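/- \textbf{Setting.} Let $B$ be a closed manifold with a Riemannian metric $g_B$ and Levi-Civita connection $\nabla^B$. For a smooth submersion $\pi : X \to B$ with a Riemannian metric on $X$, let $T(X/B)=\ker d\pi$, let $P : TX \to T(X/B)$ be the orthogonal projection, let $g_0(u,v)=g(Pu,Pv)$, $\nabla^{X/B}=P\nabla^X P$, and, for $U$ vertical, $Z,Z'$ horizontal and $\mathcal S,\Omega$ extended by zero, let $\mathcal S(U,Z)=\nabla^{X/B}_ZU-P[Z,U]$, $\Omega(Z,Z')=-P[Z,Z']$ and \[ \omega(v)(y,z)=g_0(\mathcal S(v,y),z)-g_0(\mathcal S(v,z),y)+\tfrac12 g_0(\Omega(v,z),y)-\tfrac12 g_0(\Omega(v,y),z)+\tfrac12 g_0(\Omega(y,z),v). \] Let $E\to X$ be a family of Clifford modules (Dirac bundles): a Hermitian vector bundle with a skew-adjoint Clifford action $\mathrm{cl}$ of $T^*(X/B)$, $\mathrm{cl}(\alpha)^2=-|\alpha|^2$, and a unitary Clifford connection $\nabla^E$. Put $\mathbb E=\pi^*\Lambda T^*B\otimes E$, with the degenerate Clifford action $m_0(\alpha)(\beta\otimes u)=(\alpha_H\wedge\beta)\otimes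 u+(-1)^{\deg\beta}\beta\otimes\mathrm{cl}(\alpha_V)u$, where $\alpha=\alpha_H+\alpha_V$ is the splitting into horizontal and vertical parts, and the connection $\nabla^{\mathbb E,0}=\pi^*\nabla^B\otimes1+1\otimes\nabla^E+\tfrac12m_0(\omega)$, where $m_0(\omega(v))=\tfrac12\sum_{a,b}\omega(v)(e_a,e_b)m_0(e^a)m_0(e^b)$. The Bismut superconnection is $A=\sum_jm_0(e^j)\nabla^{\mathbb E,0}_{e_j}$, for a local frame $(e_j)$ of $TX$ with dual coframe $(e^j)$. The vertical Dirac operator is $D=\sum_j\mathrm{cl}(e^j)\nabla^E_{e_j}$, for a frame of $T(X/B)$. $A_{[j]}$ denotes the part of $A$ that maps $\Gamma(E)$ to $\Gamma(\pi^*\Lambda^jT^*B\otimes E)$. Let $Y\to B$ be such a family with $Y$ closed and with Clifford modules $E_Y\to Y$. Let $f_0:Y\to S^1$ be smooth, $\hat Y=\{(t,y)\in\mathbb R\times Y: e^{2\pi it}=f_0(y)\}$ with $f(t,y)=t$, $p(t,y)=y$ and $(t,y)+m=(t+m,y)$ for $m\in\mathbb Z$; let $df$ denote the one-form $f_0^*(d\theta)$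 on $Y$ (with $\int_{S^1}d\theta=1$), $d_{Y/B}f$ its vertical part (its restriction to $T(Y/B)$) and $\pi^*d_Bf$ its horizontal part. Let $M\to B$ with $E\to M$ be such a family (with $M$ not necessarily compact) that is end-periodic with furled-up family $Y\to B$, $E_Y$: outside a compact set, $M$ is diffeomorphic over $B$ to $\{f>0\}\subset\hat Y$, and there the metric and $E$ with its Hermitian metric, Clifford action and connection are identified with the lifts by $p$ of the data of $Y$ and $E_Y$. Let $A$, $D$ and $A(Y)$, $D(Y)$ be the Bismut superconnections and Dirac operators of $M$ and of $Y$. An operator on sections of $\mathbb E\to M$ is end-periodic if over the end it coincides with the lift $p^*P$ to $p^*\mathbb E_Y\to\hat Y$ of an operator $P$ on sections of $\mathbb E_Y$; $N=p^*P$ is its normal operator. For $\xi\in\mathbb C^\times$ choose a logarithm $\log\xi$, put $\xi^t=e^{t\log\xi}$, and let \[ (\mathcal F_\xi u)(p(x))=\xi^{f(x)}\sum_{m\in\mathbb Z}\xi^m\,u(x+m),\qquad u\in C_c^\infty(\hat Y;p^*\mathbb E_Y), \] be the Fourier--Laplace transform. The indicial family at $\xi$ of an end-periodic operator with normal operator $N$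 is the operator $Q$ on smooth sections of $\mathbb E_Y$ determined by $\mathcal F_\xi\circ N=Q\circ\mathcal F_\xi$ on $C_c^\infty(\hat Y;p^*\mathbb E_Y)$. Operators $\Gamma(E)\to\Gamma(\mathbb E)$ such as $D$ and $A_{[j]}$ are extended by zero to forms of positive degree. \textbf{Proposition.} On sections of $E\to M$ and of $E_Y\to Y$, respectively, \[ A=D+A_{[1]}+A_{[2]},\qquad A(Y)=D(Y)+A_{[1]}(Y)+A_{[2]}(Y). \] For every $\xi\in\mathbb C^\times$ and every choice of $\log\xi$, the operator $A$ is end-periodic, and its indicial family at $\xi$ exists, is unique, and equals \[ A(Y)(\xi)=A(Y)-\log(\xi)\,m_0(df). \] Likewise the indicial families of $D$, $A_{[1]}$ and $A_{[2]}$ exist, are unique, and are \[ D(Y)(\xi)=D(Y)-\log(\xi)\,\mathrm{cl}(d_{Y/B}f),\qquad A_{[1]}(Y)(\xi)=A_{[1]}(Y)-\log(\xi)\,\pi^*d_Bf\wedge,\qquad A_{[2]}(Y)(\xi)=A_{[2]}(Y), \] and on sections of $E_Y$ \[ A(Y)-\log(\xi)\,m_0(df)=\bigl(D(Y)-\log(\xi)\,\mathrm{cl}(d_{Y/B}f)\bigr)+\bigl(A_{[1]}(Y)-\log(\xi)\,\pi^*d_Bf\wedge\bigr)+A_{[2]}(Y).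 \] -/

import Mathlib

open Bundle Manifold
open scoped ContDiff Topology

set_option linter.unusedSectionVars false

noncomputable section

namespace EndPeriodic

theorem exists_orthogonal_rightInverse {T W : Type*} [AddCommGroup T] [Module ℝ T]
    [FiniteDimensional ℝ T] [AddCommGroup W] [Module ℝ W] (g : T → T → ℝ)
    (hadd : ∀ u v w, g (u + v) w = g u w + g v w) (hsmul : ∀ (c : ℝ) u w, g (c • u) w = c * g u w)
    (hsymm : ∀ u v, g u v = g v u) (hpos : ∀ v, v ≠ 0 → 0 < g v v)
    (A : T →ₗ[ℝ] W) (hA : Function.Surjective A) :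
    ∃ h : W →ₗ[ℝ] T, (∀ w, A (h w) = w) ∧ ∀ w, ∀ v ∈ LinearMap.ker A, g (h w) v = 0 := by
  let b : LinearMap.BilinForm ℝ T := LinearMap.mk₂ ℝ g hadd hsmul
    (fun u v w => by rw [hsymm, hadd, hsymm v, hsymm w])
    (fun c u v => by rw [hsymm, hsmul, hsymm v, smul_eq_mul])
  have hrefl : b.IsRefl := fun u v h => by
    change g v u = 0
    rw [hsymm]; exact h
  let K := LinearMap.ker A
  have hdisj : Disjoint K (b.orthogonal K) := by
    rw [Submodule.disjoint_def]
    intro v hv hv'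
    by_contra hne
    have h1 : g v v = 0 := hv' v hv
    exact absurd h1 (hpos v hne).ne'
  have hcompl : IsCompl K (b.orthogonal K) :=
    (LinearMap.BilinForm.isCompl_orthogonal_iff_disjoint hrefl).2 hdisj
  obtain ⟨r, hr⟩ := A.exists_rightInverse_of_surjective (LinearMap.range_eq_top.2 hA)
  refine ⟨(b.orthogonal K).projection K hcompl.symm ∘ₗ r, fun w => ?_, fun w v hv => ?_⟩
  · have h1 : r w - (b.orthogonal K).projection K hcompl.symm (r w) ∈ K := by
      refine (Submodule.projection_apply_eq_zero_iff hcompl.symm).1 ?_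
      rw [map_sub, sub_eq_zero]
      exact (Submodule.projection_apply_left hcompl.symm
        ⟨_, Submodule.projection_apply_mem hcompl.symm (r w)⟩).symm
    have h2 : A (r w) = w := LinearMap.congr_fun hr w
    have h3 : A (r w - (b.orthogonal K).projection K hcompl.symm (r w)) = 0 := h1
    rw [map_sub, h2, sub_eq_zero] at h3
    exact h3.symm
  · rw [hsymm]
    exact Submodule.projection_apply_mem hcompl.symm (r w) v hv

section Cover

variable {EY : Type*} [NormedAddCommGroup EY] [NormedSpace ℝ EY]
  {Y : Type*} [TopologicalSpace Y] [ChartedSpace EY Y]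

/-- The infinite cyclic cover of `Y` determined by `f₀ : Y → S¹`, i.e. the fibre product
`{(t, y) | exp (2 π i t) = f₀ y}`, with `f (t, y) = t` and `p (t, y) = y`. -/
@[ext]
structure CyclicCover (f₀ : C^∞⟮𝓘(ℝ, EY), Y; 𝓡 1, Circle⟯) where
  /-- the real valued function `f` -/
  height : ℝ
  /-- the covering projection `p` -/
  proj : Y
  exp_height : Circle.exp (2 * Real.pi * height) = f₀ proj

namespace CyclicCover

variable {f₀ : C^∞⟮𝓘(ℝ, EY), Y; 𝓡 1, Circle⟯}

/-- The cyclic cover carries the topology of a subspace of `ℝ × Y`. -/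
instance : TopologicalSpace (CyclicCover f₀) :=
  TopologicalSpace.induced (fun x => (x.height, x.proj)) inferInstance

theorem isInducing : Topology.IsInducing (fun x : CyclicCover f₀ => (x.height, x.proj)) := ⟨rfl⟩

theorem exp_add_int (t : ℝ) (m : ℤ) :
    Circle.exp (2 * Real.pi * (t + m)) = Circle.exp (2 * Real.pi * t) := by
  have h : 2 * Real.pi * (t + m) = 2 * Real.pi * t + m * (2 * Real.pi) := by ring
  rw [h]
  exact (Circle.periodic_exp.int_mul m) _

/-- The action `x ↦ x + m` of the integers by deck transformations. -/
def deck (m : ℤ) (x : CyclicCover f₀) : CyclicCover f₀ :=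
  ⟨x.height + m, x.proj, (exp_add_int x.height m).trans x.exp_height⟩

variable (f₀) in
/-- A chosen point of the cyclic cover above a point of `Y`. -/
def lift (y : Y) : CyclicCover f₀ :=
  ⟨Complex.arg (f₀ y) / (2 * Real.pi), y, by
    rw [mul_div_cancel₀ _ (by positivity)]
    exact Circle.exp_arg _⟩

theorem isLocalHomeomorph_proj : IsLocalHomeomorph (proj : CyclicCover f₀ → Y) := by
  classical
  have hexp : IsLocalHomeomorph (fun t : ℝ => Circle.exp (2 * Real.pi * t)) :=
    isLocalHomeomorph_circleExp.comp
      (Homeomorph.mulLeft₀ (2 * Real.pi) (by positivity)).isLocalHomeomorph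
  have hf : Continuous f₀ := f₀.contMDiff.continuous
  intro x
  obtain ⟨e, hx, he⟩ := hexp x.height
  have he' : ∀ t, e t = Circle.exp (2 * Real.pi * t) := fun t => (congrFun he t).symm
  let inv : Y → CyclicCover f₀ := fun y =>
    if h : f₀ y ∈ e.target then ⟨e.symm (f₀ y), y, by rw [← he', e.right_inv h]⟩ else x
  have inv_height : ∀ y, f₀ y ∈ e.target → (inv y).height = e.symm (f₀ y) := fun y h => by
    simp only [inv, dif_pos h]
  have inv_proj : ∀ y, f₀ y ∈ e.target → (inv y).proj = y := fun y h => by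
    simp only [inv, dif_pos h]
  have hmem : ∀ z : CyclicCover f₀, z.height ∈ e.source → f₀ z.proj ∈ e.target := fun z hz => by
    rw [← z.exp_height, ← he']
    exact e.map_source hz
  have hpair : Continuous (fun z : CyclicCover f₀ => (z.height, z.proj)) := isInducing.continuous
  refine ⟨{ toFun := proj
            invFun := inv
            source := {z | z.height ∈ e.source}
            target := {y | f₀ y ∈ e.target}
            map_source' := hmem
            map_target' := fun y hy => by
              change (inv y).height ∈ e.source
              rw [inv_height y hy]
              exact e.map_target hy
            left_inv' := fun z hz => by
              refine CyclicCover.ext ?_ (inv_proj _ (hmem z hz))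
              rw [inv_height _ (hmem z hz), ← z.exp_height, ← he', e.left_inv hz]
            right_inv' := fun y hy => inv_proj y hy
            open_source := e.open_source.preimage hpair.fst
            open_target := e.open_target.preimage hf
            continuousOn_toFun := hpair.snd.continuousOn
            continuousOn_invFun := ?_ }, hx, rfl⟩
  rw [isInducing.continuousOn_iff]
  refine ContinuousOn.congr (f := fun y => (e.symm (f₀ y), y)) ?_ (fun y hy => ?_)
  · exact (e.continuousOn_symm.comp hf.continuousOn (fun _ h => h)).prodMk continuousOn_id
  · exact Prod.ext (inv_height y hy) (inv_proj y hy)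

/-- The manifold structure of the cyclic cover is the one that makes the covering projection a
local diffeomorphism. -/
instance : ChartedSpace EY (CyclicCover f₀) where
  atlas := {e | ∃ x : CyclicCover f₀,
    e = (isLocalHomeomorph_proj.localInverseAt x).symm.trans (chartAt EY x.proj)}
  chartAt x := (isLocalHomeomorph_proj.localInverseAt x).symm.trans (chartAt EY x.proj)
  mem_chart_source x := by simp
  chart_mem_atlas x := ⟨x, rfl⟩

instance [IsManifold 𝓘(ℝ, EY) ∞ Y] : IsManifold 𝓘(ℝ, EY) ∞ (CyclicCover f₀) := by
  refine isManifold_of_contDiffOn _ _ _ ?_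
  rintro _ _ ⟨x, rfl⟩ ⟨x', rfl⟩
  have h := (contDiffGroupoid ∞ 𝓘(ℝ, EY)).compatible (chart_mem_atlas EY x.proj)
    (chart_mem_atlas EY x'.proj)
  rw [contDiffGroupoid, mem_groupoid_of_pregroupoid] at h
  refine h.1.congr_mono (fun v hv => ?_) (fun v hv => ?_)
  · simp only [modelWithCornersSelf_coe, Set.mem_inter_iff] at hv
    simp at hv ⊢
    rw [isLocalHomeomorph_proj.apply_localInverseAt_of_mem hv.1.2]
  · simp at hv ⊢
    rw [isLocalHomeomorph_proj.apply_localInverseAt_of_mem hv.1.2] at hv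
    exact ⟨hv.1.1, hv.2.2⟩

end CyclicCover
end Cover


section Alternating

variable {T W : Type*} [AddCommGroup T] [Module ℝ T] [AddCommGroup W] [Module ℝ W]

/-- The derivation action of an endomorphism on alternating maps is alternating. -/
theorem exists_derivation {k : ℕ} (e : T [⋀^Fin k]→ₗ[ℝ] W) (Γ : T →ₗ[ℝ] T) :
    ∃ a : T [⋀^Fin k]→ₗ[ℝ] W, ∀ w, a w = ∑ i, e (Function.update w i (Γ (w i))) := by
  classical
  have hm : ∀ i : Fin k, ∃ a : MultilinearMap ℝ (fun _ : Fin k => T) W,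
      ∀ w, a w = e (Function.update w i (Γ (w i))) := fun i => by
    refine ⟨e.toMultilinearMap.compLinearMap
      (fun j => if j = i then Γ else LinearMap.id), fun w => ?_⟩
    rw [MultilinearMap.compLinearMap_apply]
    change e _ = e _
    congr 1
    funext j
    by_cases hj : j = i
    · subst hj; simp
    · simp [hj]
  choose a ha using hm
  refine ⟨{ (∑ i, a i) with map_eq_zero_of_eq' := fun w i j hij hne => ?_ }, fun w => ?_⟩
  · change (∑ l, a l) w = 0
    rw [_root_.sum_apply, Finset.sum_congr rfl (fun l _ => ha l w),
      Fintype.sum_eq_add i j hne (fun l hl => ?_)]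
    · have h1 : Function.update w j (Γ (w j)) =
          Function.update w i (Γ (w i)) ∘ Equiv.swap i j := by
        funext l
        rcases eq_or_ne l i with rfl | hli
        · simp [hne, hne.symm, hij]
        rcases eq_or_ne l j with rfl | hlj
        · simp [hij]
        · simp [Equiv.swap_apply_of_ne_of_ne hli hlj, hli, hlj]
      rw [h1, e.map_swap _ hne, add_neg_cancel]
    · exact e.map_eq_zero_of_eq _ (by simp [hl.1.symm, hl.2.symm, hij]) hne
  · change (∑ l, a l) w = _
    rw [_root_.sum_apply]
    exact Finset.sum_congr rfl (fun l _ => ha l w)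

end Alternating

/-! ## Riemannian structures, families and Clifford modules -/

section Geometry

/-- A smooth Riemannian metric on a manifold together with its Levi-Civita connection, which is the
unique torsion free metric connection. The convention is that `nabla W x v` is `∇_v W` at `x`. -/
structure RiemannianStructure (E : Type*) [NormedAddCommGroup E] [NormedSpace ℝ E]
    (M : Type*) [TopologicalSpace M] [ChartedSpace E M] [IsManifold 𝓘(ℝ, E) ∞ M] where
  metric : ContMDiffRiemannianMetric 𝓘(ℝ, E) ∞ E (fun x : M => TangentSpace 𝓘(ℝ, E) x)
  nabla : CovariantDerivative 𝓘(ℝ, E) E (fun x : M => TangentSpace 𝓘(ℝ, E) x)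
  nabla_smooth : CovariantDerivative.ContMDiffCovariantDerivative nabla ∞
  torsion_free : ∀ (x : M) (U W : ∀ x : M, TangentSpace 𝓘(ℝ, E) x),
    MDiffAt (T% U) x → MDiffAt (T% W) x →
      nabla W x (U x) - nabla U x (W x) = VectorField.mlieBracket 𝓘(ℝ, E) U W x
  metric_compatible : ∀ (x : M) (U W : ∀ x : M, TangentSpace 𝓘(ℝ, E) x),
    MDiffAt (T% U) x → MDiffAt (T% W) x → ∀ v : TangentSpace 𝓘(ℝ, E) x,
      mfderiv 𝓘(ℝ, E) 𝓘(ℝ, ℝ) (fun x' => metric.inner x' (U x') (W x')) x v =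
        metric.inner x (nabla U x v) (W x) + metric.inner x (U x) (nabla W x v)

variable {EB : Type*} [NormedAddCommGroup EB] [NormedSpace ℝ EB]
  {B : Type*} [TopologicalSpace B] [ChartedSpace EB B] [IsManifold 𝓘(ℝ, EB) ∞ B]
  {EX : Type*} [NormedAddCommGroup EX] [NormedSpace ℝ EX] [FiniteDimensional ℝ EX]
  {X : Type*} [TopologicalSpace X] [ChartedSpace EX X] [IsManifold 𝓘(ℝ, EX) ∞ X]

instance (x : X) : FiniteDimensional ℝ (TangentSpace 𝓘(ℝ, EX) x) :=
  inferInstanceAs (FiniteDimensional ℝ EX)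

/-- A family of manifolds `ϖ : X → B` (a smooth submersion) with a Riemannian metric on the total
space. -/
structure RiemannianFamily (ϖ : X → B) where
  smooth_proj : ContMDiff 𝓘(ℝ, EX) 𝓘(ℝ, EB) ∞ ϖ
  submersion : ∀ x, Function.Surjective (mfderiv 𝓘(ℝ, EX) 𝓘(ℝ, EB) ϖ x)
  riem : RiemannianStructure EX X

variable (EB EX) in
/-- The vertical tangent space `T_x(X/B)`. -/
abbrev Vertical (ϖ : X → B) (x : X) : Submodule ℝ (TangentSpace 𝓘(ℝ, EX) x) :=
  LinearMap.ker (mfderiv 𝓘(ℝ, EX) 𝓘(ℝ, EB) ϖ x).toLinearMap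

namespace RiemannianFamily

variable {ϖ : X → B} (G : RiemannianFamily (EB := EB) (EX := EX) ϖ)

theorem exists_horLift (x : X) :
    ∃ h : TangentSpace 𝓘(ℝ, EB) (ϖ x) →ₗ[ℝ] TangentSpace 𝓘(ℝ, EX) x,
      (∀ w, (mfderiv 𝓘(ℝ, EX) 𝓘(ℝ, EB) ϖ x).toLinearMap (h w) = w) ∧
        ∀ w, ∀ v ∈ Vertical EB EX ϖ x, G.riem.metric.inner x (h w) v = 0 :=
  exists_orthogonal_rightInverse (fun u v => G.riem.metric.inner x u v)
    (fun u v w => by simp) (fun c u w => by simp) (fun u v => G.riem.metric.symm x u v)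
    (fun v hv => G.riem.metric.pos x v hv) _ (G.submersion x)

/-- The horizontal lift: `dϖ (horLift x w) = w` and `horLift x w` is orthogonal to `T(X/B)`. -/
def horLift (x : X) : TangentSpace 𝓘(ℝ, EB) (ϖ x) →ₗ[ℝ] TangentSpace 𝓘(ℝ, EX) x :=
  (G.exists_horLift x).choose

/-- The projection onto the horizontal space `T(X/B)^⊥`. -/
def horProj (x : X) : TangentSpace 𝓘(ℝ, EX) x →ₗ[ℝ] TangentSpace 𝓘(ℝ, EX) x :=
  G.horLift x ∘ₗ (mfderiv 𝓘(ℝ, EX) 𝓘(ℝ, EB) ϖ x).toLinearMap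

/-- The orthogonal projection onto the vertical tangent space. -/
def vertProj (x : X) : TangentSpace 𝓘(ℝ, EX) x →ₗ[ℝ] TangentSpace 𝓘(ℝ, EX) x :=
  LinearMap.id - G.horProj x

/-- The second fundamental form `S(u, z) = ∇^{X/B}_Z U - P [Z, U]` at `x`, where `U` is a vertical
field with value `P u`, `Z` is a horizontal field with value `(1 - P) z`, `P` is the vertical
projection, and `∇^{X/B} = P ∇^X P`. -/
def secondFundamentalForm (x : X) (u z : TangentSpace 𝓘(ℝ, EX) x) : TangentSpace 𝓘(ℝ, EX) x :=
  let U : ∀ x' : X, TangentSpace 𝓘(ℝ, EX) x' := fun x' =>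
    G.vertProj x' (FiberBundle.extend (E := fun x' : X => TangentSpace 𝓘(ℝ, EX) x') EX u x')
  let Z : ∀ x' : X, TangentSpace 𝓘(ℝ, EX) x' := fun x' =>
    G.horProj x' (FiberBundle.extend (E := fun x' : X => TangentSpace 𝓘(ℝ, EX) x') EX z x')
  G.vertProj x (G.riem.nabla U x (Z x)) - G.vertProj x (VectorField.mlieBracket 𝓘(ℝ, EX) Z U x)

/-- The curvature `Ω(u, z) = -P [U, Z]` of the horizontal distribution at `x`, where `U`, `Z` are
horizontal fields whose values are the horizontal parts of `u`, `z`. -/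
def horCurvature (x : X) (u z : TangentSpace 𝓘(ℝ, EX) x) : TangentSpace 𝓘(ℝ, EX) x :=
  let U : ∀ x' : X, TangentSpace 𝓘(ℝ, EX) x' := fun x' =>
    G.horProj x' (FiberBundle.extend (E := fun x' : X => TangentSpace 𝓘(ℝ, EX) x') EX u x')
  let Z : ∀ x' : X, TangentSpace 𝓘(ℝ, EX) x' := fun x' =>
    G.horProj x' (FiberBundle.extend (E := fun x' : X => TangentSpace 𝓘(ℝ, EX) x') EX z x')
  G.vertProj x (-VectorField.mlieBracket 𝓘(ℝ, EX) U Z x)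

/-- The degenerate metric `g₀(u, v) = g(P u, P v)`. -/
def metric₀ (x : X) (u v : TangentSpace 𝓘(ℝ, EX) x) : ℝ :=
  G.riem.metric.inner x (G.vertProj x u) (G.vertProj x v)

/-- The one-form `ω` with values in two-forms that is built from the second fundamental form and
the curvature of the family, `omega x v y z = ω(v)(y, z)`. -/
def omega (x : X) (v y z : TangentSpace 𝓘(ℝ, EX) x) : ℝ :=
  G.metric₀ x (G.secondFundamentalForm x v y) z - G.metric₀ x (G.secondFundamentalForm x v z) y
    + (1 / 2) * G.metric₀ x (G.horCurvature x v z) y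
    - (1 / 2) * G.metric₀ x (G.horCurvature x v y) z
    + (1 / 2) * G.metric₀ x (G.horCurvature x y z) v

/-- The covector on the vertical tangent space that is metrically dual to `v`. -/
def vertFlat (x : X) (v : TangentSpace 𝓘(ℝ, EX) x) : Module.Dual ℝ (Vertical EB EX ϖ x) :=
  (G.riem.metric.inner x v).toLinearMap.domRestrict _

end RiemannianFamily

variable {F : Type*} [NormedAddCommGroup F] [NormedSpace ℝ F] [FiniteDimensional ℝ F]
  {V : X → Type*} [TopologicalSpace (TotalSpace F V)] [∀ x, AddCommGroup (V x)]
  [∀ x, Module ℝ (V x)] [∀ x, Module ℂ (V x)] [∀ x, IsScalarTower ℝ ℂ (V x)]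
  [∀ x, TopologicalSpace (V x)] [∀ x, IsTopologicalAddGroup (V x)] [∀ x, ContinuousSMul ℝ (V x)]
  [FiberBundle F V] [VectorBundle ℝ F V] [ContMDiffVectorBundle ∞ F V 𝓘(ℝ, EX)]

/-- A family of Clifford modules (Dirac bundles) `V` over the fibres of `ϖ : X → B`: a smooth
complex vector bundle `V → X` with a Hermitian metric, a skew-adjoint Clifford action of the
vertical cotangent bundle `T^*(X/B)` with `cl(α)² = -|α|²`, and a unitary Clifford connection. -/
structure CliffordFamily {ϖ : X → B} (G : RiemannianFamily (EB := EB) (EX := EX) ϖ)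
    (F : Type*) [NormedAddCommGroup F] [NormedSpace ℝ F]
    (V : X → Type*) [TopologicalSpace (TotalSpace F V)] [∀ x, AddCommGroup (V x)]
    [∀ x, Module ℝ (V x)] [∀ x, Module ℂ (V x)]
    [∀ x, TopologicalSpace (V x)] [∀ x, IsTopologicalAddGroup (V x)] [∀ x, ContinuousSMul ℝ (V x)]
    [FiberBundle F V] [VectorBundle ℝ F V] where
  /-- multiplication by `i` is a smooth bundle map -/
  complex_smooth : ∀ s : ∀ x, V x, CMDiff ∞ (T% s) → CMDiff ∞ (T% (fun x => Complex.I • s x))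
  /-- the Hermitian metric, conjugate linear in the first variable -/
  herm : ∀ x, V x →ₗ⋆[ℂ] V x →ₗ[ℂ] ℂ
  herm_conj : ∀ x u w, herm x w u = (starRingEnd ℂ) (herm x u w)
  herm_pos : ∀ x u, u ≠ 0 → 0 < (herm x u u).re
  herm_smooth : ∀ s t : ∀ x, V x, CMDiff ∞ (T% s) → CMDiff ∞ (T% t) →
    ContMDiff 𝓘(ℝ, EX) 𝓘(ℝ, ℂ) ∞ (fun x => herm x (s x) (t x))
  /-- the Clifford action of vertical covectors -/
  cl : ∀ x, Module.Dual ℝ (Vertical EB EX ϖ x) →ₗ[ℝ] (V x →ₗ[ℂ] V x)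
  cl_sq : ∀ x, ∀ v ∈ Vertical EB EX ϖ x, ∀ u,
    cl x (G.vertFlat x v) (cl x (G.vertFlat x v) u) = -(G.riem.metric.inner x v v • u)
  cl_skew : ∀ x α u w, herm x (cl x α u) w = -herm x u (cl x α w)
  /-- smoothness of the Clifford action, tested on the metric duals of vector fields -/
  cl_smooth : ∀ (W : ∀ x : X, TangentSpace 𝓘(ℝ, EX) x) (s : ∀ x, V x),
    CMDiff ∞ (T% W) → CMDiff ∞ (T% s) → CMDiff ∞ (T% (fun x => cl x (G.vertFlat x (W x)) (s x)))
  /-- the Clifford connection; `conn s x v` is `∇_v s` at `x` -/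
  conn : CovariantDerivative 𝓘(ℝ, EX) F V
  conn_smooth : CovariantDerivative.ContMDiffCovariantDerivative conn ∞
  conn_complex : ∀ x (s : ∀ x, V x), MDiffAt (T% s) x → ∀ v,
    conn (fun x => Complex.I • s x) x v = Complex.I • conn s x v
  conn_unitary : ∀ x (s t : ∀ x, V x), MDiffAt (T% s) x → MDiffAt (T% t) x →
    ∀ v : TangentSpace 𝓘(ℝ, EX) x,
      mfderiv 𝓘(ℝ, EX) 𝓘(ℝ, ℂ) (fun x' => herm x' (s x') (t x')) x v =
        herm x (conn s x v) (t x) + herm x (s x) (conn t x v)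
  /-- `∇_v (cl(α) s) = cl(∇^{X/B}_v α) s + cl(α) ∇_v s`, where `α` is the vertical covector field
  that is metrically dual to a vertical field `W` and `∇^{X/B} = P ∇^X P` -/
  conn_clifford : ∀ x (W : ∀ x : X, TangentSpace 𝓘(ℝ, EX) x) (s : ∀ x, V x),
    (∀ x, W x ∈ Vertical EB EX ϖ x) → MDiffAt (T% W) x → MDiffAt (T% s) x → ∀ v,
      conn (fun x' => cl x' (G.vertFlat x' (W x')) (s x')) x v =
        cl x (G.vertFlat x (G.vertProj x (G.riem.nabla W x v))) (s x)
          + cl x (G.vertFlat x (W x)) (conn s x v)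

/-! ## Forms on the base with values in `V` -/

variable (EB) in
/-- The fibre at `x` of `𝔼 = ϖ^* Λ T^*B ⊗ V`, realized as alternating forms on `T_{ϖ x} B` with
values in `V x`; the `k`-th entry is the component of degree `k`. -/
abbrev FormFiber (ϖ : X → B) (V : X → Type*) [∀ x, AddCommGroup (V x)] [∀ x, Module ℝ (V x)]
    (x : X) : Type _ :=
  ∀ k : ℕ, (TangentSpace 𝓘(ℝ, EB) (ϖ x)) [⋀^Fin k]→ₗ[ℝ] V x

variable (EX F) in
/-- Smoothness of a section `x ↦ s x ∈ 𝔼_{q x}` along a map `q` (i.e. of a section of `q^* 𝔼`):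
inserting vector fields of the base that are smooth near `ϖ (q x)` gives a smooth section of `V`
along `q`. -/
def SmoothAlong {EX' : Type*} [NormedAddCommGroup EX'] [NormedSpace ℝ EX']
    {X' : Type*} [TopologicalSpace X'] [ChartedSpace EX' X'] (ϖ : X → B) (q : X' → X)
    (s : ∀ x : X', FormFiber EB ϖ V (q x)) : Prop :=
  ∀ (x : X') (k : ℕ) (W : Fin k → ∀ b : B, TangentSpace 𝓘(ℝ, EB) b),
    (∀ i, CMDiffAt ∞ (T% (W i)) (ϖ (q x))) →
      ContMDiffAt 𝓘(ℝ, EX') (𝓘(ℝ, EX).prod 𝓘(ℝ, F)) ∞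
        (fun x' => TotalSpace.mk' F (E := V) (q x') (s x' k fun i => W i (ϖ (q x')))) x

variable (EX F) in
/-- Smooth sections of `𝔼 → X`. -/
def SmoothForm (ϖ : X → B) (s : ∀ x : X, FormFiber EB ϖ V x) : Prop :=
  SmoothAlong EX F (EX' := EX) ϖ (fun x => x) s

/-- A section of `V` regarded as a section of `𝔼` of form degree `0`. -/
def ofDegZero (ϖ : X → B) (u : ∀ x, V x) : ∀ x, FormFiber EB ϖ V x := fun x =>
  Pi.single 0 (AlternatingMap.constOfIsEmpty ℝ _ (Fin 0) (u x))

/-- The component of form degree `0` of a section of `𝔼`. -/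
def degZero {ϖ : X → B} (s : ∀ x, FormFiber EB ϖ V x) : ∀ x, V x := fun x => s x 0 Fin.elim0

/-- The part `P_[j]` of an operator `P` that maps sections of `V` to `V`-valued forms of degree `j`
(extended by zero to forms of positive degree). -/
def component {ϖ : X → B} (j : ℕ)
    (P : (∀ x, FormFiber EB ϖ V x) → ∀ x, FormFiber EB ϖ V x) :
    (∀ x, FormFiber EB ϖ V x) → ∀ x, FormFiber EB ϖ V x := fun s x =>
  Pi.single j (P (ofDegZero ϖ (degZero s)) x j)

/-! ## The degenerate Clifford action and the Bismut superconnection -/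

namespace CliffordFamily

variable {ϖ : X → B} {G : RiemannianFamily (EB := EB) (EX := EX) ϖ} (C : CliffordFamily G F V)

/-- The Clifford action `cl(α_V)` of the vertical part of a covector on `V`-valued `k`-forms
(without sign). -/
def clForm {k : ℕ} (x : X) (α : Module.Dual ℝ (TangentSpace 𝓘(ℝ, EX) x))
    (e : (TangentSpace 𝓘(ℝ, EB) (ϖ x)) [⋀^Fin k]→ₗ[ℝ] V x) :
    (TangentSpace 𝓘(ℝ, EB) (ϖ x)) [⋀^Fin k]→ₗ[ℝ] V x :=
  ((C.cl x (α.domRestrict (Vertical EB EX ϖ x))).restrictScalars ℝ).compAlternatingMap e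

/-- The exterior multiplication `α_H ∧` by the horizontal part of a covector. -/
def wedgeForm (_C : CliffordFamily G F V) {k : ℕ} (x : X)
    (α : Module.Dual ℝ (TangentSpace 𝓘(ℝ, EX) x))
    (e : (TangentSpace 𝓘(ℝ, EB) (ϖ x)) [⋀^Fin k]→ₗ[ℝ] V x) :
    (TangentSpace 𝓘(ℝ, EB) (ϖ x)) [⋀^Fin (k + 1)]→ₗ[ℝ] V x :=
  AlternatingMap.alternatizeUncurryFin (LinearMap.smulRight (α ∘ₗ G.horLift x) e)

/-- The degenerate Clifford action `m₀(α)(β ⊗ u) = α_H ∧ β ⊗ u + (-1)^{deg β} β ⊗ cl(α_V) u`. -/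
def m₀ (x : X) (α : Module.Dual ℝ (TangentSpace 𝓘(ℝ, EX) x)) (e : FormFiber EB ϖ V x) :
    FormFiber EB ϖ V x
  | 0 => C.clForm x α (e 0)
  | k + 1 => C.wedgeForm x α (e k) + (-1 : ℝ) ^ (k + 1) • C.clForm x α (e (k + 1))

/-- The `V`-valued one-form `α_H ⊗ u` (that is, `α_H ∧ u`), for the horizontal part of a
covector. -/
def horTensor (C : CliffordFamily G F V) (x : X) (α : Module.Dual ℝ (TangentSpace 𝓘(ℝ, EX) x))
    (u : V x) : FormFiber EB ϖ V x :=
  Pi.single (0 + 1) (C.wedgeForm x α (AlternatingMap.constOfIsEmpty ℝ _ (Fin 0) u))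

/-- The formula for the value on `w₁, …, w_k` of `(ϖ^*∇^B ⊗ 1 + 1 ⊗ ∇^V)_v s` in degree `k`:
`∇^V_v (s(W₁, …, W_k)) - ∑ i, s(W₁, …, ∇^B_{dϖ v} W_i, …, W_k)` for vector fields `W_i` of the base
extending the `w_i`. -/
def tensorConnFun (SB : RiemannianStructure EB B) (s : ∀ x, FormFiber EB ϖ V x) (x : X)
    (v : TangentSpace 𝓘(ℝ, EX) x) (k : ℕ) (w : Fin k → TangentSpace 𝓘(ℝ, EB) (ϖ x)) : V x :=
  let W : TangentSpace 𝓘(ℝ, EB) (ϖ x) → ∀ b : B, TangentSpace 𝓘(ℝ, EB) b := fun a =>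
    FiberBundle.extend (E := fun b : B => TangentSpace 𝓘(ℝ, EB) b) EB a
  C.conn (fun x' => s x' k fun i => W (w i) (ϖ x')) x v -
    ∑ i, s x k (Function.update w i (SB.nabla (W (w i)) (ϖ x) (mfderiv 𝓘(ℝ, EX) 𝓘(ℝ, EB) ϖ x v)))

open Classical in
/-- The connection `ϖ^*∇^B ⊗ 1 + 1 ⊗ ∇^V` on `𝔼`. For smooth `s` it is given by `tensorConnFun`,
see `tensorConn_apply`; it is set to zero on sections for which that expression is not
alternating. -/
def tensorConn (SB : RiemannianStructure EB B) (s : ∀ x, FormFiber EB ϖ V x) (x : X)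
    (v : TangentSpace 𝓘(ℝ, EX) x) : FormFiber EB ϖ V x := fun k =>
  if h : ∃ a : (TangentSpace 𝓘(ℝ, EB) (ϖ x)) [⋀^Fin k]→ₗ[ℝ] V x,
    ∀ w, a w = C.tensorConnFun SB s x v k w then h.choose else 0

/-- The extension of tangent vectors of the base to vector fields is linear near the given point. -/
theorem exists_extend_linear (b₀ : B) :
    ∃ L : ∀ b, TangentSpace 𝓘(ℝ, EB) b₀ →ₗ[ℝ] TangentSpace 𝓘(ℝ, EB) b, ∀ᶠ b in 𝓝 b₀, ∀ a,
      FiberBundle.extend (E := fun b : B => TangentSpace 𝓘(ℝ, EB) b) EB a b = L b a := by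
  refine ⟨fun b => (trivializationAt EB (fun b : B => TangentSpace 𝓘(ℝ, EB) b) b₀).symmₗ ℝ b ∘ₗ
      (trivializationAt EB (fun b : B => TangentSpace 𝓘(ℝ, EB) b) b₀).linearMapAt ℝ b₀, ?_⟩
  filter_upwards [(trivializationAt EB (fun b : B => TangentSpace 𝓘(ℝ, EB) b)
    b₀).open_baseSet.mem_nhds (FiberBundle.mem_baseSet_trivializationAt' b₀)] with b hb a
  rw [LinearMap.comp_apply, Bundle.Trivialization.symmₗ_apply _ hb,
    Bundle.Trivialization.coe_linearMapAt_of_mem _ (FiberBundle.mem_baseSet_trivializationAt' b₀)]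
  rfl

/-- On smooth sections the connection `ϖ^*∇^B ⊗ 1 + 1 ⊗ ∇^V` is given by its usual formula. -/
theorem tensorConn_apply [FiniteDimensional ℝ EB] (SB : RiemannianStructure EB B)
    {s : ∀ x, FormFiber EB ϖ V x} (hs : SmoothForm EX F ϖ s) (x : X)
    (v : TangentSpace 𝓘(ℝ, EX) x) (k : ℕ) (w : Fin k → TangentSpace 𝓘(ℝ, EB) (ϖ x)) :
    C.tensorConn SB s x v k w = C.tensorConnFun SB s x v k w := by
  classical
  have hex : ∃ a : (TangentSpace 𝓘(ℝ, EB) (ϖ x)) [⋀^Fin k]→ₗ[ℝ] V x,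
      ∀ w, a w = C.tensorConnFun SB s x v k w := by
    obtain ⟨L, hL⟩ := exists_extend_linear (EB := EB) (ϖ x)
    have hE : ∀ a : TangentSpace 𝓘(ℝ, EB) (ϖ x), CMDiffAt ∞ (T%
        (FiberBundle.extend (E := fun b : B => TangentSpace 𝓘(ℝ, EB) b) EB a)) (ϖ x) :=
      fun a => FiberBundle.contMDiffAt_extend _ _ _
    have hLs : ∀ a : TangentSpace 𝓘(ℝ, EB) (ϖ x), CMDiffAt ∞ (T% (fun b => L b a)) (ϖ x) :=
      fun a => (hE a).congr_of_eventuallyEq (hL.mono fun b hb => by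
        change TotalSpace.mk' EB b (L b a) = _
        rw [← hb a])
    let σ : (Fin k → TangentSpace 𝓘(ℝ, EB) (ϖ x)) → ∀ x', V x' := fun w x' =>
      (s x' k).compLinearMap (L (ϖ x')) w
    have hσ : ∀ w, MDiffAt (T% (σ w)) x := fun w =>
      (hs x k (fun i b => L b (w i)) (fun i => hLs (w i))).mdifferentiableAt (by simp)
    let Γ : TangentSpace 𝓘(ℝ, EB) (ϖ x) →ₗ[ℝ] TangentSpace 𝓘(ℝ, EB) (ϖ x) :=
      { toFun := fun a =>
          SB.nabla (fun b => L b a) (ϖ x) (mfderiv 𝓘(ℝ, EX) 𝓘(ℝ, EB) ϖ x v)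
        map_add' := fun a a' => by
          have h1 : (fun b => L b (a + a')) = (fun b => L b a) + fun b => L b a' := by
            funext b; exact map_add _ _ _
          rw [h1, SB.nabla.isCovariantDerivativeOnUniv.add
            ((hLs a).mdifferentiableAt (by simp)) ((hLs a').mdifferentiableAt (by simp))]
          rfl
        map_smul' := fun c a => by
          have h1 : (fun b => L b (c • a)) = c • fun b => L b a := by
            funext b; exact map_smul _ _ _
          rw [h1, SB.nabla.isCovariantDerivativeOnUniv.smul_const c
            ((hLs a).mdifferentiableAt (by simp))]
          rfl }
    obtain ⟨a, ha⟩ := exists_derivation (s x k) Γ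
    have hadd : ∀ w i (c c' : TangentSpace 𝓘(ℝ, EB) (ϖ x)),
        σ (Function.update w i (c + c')) =
          σ (Function.update w i c) + σ (Function.update w i c') := fun w i c c' => by
      funext x'; exact AlternatingMap.map_update_add _ _ _ _ _
    have hsmul : ∀ w i (r : ℝ) (c : TangentSpace 𝓘(ℝ, EB) (ϖ x)),
        σ (Function.update w i (r • c)) = r • σ (Function.update w i c) := fun w i r c => by
      funext x'; exact AlternatingMap.map_update_smul _ _ _ _ _
    let m : (TangentSpace 𝓘(ℝ, EB) (ϖ x)) [⋀^Fin k]→ₗ[ℝ] V x :=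
      { toFun := fun w => C.conn (σ w) x v
        map_update_add' := fun {inst} w i c c' => by
          obtain rfl : inst = instDecidableEqFin k := Subsingleton.elim _ _
          rw [hadd, C.conn.isCovariantDerivativeOnUniv.add (hσ _) (hσ _)]
          rfl
        map_update_smul' := fun {inst} w i r c => by
          obtain rfl : inst = instDecidableEqFin k := Subsingleton.elim _ _
          rw [hsmul, C.conn.isCovariantDerivativeOnUniv.smul_const r (hσ _)]
          rfl
        map_eq_zero_of_eq' := fun w i j hij hne => by
          have h0 : σ w = 0 := by
            funext x'; exact AlternatingMap.map_eq_zero_of_eq _ _ hij hne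
          rw [h0, C.conn.isCovariantDerivativeOnUniv.zero]
          rfl }
    refine ⟨m - a, fun w => ?_⟩
    rw [AlternatingMap.sub_apply, ha]
    have h1 : C.conn (σ w) x v = C.conn (fun x' => s x' k fun i =>
        FiberBundle.extend (E := fun b : B => TangentSpace 𝓘(ℝ, EB) b) EB (w i) (ϖ x')) x v := by
      rw [C.conn.isCovariantDerivativeOnUniv.congr_of_eventuallyEq (hσ w) ((hs x k (fun i =>
        FiberBundle.extend (E := fun b : B => TangentSpace 𝓘(ℝ, EB) b) EB (w i))
          (fun i => hE (w i))).mdifferentiableAt (by simp)) Filter.univ_mem]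
      filter_upwards [G.smooth_proj.continuous.continuousAt.eventually hL] with x' hx'
      change s x' k (fun i => L (ϖ x') (w i)) = _
      congr 1
      funext i
      exact (hx' (w i)).symm
    have h2 : ∀ i, Γ (w i) = SB.nabla
        (FiberBundle.extend (E := fun b : B => TangentSpace 𝓘(ℝ, EB) b) EB (w i)) (ϖ x)
          (mfderiv 𝓘(ℝ, EX) 𝓘(ℝ, EB) ϖ x v) := fun i => by
      change SB.nabla (fun b => L b (w i)) (ϖ x) (mfderiv 𝓘(ℝ, EX) 𝓘(ℝ, EB) ϖ x v) = _
      rw [SB.nabla.isCovariantDerivativeOnUniv.congr_of_eventuallyEq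
        ((hLs (w i)).mdifferentiableAt (by simp)) ((hE (w i)).mdifferentiableAt (by simp))
        Filter.univ_mem]
      exact hL.mono fun b hb => (hb (w i)).symm
    simp only [h2]
    exact congrArg (fun z => z - _) h1
  rw [tensorConn, dif_pos hex]
  exact hex.choose_spec w

/-- The action `½ m₀(ω(v))`, where `m₀(ω(v)) = ½ ∑ ω(v)(e_a, e_b) m₀(e^a) m₀(e^b)` for a basis
`(e_a)` of the tangent space with dual basis `(e^a)`. -/
def halfOmega (x : X) (v : TangentSpace 𝓘(ℝ, EX) x) (e : FormFiber EB ϖ V x) :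
    FormFiber EB ϖ V x :=
  let b := Module.finBasis ℝ (TangentSpace 𝓘(ℝ, EX) x)
  (1 / 4 : ℝ) • ∑ i, ∑ j, G.omega x v (b i) (b j) • C.m₀ x (b.coord i) (C.m₀ x (b.coord j) e)

/-- The Clifford connection `∇^{𝔼,0} = ϖ^*∇^B ⊗ 1 + 1 ⊗ ∇^V + ½ m₀(ω)` on `𝔼`. -/
def conn₀ (SB : RiemannianStructure EB B) (s : ∀ x, FormFiber EB ϖ V x) (x : X)
    (v : TangentSpace 𝓘(ℝ, EX) x) : FormFiber EB ϖ V x :=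
  C.tensorConn SB s x v + C.halfOmega x v (s x)

/-- The Bismut superconnection `A = ∑ m₀(e^j) ∇^{𝔼,0}_{e_j}`, for a basis `(e_j)` of the tangent
space with dual basis `(e^j)`. -/
def bismut (SB : RiemannianStructure EB B) (s : ∀ x, FormFiber EB ϖ V x) :
    ∀ x, FormFiber EB ϖ V x := fun x =>
  let b := Module.finBasis ℝ (TangentSpace 𝓘(ℝ, EX) x)
  ∑ j, C.m₀ x (b.coord j) (C.conn₀ SB s x (b j))

/-- The vertical family of Dirac operators `D = ∑ cl(e^j) ∇^V_{e_j}`, for a basis `(e_j)` of the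
vertical tangent space with dual basis `(e^j)`. -/
def dirac (u : ∀ x, V x) : ∀ x, V x := fun x =>
  let b := Module.finBasis ℝ (Vertical EB EX ϖ x)
  ∑ j, C.cl x (b.coord j) (C.conn u x (b j))

/-- The Dirac operator `D`, extended by zero to forms of positive degree. -/
def diracForm (s : ∀ x, FormFiber EB ϖ V x) : ∀ x, FormFiber EB ϖ V x :=
  ofDegZero ϖ (C.dirac (degZero s))

end CliffordFamily

end Geometry


/-! ## The Fourier-Laplace transform, end-periodic families and indicial families -/

section Periodic

variable {EB : Type*} [NormedAddCommGroup EB] [NormedSpace ℝ EB]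
  {B : Type*} [TopologicalSpace B] [ChartedSpace EB B] [IsManifold 𝓘(ℝ, EB) ∞ B]
  {EY : Type*} [NormedAddCommGroup EY] [NormedSpace ℝ EY] [FiniteDimensional ℝ EY]
  {Y : Type*} [TopologicalSpace Y] [ChartedSpace EY Y] [IsManifold 𝓘(ℝ, EY) ∞ Y]
  {F : Type*} [NormedAddCommGroup F] [NormedSpace ℝ F]
  {V : Y → Type*} [TopologicalSpace (TotalSpace F V)] [∀ y, AddCommGroup (V y)]
  [∀ y, Module ℝ (V y)] [∀ y, Module ℂ (V y)] [∀ y, IsScalarTower ℝ ℂ (V y)]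
  [∀ y, TopologicalSpace (V y)] [∀ y, IsTopologicalAddGroup (V y)] [∀ y, ContinuousSMul ℝ (V y)]
  [FiberBundle F V] [VectorBundle ℝ F V]
  {EM : Type*} [NormedAddCommGroup EM] [NormedSpace ℝ EM] [FiniteDimensional ℝ EM]
  {M : Type*} [TopologicalSpace M] [ChartedSpace EM M] [IsManifold 𝓘(ℝ, EM) ∞ M]
  {F' : Type*} [NormedAddCommGroup F'] [NormedSpace ℝ F']
  {V' : M → Type*} [TopologicalSpace (TotalSpace F' V')] [∀ x, AddCommGroup (V' x)]
  [∀ x, Module ℝ (V' x)] [∀ x, Module ℂ (V' x)] [∀ x, IsScalarTower ℝ ℂ (V' x)]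
  [∀ x, TopologicalSpace (V' x)] [∀ x, IsTopologicalAddGroup (V' x)]
  [∀ x, ContinuousSMul ℝ (V' x)] [FiberBundle F' V'] [VectorBundle ℝ F' V']
  {f₀ : C^∞⟮𝓘(ℝ, EY), Y; 𝓡 1, Circle⟯} {ϖY : Y → B} {ϖM : M → B}

/-- The one-form `df = f₀^*(dθ)` on `Y`, where `dθ` has total integral `1`; explicitly
`df = (2 π)⁻¹ Im (conj f₀ · d f₀)`. -/
def dHeight (f₀ : C^∞⟮𝓘(ℝ, EY), Y; 𝓡 1, Circle⟯) (y : Y) :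
    Module.Dual ℝ (TangentSpace 𝓘(ℝ, EY) y) :=
  ((2 * Real.pi)⁻¹ : ℝ) • (Complex.imLm ∘ₗ
    LinearMap.mulLeft ℝ ((starRingEnd ℂ) (f₀ y : ℂ)) ∘ₗ
      (show TangentSpace 𝓘(ℝ, EY) y →L[ℝ] ℂ from
        mfderiv 𝓘(ℝ, EY) 𝓘(ℝ, ℂ) (fun y' => (f₀ y' : ℂ)) y).toLinearMap)

/-- The Fourier-Laplace transform
`(ℱ_ξ u)(p x) = ξ^{f x} ∑_{m ∈ ℤ} ξ^m u(x + m)`, where `ξ^t = exp (t L)` for a logarithm `L` of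
`ξ`; see `fourierLaplace_proj` for the independence of the point `x` above a point of `Y`. -/
def fourierLaplace (ξ L : ℂ) (u : ∀ x : CyclicCover f₀, FormFiber EB ϖY V x.proj) :
    ∀ y, FormFiber EB ϖY V y := fun y =>
  Complex.exp ((CyclicCover.lift f₀ y).height * L) •
    ∑ᶠ m : ℤ, ξ ^ m • u ((CyclicCover.lift f₀ y).deck m)

theorem fourierLaplace_proj (ξ L : ℂ) (hL : Complex.exp L = ξ)
    (u : ∀ x : CyclicCover f₀, FormFiber EB ϖY V x.proj) (x : CyclicCover f₀) :
    fourierLaplace ξ L u x.proj =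
      Complex.exp (x.height * L) • ∑ᶠ m : ℤ, ξ ^ m • u (x.deck m) := by
  have hξ : ξ ≠ 0 := hL ▸ Complex.exp_ne_zero L
  obtain ⟨n, hn⟩ := Circle.exp_eq_exp.1
    (x.exp_height.trans (CyclicCover.lift f₀ x.proj).exp_height.symm)
  have hh : x.height = (CyclicCover.lift f₀ x.proj).height + n := by
    have hpi : (2 * Real.pi) ≠ 0 := by positivity
    apply mul_left_cancel₀ hpi
    rw [hn]; ring
  let u' : ℝ → FormFiber EB ϖY V x.proj := fun t => by
    classical
    exact if h : Circle.exp (2 * Real.pi * t) = f₀ x.proj then u ⟨t, x.proj, h⟩ else 0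
  have h1 : ∀ m : ℤ, u (x.deck m) = u' (x.height + m) := fun m =>
    (show u' (x.height + m) = u (x.deck m) from dif_pos (x.deck m).exp_height).symm
  have h2 : ∀ m : ℤ, u ((CyclicCover.lift f₀ x.proj).deck m) =
      u' ((CyclicCover.lift f₀ x.proj).height + m) := fun m =>
    (show u' ((CyclicCover.lift f₀ x.proj).height + m) = u ((CyclicCover.lift f₀ x.proj).deck m)
      from dif_pos ((CyclicCover.lift f₀ x.proj).deck m).exp_height).symm
  have h3 : ∑ᶠ m : ℤ, ξ ^ m • u' ((CyclicCover.lift f₀ x.proj).height + m) =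
      ξ ^ n • ∑ᶠ m : ℤ, ξ ^ m • u' (x.height + m) := by
    rw [smul_finsum, ← finsum_comp_equiv (Equiv.addRight n)]
    refine finsum_congr fun m => ?_
    rw [hh, smul_smul, ← zpow_add₀ hξ, add_comm n m]
    change ξ ^ (m + n) • u' ((CyclicCover.lift f₀ x.proj).height + ((m + n : ℤ) : ℝ)) = _
    congr 2
    push_cast
    ring
  have h4 : fourierLaplace ξ L u x.proj = Complex.exp ((CyclicCover.lift f₀ x.proj).height * L) •
      ∑ᶠ m : ℤ, ξ ^ m • u' ((CyclicCover.lift f₀ x.proj).height + m) :=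
    congrArg (Complex.exp ((CyclicCover.lift f₀ x.proj).height * L) • ·)
      (finsum_congr fun m => congrArg (ξ ^ m • ·) (h2 m))
  have h5 : Complex.exp (x.height * L) • ∑ᶠ m : ℤ, ξ ^ m • u' (x.height + m) =
      Complex.exp (x.height * L) • ∑ᶠ m : ℤ, ξ ^ m • u (x.deck m) :=
    congrArg (Complex.exp (x.height * L) • ·)
      (finsum_congr fun m => congrArg (ξ ^ m • ·) (h1 m).symm)
  rw [h4, ← h5, h3, smul_smul, hh, ← hL, ← Complex.exp_int_mul, ← Complex.exp_add]
  congr 2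
  push_cast
  ring

/-- An operator `N` on sections along `p` of the cyclic cover is the lift `p^* P` of the operator
`P` on `Y`: `N s` agrees at `x` with `p^*(P u)` whenever `s` agrees with `p^* u` near `x`. -/
def IsLift (F : Type*) [NormedAddCommGroup F] [NormedSpace ℝ F] [TopologicalSpace (TotalSpace F V)]
    [FiberBundle F V]
    (P : (∀ y, FormFiber EB ϖY V y) → ∀ y, FormFiber EB ϖY V y)
    (N : (∀ x : CyclicCover f₀, FormFiber EB ϖY V x.proj) →
      ∀ x : CyclicCover f₀, FormFiber EB ϖY V x.proj) : Prop :=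
  ∀ (u : ∀ y, FormFiber EB ϖY V y) (s : ∀ x : CyclicCover f₀, FormFiber EB ϖY V x.proj),
    SmoothForm EY F ϖY u → SmoothAlong EY F (EX' := EY) ϖY CyclicCover.proj s →
      ∀ x, (∀ᶠ x' in 𝓝 x, s x' = u x'.proj) → N s x = P u x.proj

/-- `M → B` with the family of Clifford modules `V' → M` is end-periodic, with furled-up family
`Y → B`, `V → Y`: outside a compact set, `M` is identified over `B` with the part `f > 0` of the
cyclic cover of `Y`, and all geometric data of `M` and `V'` are identified there with the lifts of
the data of `Y` and `V`. -/
structure EndPeriodicFamily (f₀ : C^∞⟮𝓘(ℝ, EY), Y; 𝓡 1, Circle⟯)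
    {GY : RiemannianFamily (EB := EB) (EX := EY) ϖY} (CY : CliffordFamily GY F V)
    {GM : RiemannianFamily (EB := EB) (EX := EM) ϖM} (CM : CliffordFamily GM F' V') where
  /-- the identification of the positive half of the cyclic cover with the end of `M` -/
  toEnd : OpenPartialHomeomorph (CyclicCover f₀) M
  source_eq : toEnd.source = {x | 0 < x.height}
  smooth : ContMDiffOn 𝓘(ℝ, EY) 𝓘(ℝ, EM) ∞ toEnd toEnd.source
  smooth_symm : ContMDiffOn 𝓘(ℝ, EM) 𝓘(ℝ, EY) ∞ toEnd.symm toEnd.target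
  isCompact_core : IsCompact toEnd.targetᶜ
  over_base : ∀ x ∈ toEnd.source, ϖM (toEnd x) = ϖY x.proj
  /-- the identification of `p^* V` with `V'` over the end -/
  bundleMap : ∀ x : CyclicCover f₀, V x.proj →ₗ[ℂ] V' (toEnd x)
  bundleMap_bijective : ∀ x ∈ toEnd.source, Function.Bijective (bundleMap x)
  bundleMap_smooth : ∀ x ∈ toEnd.source, ∀ u : ∀ x : CyclicCover f₀, V x.proj,
    ContMDiffAt 𝓘(ℝ, EY) (𝓘(ℝ, EY).prod 𝓘(ℝ, F)) ∞
      (fun x' : CyclicCover f₀ => TotalSpace.mk' F (E := V) x'.proj (u x')) x →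
    ContMDiffAt 𝓘(ℝ, EY) (𝓘(ℝ, EM).prod 𝓘(ℝ, F')) ∞
      (fun x' => TotalSpace.mk' F' (E := V') (toEnd x') (bundleMap x' (u x'))) x
  metric_eq : ∀ x ∈ toEnd.source, ∀ v w : TangentSpace 𝓘(ℝ, EY) x,
    GM.riem.metric.inner (toEnd x) (mfderiv 𝓘(ℝ, EY) 𝓘(ℝ, EM) toEnd x v)
        (mfderiv 𝓘(ℝ, EY) 𝓘(ℝ, EM) toEnd x w) =
      GY.riem.metric.inner x.proj (mfderiv 𝓘(ℝ, EY) 𝓘(ℝ, EY) CyclicCover.proj x v)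
        (mfderiv 𝓘(ℝ, EY) 𝓘(ℝ, EY) CyclicCover.proj x w)
  herm_eq : ∀ x ∈ toEnd.source, ∀ u w,
    CM.herm (toEnd x) (bundleMap x u) (bundleMap x w) = CY.herm x.proj u w
  cl_eq : ∀ x ∈ toEnd.source, ∀ (α : Module.Dual ℝ (TangentSpace 𝓘(ℝ, EY) x.proj))
    (β : Module.Dual ℝ (TangentSpace 𝓘(ℝ, EM) (toEnd x))),
    (∀ v : TangentSpace 𝓘(ℝ, EY) x, β (mfderiv 𝓘(ℝ, EY) 𝓘(ℝ, EM) toEnd x v) =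
      α (mfderiv 𝓘(ℝ, EY) 𝓘(ℝ, EY) CyclicCover.proj x v)) → ∀ u,
    CM.cl (toEnd x) (β.domRestrict (Vertical EB EM ϖM (toEnd x))) (bundleMap x u) =
      bundleMap x (CY.cl x.proj (α.domRestrict (Vertical EB EY ϖY x.proj)) u)
  conn_eq : ∀ x ∈ toEnd.source, ∀ (u : ∀ y, V y) (s : ∀ x, V' x),
    MDiffAt (T% u) x.proj → MDiffAt (T% s) (toEnd x) →
    (∀ᶠ x' in 𝓝 x, s (toEnd x') = bundleMap x' (u x'.proj)) →
    ∀ v : TangentSpace 𝓘(ℝ, EY) x,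
      CM.conn s (toEnd x) (mfderiv 𝓘(ℝ, EY) 𝓘(ℝ, EM) toEnd x v) =
        bundleMap x (CY.conn u x.proj (mfderiv 𝓘(ℝ, EY) 𝓘(ℝ, EY) CyclicCover.proj x v))

namespace EndPeriodicFamily

variable {GY : RiemannianFamily (EB := EB) (EX := EY) ϖY} {CY : CliffordFamily GY F V}
  {GM : RiemannianFamily (EB := EB) (EX := EM) ϖM} {CM : CliffordFamily GM F' V'}
  (D : EndPeriodicFamily f₀ CY CM)

/-- `e ∈ (p^* 𝔼_Y)_x` and `e' ∈ 𝔼_{toEnd x}` correspond to each other under the identification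
over the end; the forms are compared by inserting vector fields of the base `B`. -/
def Corresponds (x : CyclicCover f₀) (e : FormFiber EB ϖY V x.proj)
    (e' : FormFiber EB ϖM V' (D.toEnd x)) : Prop :=
  ∀ (k : ℕ) (W : Fin k → ∀ b : B, TangentSpace 𝓘(ℝ, EB) b),
    e' k (fun i => W i (ϖM (D.toEnd x))) = D.bundleMap x (e k fun i => W i (ϖY x.proj))

/-- The operator `A` on sections of `𝔼 → M` is end-periodic: over the end it coincides with
`N = p^* P`. Then `N` is the normal operator `N(A)`. -/
def IsNormalOperator (A : (∀ x, FormFiber EB ϖM V' x) → ∀ x, FormFiber EB ϖM V' x)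
    (P : (∀ y, FormFiber EB ϖY V y) → ∀ y, FormFiber EB ϖY V y)
    (N : (∀ x : CyclicCover f₀, FormFiber EB ϖY V x.proj) →
      ∀ x : CyclicCover f₀, FormFiber EB ϖY V x.proj) : Prop :=
  IsLift F P N ∧
  ∀ (s : ∀ x, FormFiber EB ϖM V' x) (u : ∀ x : CyclicCover f₀, FormFiber EB ϖY V x.proj),
    SmoothForm EM F' ϖM s → SmoothAlong EY F (EX' := EY) ϖY CyclicCover.proj u →
      ∀ x ∈ D.toEnd.source, (∀ᶠ x' in 𝓝 x, D.Corresponds x' (u x') (s (D.toEnd x'))) →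
        D.Corresponds x (N u x) (A s (D.toEnd x))

/-- `Q = A(Y)(ξ)` is the indicial family at `ξ` of the end-periodic operator `A`:
`ℱ_ξ ∘ N(A) = Q ∘ ℱ_ξ` on compactly supported smooth sections. -/
def IsIndicialFamily (ξ L : ℂ) (A : (∀ x, FormFiber EB ϖM V' x) → ∀ x, FormFiber EB ϖM V' x)
    (Q : (∀ y, FormFiber EB ϖY V y) → ∀ y, FormFiber EB ϖY V y) : Prop :=
  ∃ (P : (∀ y, FormFiber EB ϖY V y) → ∀ y, FormFiber EB ϖY V y)
    (N : (∀ x : CyclicCover f₀, FormFiber EB ϖY V x.proj) →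
      ∀ x : CyclicCover f₀, FormFiber EB ϖY V x.proj),
    D.IsNormalOperator A P N ∧
      ∀ u : ∀ x : CyclicCover f₀, FormFiber EB ϖY V x.proj,
        SmoothAlong EY F (EX' := EY) ϖY CyclicCover.proj u → IsCompact (closure {x | u x ≠ 0}) →
          fourierLaplace ξ L (N u) = Q (fourierLaplace ξ L u)

end EndPeriodicFamily

end Periodic

end EndPeriodic

end

open EndPeriodic

/-! Two independent facts carry the theorem. The first concerns form degree. Applied to a form of
degree zero, `bismut` is the sum of a term in `tensorConn`, which only reaches degrees 0 and 1, and
a cubic term in three factors `m₀` contracted with `omega`. In degree 0 the three covectors act by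
Clifford multiplication and only see vertical vectors; in degree 3 they act by exterior
multiplication and only see horizontal vectors. By torsion-freeness every term of `omega` is a value
of the tensor `secondForm`, which ignores the vertical part of its middle argument and the
horizontal part of its last one. So both extreme parts of the cubic term vanish, and what remains is
the Dirac operator in degree 0 and something in degrees 1 and 2 (`bismut_ofDegZero`).

The second fact is a conjugation argument. Near a point of `Y`, the transform of a compactly
supported section is `φ • ∑ ξ ^ m • w m`, a finite sum over local representatives of the translates,
with `φ = exp (f L)` for a branch of the height `f`, so that `dφ = L φ df`. A first-order operator
`A'` with symbol `σ` at `df` satisfies `A' (φ W) = φ A' W + L φ σ W`, and `φ A' W` is the transform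
of the lifted operator. Hence the indicial family must be `A' - L σ`
(`IsFirstOrder.fourierLaplace_lift`). Uniqueness follows since every smooth form on the closed
manifold `Y` is such a transform (`exists_fourierLaplace_eq`).

To connect `M` with `Y`, the superconnection must be natural under the identification of the end
(`isNatural_bismut`). Here the Levi-Civita connection is transported by the Koszul formula, and the
differentiability of the horizontal projection is obtained from a linear system. The existence and
uniqueness statements are then all instances of `IsNatural.isIndicialFamily_iff`, applied to
`bismut` and its components, with `D` as the component of degree 0. -/

noncomputable section

namespace EndPeriodic

/-! ### Change of basis in contractions. -/

section LinearAlgebra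

/-- A contraction over a basis of `T` can be computed over a basis of `T'` when the covectors only
enter through their pullback along `f : T' → T`. -/
theorem sum_coord_comp_eq {T T' W κ ι : Type*} [AddCommGroup T] [Module ℝ T] [AddCommGroup T']
    [Module ℝ T'] [AddCommGroup W] [Module ℝ W] [Fintype κ] [Fintype ι]
    (b : Module.Basis κ ℝ T) (c : Module.Basis ι ℝ T') (f : T' →ₗ[ℝ] T)
    (Φ : Module.Dual ℝ T' →ₗ[ℝ] T →ₗ[ℝ] W) :
    ∑ j, Φ (b.coord j ∘ₗ f) (b j) = ∑ i, Φ (c.coord i) (f (c i)) := by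
  classical
  have h1 : ∀ j, b.coord j ∘ₗ f = ∑ i, b.coord j (f (c i)) • c.coord i := fun j => by
    refine c.ext fun i => ?_
    rw [LinearMap.comp_apply, LinearMap.sum_apply, Finset.sum_eq_single i]
    · simp
    · intro i' _ hi'
      simp [hi'.symm]
    · simp
  simp only [h1, map_sum, map_smul, LinearMap.sum_apply, LinearMap.smul_apply]
  rw [Finset.sum_comm]
  refine Finset.sum_congr rfl fun i _ => ?_
  simp only [← map_smul, ← map_sum]
  congr 1
  exact b.sum_repr (f (c i))

end LinearAlgebra

/-! ### Globalizing locally smooth sections of vector bundles. -/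

section Sections

variable {EX : Type*} [NormedAddCommGroup EX] [NormedSpace ℝ EX] [FiniteDimensional ℝ EX]
  {X : Type*} [TopologicalSpace X] [ChartedSpace EX X] [IsManifold 𝓘(ℝ, EX) ∞ X]
  {F : Type*} [NormedAddCommGroup F] [NormedSpace ℝ F]
  {V : X → Type*} [TopologicalSpace (TotalSpace F V)] [∀ x, AddCommGroup (V x)]
  [∀ x, Module ℝ (V x)]
  [∀ x, TopologicalSpace (V x)] [∀ x, IsTopologicalAddGroup (V x)] [∀ x, ContinuousSMul ℝ (V x)]
  [FiberBundle F V] [VectorBundle ℝ F V]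

theorem _root_.ContMDiffAt.congr_section {n : WithTop ℕ∞} {s t : ∀ x, V x} {x : X}
    (hs : CMDiffAt n (T% s) x) (h : ∀ᶠ x' in 𝓝 x, t x' = s x') : CMDiffAt n (T% t) x :=
  hs.congr_of_eventuallyEq (h.mono fun x' hx' => by
    change TotalSpace.mk' F x' (t x') = TotalSpace.mk' F x' (s x')
    rw [hx'])

theorem exists_bump [T2Space X] {x : X} {U : Set X} (hU : U ∈ 𝓝 x) :
    ∃ φ : X → ℝ, ContMDiff 𝓘(ℝ, EX) 𝓘(ℝ, ℝ) ∞ φ ∧ (∀ᶠ x' in 𝓝 x, φ x' = 1) ∧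
      ∀ x' ∉ U, ∀ᶠ x'' in 𝓝 x', φ x'' = 0 := by
  obtain ⟨f, -, hf⟩ := (SmoothBumpFunction.nhds_basis_tsupport (I := 𝓘(ℝ, EX)) x).mem_iff.1 hU
  refine ⟨f, f.contMDiff, f.eventuallyEq_one, fun x' hx' => ?_⟩
  have h : x' ∉ tsupport f := fun h => hx' (hf h)
  exact notMem_tsupport_iff_eventuallyEq.1 h

/-- A section that is smooth near a point agrees near that point with a smooth section. -/
theorem exists_contMDiff_section [T2Space X] [ContMDiffVectorBundle ∞ F V 𝓘(ℝ, EX)] {s : ∀ x, V x}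
    {x : X}
    (hs : ∀ᶠ x' in 𝓝 x, CMDiffAt ∞ (T% s) x') :
    ∃ s' : ∀ x, V x, CMDiff ∞ (T% s') ∧ ∀ᶠ x' in 𝓝 x, s' x' = s x' := by
  -- The neighbourhood that contains the support of the bump is the set of smooth points of `s`
  -- itself, so at any other point the product is locally zero.
  obtain ⟨φ, hφ, h1, h0⟩ := exists_bump (EX := EX) hs
  refine ⟨fun x => φ x • s x, fun x' => ?_, h1.mono fun x' hx' => by simp [hx']⟩
  by_cases hx' : CMDiffAt ∞ (T% s) x'
  · exact (hφ x').smul_section hx'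
  · refine ContMDiffAt.congr_section (s := fun x => 0)
      ((contMDiff_zeroSection ℝ V).contMDiffAt) ?_
    exact (h0 x' hx').mono fun x'' h => by simp [h]

/-- A family of linear maps of the fibres that preserves smooth sections preserves smoothness of
sections at a point. -/
theorem contMDiffAt_map_section [FiniteDimensional ℝ F] [T2Space X]
    [ContMDiffVectorBundle ∞ F V 𝓘(ℝ, EX)] (A : ∀ x, V x →ₗ[ℝ] V x)
    (hA : ∀ s : ∀ x, V x, CMDiff ∞ (T% s) → CMDiff ∞ (T% (fun x => A x (s x))))
    {s : ∀ x, V x} {x : X} (hs : CMDiffAt ∞ (T% s) x) :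
    CMDiffAt ∞ (T% (fun x => A x (s x))) x := by
  let e := trivializationAt F V x
  have hx : x ∈ e.baseSet := FiberBundle.mem_baseSet_trivializationAt' x
  let b := Module.finBasis ℝ F
  -- The hypothesis `hA` can only be applied to globally smooth sections, so the local frame is
  -- first replaced by global sections with the same germ at `x`.
  have hfr : ∀ i, ∃ t : ∀ x, V x, CMDiff ∞ (T% t) ∧
      ∀ᶠ x' in 𝓝 x, t x' = e.localFrame b i x' := fun i => by
    refine exists_contMDiff_section ?_
    filter_upwards [e.open_baseSet.mem_nhds hx] with x' hx'
    exact contMDiffAt_localFrame_of_mem (n := ∞) e b i hx'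
  choose t ht hte using hfr
  have hc : ∀ i, CMDiffAt ∞ ((LinearMap.piApply (e.localFrameCoeff 𝓘(ℝ, EX) b i)) s) x :=
    fun i => contMDiffAt_localFrameCoeff b hx hs i
  have hsum : CMDiffAt ∞ (T% (fun x' => ∑ i, e.localFrameCoeff 𝓘(ℝ, EX) b i x' (s x') •
      A x' (t i x'))) x := by
    refine ContMDiffAt.sum_section (t := fun i x' =>
      e.localFrameCoeff 𝓘(ℝ, EX) b i x' (s x') • A x' (t i x')) fun i _ => ?_
    exact (hc i).smul_section (hA (t i) (ht i) x)
  refine hsum.congr_section ?_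
  filter_upwards [e.eventually_eq_localFrame_sum_coeff_smul (I := 𝓘(ℝ, EX)) b hx (s := s),
    Filter.eventually_all.2 hte] with x' h1 h2
  conv_lhs => rw [h1]
  simp [h2]

end Sections

/-! ### Pointwise smoothness of vector-valued forms. -/

section Forms

variable {EB : Type*} [NormedAddCommGroup EB] [NormedSpace ℝ EB]
  {B : Type*} [TopologicalSpace B] [ChartedSpace EB B] [IsManifold 𝓘(ℝ, EB) ∞ B]
  {EX : Type*} [NormedAddCommGroup EX] [NormedSpace ℝ EX] [FiniteDimensional ℝ EX]
  {X : Type*} [TopologicalSpace X] [ChartedSpace EX X] [IsManifold 𝓘(ℝ, EX) ∞ X]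
  {F : Type*} [NormedAddCommGroup F] [NormedSpace ℝ F]
  {V : X → Type*} [TopologicalSpace (TotalSpace F V)] [∀ x, AddCommGroup (V x)]
  [∀ x, Module ℝ (V x)] [∀ x, Module ℂ (V x)] [∀ x, IsScalarTower ℝ ℂ (V x)]
  [∀ x, TopologicalSpace (V x)] [∀ x, IsTopologicalAddGroup (V x)] [∀ x, ContinuousSMul ℝ (V x)]
  [FiberBundle F V] [VectorBundle ℝ F V] [ContMDiffVectorBundle ∞ F V 𝓘(ℝ, EX)]
  {ϖ : X → B}

variable (EX F) in
/-- Smoothness of a `V`-valued form at a point. -/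
def SmoothFormAt (ϖ : X → B) (s : ∀ x : X, FormFiber EB ϖ V x) (x : X) : Prop :=
  ∀ (k : ℕ) (W : Fin k → ∀ b : B, TangentSpace 𝓘(ℝ, EB) b),
    (∀ i, CMDiffAt ∞ (T% (W i)) (ϖ x)) →
      CMDiffAt ∞ (T% (fun x' => s x' k fun i => W i (ϖ x'))) x

theorem SmoothFormAt.congr {s t : ∀ x : X, FormFiber EB ϖ V x} {x : X}
    (hs : SmoothFormAt EX F ϖ s x) (h : ∀ᶠ x' in 𝓝 x, t x' = s x') : SmoothFormAt EX F ϖ t x :=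
  fun k W hW => (hs k W hW).congr_section (h.mono fun x' hx' => by rw [hx'])

theorem smoothFormAt_zero (x : X) : SmoothFormAt EX F ϖ (0 : ∀ x : X, FormFiber EB ϖ V x) x :=
  fun _ _ _ => (contMDiff_zeroSection ℝ V).contMDiffAt

theorem SmoothFormAt.add {s t : ∀ x : X, FormFiber EB ϖ V x} {x : X}
    (hs : SmoothFormAt EX F ϖ s x) (ht : SmoothFormAt EX F ϖ t x) :
    SmoothFormAt EX F ϖ (s + t) x :=
  fun k W hW => (hs k W hW).add_section (ht k W hW)

theorem SmoothFormAt.sum {ι : Type*} {s : Finset ι} {t : ι → ∀ x : X, FormFiber EB ϖ V x} {x : X}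
    (ht : ∀ i ∈ s, SmoothFormAt EX F ϖ (t i) x) :
    SmoothFormAt EX F ϖ (∑ i ∈ s, t i) x := by
  classical
  induction s using Finset.induction_on with
  | empty => simpa using smoothFormAt_zero x
  | insert a s ha ih =>
    rw [Finset.sum_insert ha]
    exact (ht a (by simp)).add (ih fun i hi => ht i (by simp [hi]))

theorem SmoothFormAt.real_smul {s : ∀ x : X, FormFiber EB ϖ V x} {x : X} {φ : X → ℝ}
    (hφ : ContMDiffAt 𝓘(ℝ, EX) 𝓘(ℝ, ℝ) ∞ φ x) (hs : SmoothFormAt EX F ϖ s x) :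
    SmoothFormAt EX F ϖ (fun x => φ x • s x) x :=
  fun k W hW => hφ.smul_section (hs k W hW)

/-- A form that is smooth near a point agrees near that point with a smooth form. -/
theorem exists_smoothForm [T2Space X] {s : ∀ x : X, FormFiber EB ϖ V x} {x : X}
    (hs : ∀ᶠ x' in 𝓝 x, SmoothFormAt EX F ϖ s x') :
    ∃ s' : ∀ x : X, FormFiber EB ϖ V x, SmoothForm EX F ϖ s' ∧ ∀ᶠ x' in 𝓝 x, s' x' = s x' := by
  obtain ⟨φ, hφ, h1, h0⟩ := exists_bump (EX := EX) hs
  refine ⟨fun x => φ x • s x, fun x' => ?_, h1.mono fun x' hx' => by simp [hx']⟩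
  change SmoothFormAt EX F ϖ _ x'
  by_cases hx' : SmoothFormAt EX F ϖ s x'
  · exact hx'.real_smul (hφ x')
  · refine (smoothFormAt_zero x').congr ?_
    exact (h0 x' hx').mono fun x'' h => by simp [h]

theorem smoothForm_ofDegZero {u : ∀ x, V x} (hu : CMDiff ∞ (T% u)) :
    SmoothForm EX F ϖ (ofDegZero (EB := EB) ϖ u) := by
  intro x k W hW
  cases k with
  | zero => exact hu x
  | succ k =>
    refine ContMDiffAt.congr_section (s := fun x => 0)
      ((contMDiff_zeroSection ℝ V).contMDiffAt) (Filter.Eventually.of_forall fun x' => ?_)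
    simp [ofDegZero]

theorem SmoothForm.degZero {s : ∀ x : X, FormFiber EB ϖ V x} (hs : SmoothForm EX F ϖ s) :
    CMDiff ∞ (T% (EndPeriodic.degZero s)) := fun x =>
  ContMDiffAt.congr_section (hs x 0 (fun i => i.elim0) (fun i => i.elim0))
    (Filter.Eventually.of_forall fun _ => congrArg _ (Subsingleton.elim _ _))

variable [FiniteDimensional ℝ F] {G : RiemannianFamily (EB := EB) (EX := EX) ϖ}

/-- The bundle structure is only real. A complex factor is split as `re + im * I`, and
multiplication by `I` is smooth by `complex_smooth`. -/
theorem CliffordFamily.contMDiffAt_complex_smul (C : CliffordFamily G F V) [T2Space X]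
    {s : ∀ x, V x} {x : X} {φ : X → ℂ}
    (hφ : ContMDiffAt 𝓘(ℝ, EX) 𝓘(ℝ, ℂ) ∞ φ x) (hs : CMDiffAt ∞ (T% s) x) :
    CMDiffAt ∞ (T% (fun x => φ x • s x)) x := by
  have hI : CMDiffAt ∞ (T% (fun x => Complex.I • s x)) x :=
    contMDiffAt_map_section (fun x => (LinearMap.lsmul ℂ (V x) Complex.I).restrictScalars ℝ)
      C.complex_smooth hs
  have hre : ContMDiffAt 𝓘(ℝ, EX) 𝓘(ℝ, ℝ) ∞ (fun x => (φ x).re) x :=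
    Complex.reCLM.contDiff.contMDiff.contMDiffAt.comp x hφ
  have him : ContMDiffAt 𝓘(ℝ, EX) 𝓘(ℝ, ℝ) ∞ (fun x => (φ x).im) x :=
    Complex.imCLM.contDiff.contMDiff.contMDiffAt.comp x hφ
  refine ((hre.smul_section hs).add_section (him.smul_section hI)).congr_section
    (Filter.Eventually.of_forall fun x' => ?_)
  change φ x' • s x' = (φ x').re • s x' + (φ x').im • Complex.I • s x'
  conv_lhs => rw [← Complex.re_add_im (φ x')]
  rw [add_smul, mul_smul, ← algebraMap_smul ℂ (φ x').re, ← algebraMap_smul ℂ (φ x').im]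
  rfl

theorem CliffordFamily.smoothFormAt_complex_smul (C : CliffordFamily G F V) [T2Space X]
    {s : ∀ x : X, FormFiber EB ϖ V x}
    {x : X} {φ : X → ℂ} (hφ : ContMDiffAt 𝓘(ℝ, EX) 𝓘(ℝ, ℂ) ∞ φ x)
    (hs : SmoothFormAt EX F ϖ s x) : SmoothFormAt EX F ϖ (fun x => φ x • s x) x :=
  fun k W hW => C.contMDiffAt_complex_smul hφ (hs k W hW)

end Forms
end EndPeriodic
end

noncomputable section

namespace EndPeriodic

/-! ### A saddle point system with differentiable solution. -/

section Saddle

variable {E W L N : Type*} [NormedAddCommGroup E] [NormedSpace ℝ E]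
  [NormedAddCommGroup W] [NormedSpace ℝ W] [NormedAddCommGroup L] [NormedSpace ℝ L]
  [NormedAddCommGroup N] [NormedSpace ℝ N]

/-- The saddle point operator `(z, l) ↦ (g z - τ A l, A z)` determined by `g` and `A`. -/
def saddle (τ : (E →L[ℝ] W) →L[ℝ] L →L[ℝ] N) (g : E →L[ℝ] N) (A : E →L[ℝ] W) :
    E × L →L[ℝ] N × W :=
  ContinuousLinearMap.inl ℝ N W ∘L
      (g ∘L ContinuousLinearMap.fst ℝ E L - τ A ∘L ContinuousLinearMap.snd ℝ E L) +
    ContinuousLinearMap.inr ℝ N W ∘L (A ∘L ContinuousLinearMap.fst ℝ E L)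

@[simp]
theorem saddle_apply (τ : (E →L[ℝ] W) →L[ℝ] L →L[ℝ] N) (g : E →L[ℝ] N) (A : E →L[ℝ] W) (z : E)
    (l : L) : saddle τ g A (z, l) = (g z - τ A l, A z) := by simp [saddle]

theorem differentiable_saddle (τ : (E →L[ℝ] W) →L[ℝ] L →L[ℝ] N) :
    Differentiable ℝ (fun p : (E →L[ℝ] N) × (E →L[ℝ] W) => saddle τ p.1 p.2) := by
  refine Differentiable.add (Differentiable.clm_comp (differentiable_const _) ?_)
    (Differentiable.clm_comp (differentiable_const _) ?_)
  · exact (differentiable_fst.clm_comp (differentiable_const _)).sub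
      ((τ.differentiable.comp differentiable_snd).clm_comp (differentiable_const _))
  · exact differentiable_snd.clm_comp (differentiable_const _)

variable [FiniteDimensional ℝ E] [FiniteDimensional ℝ L] [FiniteDimensional ℝ W]
  [FiniteDimensional ℝ N]

/-- Inversion of operators is differentiable at invertible ones, so the solution of the linear
system depends differentiably on its coefficients and on the right-hand side. -/
theorem differentiableAt_saddle_inverse (τ : (E →L[ℝ] W) →L[ℝ] L →L[ℝ] N)
    (p : (E →L[ℝ] N) × (E →L[ℝ] W)) (a : E) (h : (saddle τ p.1 p.2).IsInvertible) :
    DifferentiableAt ℝ (fun q : ((E →L[ℝ] N) × (E →L[ℝ] W)) × E =>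
      ((saddle τ q.1.1 q.1.2).inverse (0, q.1.2 q.2)).1) (p, a) := by
  have h2 : DifferentiableAt ℝ ContinuousLinearMap.inverse (saddle τ p.1 p.2) := by
    obtain ⟨e, he⟩ := h
    rw [← he]
    exact (contDiffAt_map_inverse (n := 1) e).differentiableAt (by simp)
  have h3 : DifferentiableAt ℝ (fun q : ((E →L[ℝ] N) × (E →L[ℝ] W)) × E =>
      (saddle τ q.1.1 q.1.2).inverse) (p, a) := by
    have h1 : DifferentiableAt ℝ (fun q : ((E →L[ℝ] N) × (E →L[ℝ] W)) × E =>
        saddle τ q.1.1 q.1.2) (p, a) :=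
      ((differentiable_saddle τ).comp differentiable_fst) (p, a)
    exact DifferentiableAt.comp (p, a) (g := ContinuousLinearMap.inverse) h2 h1
  have h4 : DifferentiableAt ℝ (fun q : ((E →L[ℝ] N) × (E →L[ℝ] W)) × E => q.1.2 q.2) (p, a) :=
    (differentiableAt_fst.snd).clm_apply differentiableAt_snd
  exact (h3.clm_apply ((differentiableAt_const _).prodMk h4)).fst

theorem mdifferentiableAt_saddle_inverse {X : Type*} [TopologicalSpace X] {E₁ : Type*}
    [NormedAddCommGroup E₁] [NormedSpace ℝ E₁] [ChartedSpace E₁ X]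
    (τ : (E →L[ℝ] W) →L[ℝ] L →L[ℝ] N) {g : X → E →L[ℝ] N} {A : X → E →L[ℝ] W} {a : X → E} {x : X}
    (hg : MDifferentiableAt 𝓘(ℝ, E₁) 𝓘(ℝ, E →L[ℝ] N) g x)
    (hA : MDifferentiableAt 𝓘(ℝ, E₁) 𝓘(ℝ, E →L[ℝ] W) A x)
    (ha : MDifferentiableAt 𝓘(ℝ, E₁) 𝓘(ℝ, E) a x) (h : (saddle τ (g x) (A x)).IsInvertible) :
    MDifferentiableAt 𝓘(ℝ, E₁) 𝓘(ℝ, E)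
      (fun x => ((saddle τ (g x) (A x)).inverse (0, A x (a x))).1) x :=
  MDifferentiableAt.comp (I' := 𝓘(ℝ, ((E →L[ℝ] N) × (E →L[ℝ] W)) × E))
    (f := fun x => ((g x, A x), a x)) x
    (differentiableAt_saddle_inverse τ (g x, A x) (a x) h).mdifferentiableAt
    ((hg.prodMk_space hA).prodMk_space ha)

-- If `(z, l)` is in the kernel, pairing `g z = l ∘ A` with `z` gives `g z z = l (A z) = 0`, hence
-- `z = 0` by positivity; then `l ∘ A = 0` and `l = 0` because `A` is onto. Both sides have
-- dimension `dim E + dim W`, so injectivity suffices.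
omit [FiniteDimensional ℝ L] [FiniteDimensional ℝ N] in
theorem isInvertible_saddle (g : E →L[ℝ] E →L[ℝ] ℝ) (hg : ∀ z, z ≠ 0 → 0 < g z z)
    (A : E →L[ℝ] W) (hA : Function.Surjective A) :
    (saddle (ContinuousLinearMap.compL ℝ E W ℝ).flip g A).IsInvertible := by
  have hinj : Function.Injective
      (saddle (ContinuousLinearMap.compL ℝ E W ℝ).flip g A).toLinearMap := by
    rw [← LinearMap.ker_eq_bot, LinearMap.ker_eq_bot']
    rintro ⟨z, l⟩ h
    have h' : (g z - (ContinuousLinearMap.compL ℝ E W ℝ).flip A l, A z) = 0 := by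
      rw [← saddle_apply]; exact h
    have h1 : ∀ c, g z c - l (A c) = 0 := fun c =>
      congrArg (fun p : (E →L[ℝ] ℝ) × W => p.1 c) h'
    have h2 : A z = 0 := congrArg (fun p : (E →L[ℝ] ℝ) × W => p.2) h'
    have hz : z = 0 := by
      by_contra hne
      have := h1 z
      rw [h2, map_zero, sub_zero] at this
      exact (hg z hne).ne' this
    have hl : l = 0 := by
      ext w
      obtain ⟨c, rfl⟩ := hA w
      have := h1 c
      rw [hz] at this
      simpa using this
    rw [hz, hl]; rfl
  have hfr : Module.finrank ℝ (E × (W →L[ℝ] ℝ)) = Module.finrank ℝ ((E →L[ℝ] ℝ) × W) := by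
    rw [Module.finrank_prod, Module.finrank_prod]
    have h1 : Module.finrank ℝ (W →L[ℝ] ℝ) = Module.finrank ℝ W := by
      rw [← (LinearMap.toContinuousLinearMap (𝕜 := ℝ) (E := W) (F' := ℝ)).finrank_eq]
      exact Subspace.dual_finrank_eq
    have h2 : Module.finrank ℝ (E →L[ℝ] ℝ) = Module.finrank ℝ E := by
      rw [← (LinearMap.toContinuousLinearMap (𝕜 := ℝ) (E := E) (F' := ℝ)).finrank_eq]
      exact Subspace.dual_finrank_eq
    rw [h1, h2, add_comm]
  let e := (LinearEquiv.ofInjectiveOfFinrankEq _ hinj hfr).toContinuousLinearEquiv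
  exact ⟨e, ContinuousLinearMap.ext fun _ => rfl⟩

end Saddle

/-! ### Horizontal and vertical projections of a Riemannian submersion family. -/

section Horizontal

variable {EB : Type*} [NormedAddCommGroup EB] [NormedSpace ℝ EB]
  {B : Type*} [TopologicalSpace B] [ChartedSpace EB B] [IsManifold 𝓘(ℝ, EB) ∞ B]
  {EX : Type*} [NormedAddCommGroup EX] [NormedSpace ℝ EX] [FiniteDimensional ℝ EX]
  {X : Type*} [TopologicalSpace X] [ChartedSpace EX X] [IsManifold 𝓘(ℝ, EX) ∞ X]

namespace RiemannianFamily

variable {ϖ : X → B} (G : RiemannianFamily (EB := EB) (EX := EX) ϖ)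

theorem mfderiv_horLift (x : X) (w : TangentSpace 𝓘(ℝ, EB) (ϖ x)) :
    mfderiv 𝓘(ℝ, EX) 𝓘(ℝ, EB) ϖ x (G.horLift x w) = w :=
  (G.exists_horLift x).choose_spec.1 w

theorem inner_horLift (x : X) (w : TangentSpace 𝓘(ℝ, EB) (ϖ x)) {v : TangentSpace 𝓘(ℝ, EX) x}
    (hv : v ∈ Vertical EB EX ϖ x) : G.riem.metric.inner x (G.horLift x w) v = 0 :=
  (G.exists_horLift x).choose_spec.2 w v hv

theorem mfderiv_horProj (x : X) (u : TangentSpace 𝓘(ℝ, EX) x) :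
    mfderiv 𝓘(ℝ, EX) 𝓘(ℝ, EB) ϖ x (G.horProj x u) = mfderiv 𝓘(ℝ, EX) 𝓘(ℝ, EB) ϖ x u :=
  G.mfderiv_horLift x _

theorem inner_horProj (x : X) (u : TangentSpace 𝓘(ℝ, EX) x) {v : TangentSpace 𝓘(ℝ, EX) x}
    (hv : v ∈ Vertical EB EX ϖ x) : G.riem.metric.inner x (G.horProj x u) v = 0 :=
  G.inner_horLift x _ hv

theorem vertProj_apply (x : X) (u : TangentSpace 𝓘(ℝ, EX) x) :
    G.vertProj x u = u - G.horProj x u := rfl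

theorem vertProj_mem (x : X) (u : TangentSpace 𝓘(ℝ, EX) x) :
    G.vertProj x u ∈ Vertical EB EX ϖ x := by
  rw [LinearMap.mem_ker, vertProj_apply, map_sub, sub_eq_zero]
  exact (G.mfderiv_horProj x u).symm

theorem horProj_of_mem {x : X} {u : TangentSpace 𝓘(ℝ, EX) x} (hu : u ∈ Vertical EB EX ϖ x) :
    G.horProj x u = 0 := by
  change G.horLift x (mfderiv 𝓘(ℝ, EX) 𝓘(ℝ, EB) ϖ x u) = 0
  rw [show mfderiv 𝓘(ℝ, EX) 𝓘(ℝ, EB) ϖ x u = 0 from hu, map_zero]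

theorem vertProj_of_mem {x : X} {u : TangentSpace 𝓘(ℝ, EX) x} (hu : u ∈ Vertical EB EX ϖ x) :
    G.vertProj x u = u := by rw [vertProj_apply, G.horProj_of_mem hu, sub_zero]

/-- The horizontal part of a tangent vector is characterized by having the same image in the base
and being orthogonal to the vertical space. -/
theorem horProj_eq {x : X} {u z : TangentSpace 𝓘(ℝ, EX) x}
    (h1 : mfderiv 𝓘(ℝ, EX) 𝓘(ℝ, EB) ϖ x z = mfderiv 𝓘(ℝ, EX) 𝓘(ℝ, EB) ϖ x u)
    (h2 : ∀ v ∈ Vertical EB EX ϖ x, G.riem.metric.inner x z v = 0) : G.horProj x u = z := by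
  have hv : z - G.horProj x u ∈ Vertical EB EX ϖ x := by
    rw [LinearMap.mem_ker, map_sub, sub_eq_zero]
    exact h1.trans (G.mfderiv_horProj x u).symm
  by_contra hne
  have h3 := G.riem.metric.pos x _ (sub_ne_zero.2 (Ne.symm hne))
  have h4 : G.riem.metric.inner x (z - G.horProj x u) (z - G.horProj x u) =
      G.riem.metric.inner x z (z - G.horProj x u) -
        G.riem.metric.inner x (G.horProj x u) (z - G.horProj x u) := by
    rw [map_sub (G.riem.metric.inner x)]; rfl
  rw [h4, h2 _ hv, G.inner_horProj x u hv, sub_zero] at h3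
  exact lt_irrefl _ h3

theorem inner_vertProj_left (x : X) (u : TangentSpace 𝓘(ℝ, EX) x) {v : TangentSpace 𝓘(ℝ, EX) x}
    (hv : v ∈ Vertical EB EX ϖ x) :
    G.riem.metric.inner x (G.vertProj x u) v = G.riem.metric.inner x u v := by
  rw [vertProj_apply, map_sub, sub_apply, G.inner_horProj x u hv, sub_zero]

variable [FiniteDimensional ℝ EB]

/-- `horLift` is chosen point by point and carries no regularity. The horizontal part of `u` is
however the vector `z` with `A z = A u`, `A = dϖ`, for which `g z` vanishes on `ker A`, that is `g z
= l ∘ A` for a multiplier `l`. In trivializations this is the saddle point system, whose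
coefficients are smooth in the base point. -/
theorem mdifferentiableAt_horProj {U : ∀ x : X, TangentSpace 𝓘(ℝ, EX) x} {x₀ : X}
    (hU : MDiffAt (T% U) x₀) : MDiffAt (T% (fun x => G.horProj x (U x))) x₀ := by
  let e := trivializationAt EX (TangentSpace 𝓘(ℝ, EX) : X → Type _) x₀
  let e' := trivializationAt EB (TangentSpace 𝓘(ℝ, EB) : B → Type _) (ϖ x₀)
  let g : X → EX →L[ℝ] EX →L[ℝ] ℝ := fun x => ContinuousLinearMap.inCoordinates EX
    (TangentSpace 𝓘(ℝ, EX)) (EX →L[ℝ] ℝ) (fun x : X => TangentSpace 𝓘(ℝ, EX) x →L[ℝ] ℝ) x₀ x x₀ x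
      (G.riem.metric.inner x)
  let A : X → EX →L[ℝ] EB := inTangentCoordinates 𝓘(ℝ, EX) 𝓘(ℝ, EB) id ϖ
    (fun x => mfderiv 𝓘(ℝ, EX) 𝓘(ℝ, EB) ϖ x) x₀
  let τ : (EX →L[ℝ] EB) →L[ℝ] (EB →L[ℝ] ℝ) →L[ℝ] EX →L[ℝ] ℝ :=
    (ContinuousLinearMap.compL ℝ EX EB ℝ).flip
  have hg : ContMDiffAt 𝓘(ℝ, EX) 𝓘(ℝ, EX →L[ℝ] EX →L[ℝ] ℝ) ∞ g x₀ :=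
    ((contMDiffAt_hom_bundle _).1 (G.riem.metric.contMDiff x₀)).2
  have hA : ContMDiffAt 𝓘(ℝ, EX) 𝓘(ℝ, EX →L[ℝ] EB) ∞ A x₀ :=
    (G.smooth_proj x₀).mfderiv_const (m := ∞) (by simp)
  have hx₀ : x₀ ∈ e.baseSet := FiberBundle.mem_baseSet_trivializationAt' x₀
  have hb₀ : ϖ x₀ ∈ e'.baseSet := FiberBundle.mem_baseSet_trivializationAt' (ϖ x₀)
  have hgx : ∀ x ∈ e.baseSet, ∀ a c, g x a c =
      G.riem.metric.inner x (e.symm x a) (e.symm x c) := fun x hx a c => by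
    simp only [g]
    rw [inCoordinates_apply_eq₂ hx hx (Set.mem_univ _)]
    simp [e]
  have hAx : ∀ x ∈ e.baseSet, ϖ x ∈ e'.baseSet → ∀ a, A x a =
      (e' ⟨ϖ x, mfderiv 𝓘(ℝ, EX) 𝓘(ℝ, EB) ϖ x (e.symm x a)⟩).2 := fun x hx hb a => by
    simp only [A, inTangentCoordinates]
    rw [id, id, ContinuousLinearMap.inCoordinates_eq hx hb]
    rfl
  have hsymm : ∀ x ∈ e.baseSet, ∀ u : TangentSpace 𝓘(ℝ, EX) x, e.symm x (e ⟨x, u⟩).2 = u :=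
    fun x hx u => e.symm_apply_apply_mk hx u
  have hsymm' : ∀ x ∈ e.baseSet, ∀ a, (e ⟨x, e.symm x a⟩).2 = a :=
    fun x hx a => by rw [e.apply_mk_symm hx]
  have hinv : ∀ x ∈ e.baseSet, ϖ x ∈ e'.baseSet → (saddle τ (g x) (A x)).IsInvertible := by
    intro x hx hb
    refine isInvertible_saddle _ (fun z hz => ?_) _ (fun w => ?_)
    · rw [hgx x hx]
      refine G.riem.metric.pos x _ fun h => hz ?_
      have := hsymm' x hx z
      rw [h] at this
      rw [← this]
      exact (e.linearEquivAt ℝ x hx).map_zero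
    · obtain ⟨u, hu⟩ := G.submersion x (e'.symm (ϖ x) w)
      refine ⟨(e ⟨x, u⟩).2, ?_⟩
      rw [hAx x hx hb, hsymm x hx, hu, e'.apply_mk_symm hb]
  have hmem : ∀ᶠ x in 𝓝 x₀, x ∈ e.baseSet ∧ ϖ x ∈ e'.baseSet :=
    Filter.Eventually.and (e.open_baseSet.mem_nhds hx₀)
      (G.smooth_proj.continuous.continuousAt.eventually (e'.open_baseSet.mem_nhds hb₀))
  have hformula : ∀ x ∈ e.baseSet, ϖ x ∈ e'.baseSet → (e ⟨x, G.horProj x (U x)⟩).2 =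
      ((saddle τ (g x) (A x)).inverse (0, A x (e ⟨x, U x⟩).2)).1 := by
    intro x hx hb
    -- The multiplier pairs the horizontal part of `U x` with horizontal lifts, so `l (A c)` is the
    -- inner product with the horizontal part of `c`. The first equation of the system then says
    -- that the inner product with the vertical part of `c` is zero.
    let l : EB →ₗ[ℝ] ℝ := (G.riem.metric.inner x (G.horProj x (U x))).toLinearMap ∘ₗ G.horLift x ∘ₗ
      (e'.linearEquivAt ℝ (ϖ x) hb).symm.toLinearMap
    have hl : ∀ c, l (A x c) =
        G.riem.metric.inner x (G.horProj x (U x)) (G.horProj x (e.symm x c)) := fun c => by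
      rw [hAx x hx hb]
      change G.riem.metric.inner x (G.horProj x (U x)) (G.horLift x (e'.symm (ϖ x) _)) = _
      rw [e'.symm_apply_apply_mk hb]
      rfl
    have key : saddle τ (g x) (A x)
        ((e ⟨x, G.horProj x (U x)⟩).2, LinearMap.toContinuousLinearMap l) =
          (0, A x (e ⟨x, U x⟩).2) := by
      rw [saddle_apply]
      refine Prod.ext ?_ ?_
      · refine ContinuousLinearMap.ext fun c => ?_
        change g x (e ⟨x, G.horProj x (U x)⟩).2 c - l (A x c) = 0
        rw [hgx x hx, hsymm x hx, hl, ← map_sub]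
        exact G.inner_horProj x _ (G.vertProj_mem x _)
      · change A x (e ⟨x, G.horProj x (U x)⟩).2 = A x _
        rw [hAx x hx hb, hAx x hx hb, hsymm x hx, hsymm x hx, G.mfderiv_horProj]
    rw [← key, (hinv x hx hb).inverse_apply_self]
  rw [mdifferentiableAt_section] at hU ⊢
  have hres := mdifferentiableAt_saddle_inverse τ (hg.mdifferentiableAt (by simp))
    (hA.mdifferentiableAt (by simp)) hU (hinv x₀ hx₀ hb₀)
  refine hres.congr_of_eventuallyEq ?_
  filter_upwards [hmem] with x hx
  exact hformula x hx.1 hx.2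

theorem mdifferentiableAt_vertProj {U : ∀ x : X, TangentSpace 𝓘(ℝ, EX) x} {x₀ : X}
    (hU : MDiffAt (T% U) x₀) : MDiffAt (T% (fun x => G.vertProj x (U x))) x₀ :=
  mdifferentiableAt_sub_section hU (G.mdifferentiableAt_horProj hU)

end RiemannianFamily
end Horizontal
end EndPeriodic
end

noncomputable section

namespace EndPeriodic

/-! ### The form `omega` through one tensorial trilinear form. -/

section SecondForm

variable {EB : Type*} [NormedAddCommGroup EB] [NormedSpace ℝ EB] [FiniteDimensional ℝ EB]
  {B : Type*} [TopologicalSpace B] [ChartedSpace EB B] [IsManifold 𝓘(ℝ, EB) ∞ B]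
  {EX : Type*} [NormedAddCommGroup EX] [NormedSpace ℝ EX] [FiniteDimensional ℝ EX]
  {X : Type*} [TopologicalSpace X] [ChartedSpace EX X] [IsManifold 𝓘(ℝ, EX) ∞ X]

namespace RiemannianFamily

variable {ϖ : X → B} (G : RiemannianFamily (EB := EB) (EX := EX) ϖ)

/-- A horizontal vector field with the horizontal part of `z` as value at `x`. -/
def horExtend {x : X} (z : TangentSpace 𝓘(ℝ, EX) x) (x' : X) : TangentSpace 𝓘(ℝ, EX) x' :=
  G.horProj x' (FiberBundle.extend (E := fun x' : X => TangentSpace 𝓘(ℝ, EX) x') EX z x')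

/-- A vertical vector field with the vertical part of `z` as value at `x`. -/
def vertExtend {x : X} (z : TangentSpace 𝓘(ℝ, EX) x) (x' : X) : TangentSpace 𝓘(ℝ, EX) x' :=
  G.vertProj x' (FiberBundle.extend (E := fun x' : X => TangentSpace 𝓘(ℝ, EX) x') EX z x')

theorem horExtend_self {x : X} (z : TangentSpace 𝓘(ℝ, EX) x) :
    G.horExtend z x = G.horProj x z := by
  rw [horExtend, FiberBundle.extend_apply_self]

theorem vertExtend_self {x : X} (z : TangentSpace 𝓘(ℝ, EX) x) :
    G.vertExtend z x = G.vertProj x z := by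
  rw [vertExtend, FiberBundle.extend_apply_self]

theorem mdifferentiableAt_horExtend {x : X} (z : TangentSpace 𝓘(ℝ, EX) x) :
    MDiffAt (T% (G.horExtend z)) x :=
  G.mdifferentiableAt_horProj (FiberBundle.mdifferentiableAt_extend 𝓘(ℝ, EX) EX z)

theorem mdifferentiableAt_vertExtend {x : X} (z : TangentSpace 𝓘(ℝ, EX) x) :
    MDiffAt (T% (G.vertExtend z)) x :=
  G.mdifferentiableAt_vertProj (FiberBundle.mdifferentiableAt_extend 𝓘(ℝ, EX) EX z)

/-- The trilinear form `g(∇_a Z, P w)`, where `Z` is a horizontal field whose value is the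
horizontal part of `z`. -/
def secondForm (x : X) (a z w : TangentSpace 𝓘(ℝ, EX) x) : ℝ :=
  G.riem.metric.inner x (G.riem.nabla (G.horExtend z) x a) (G.vertProj x w)

/-- For a horizontal field `Z` and a vertical field `W`, `g(∇_a Z, W) = - g(Z, ∇_a W)`. -/
theorem inner_nabla_horizontal {x : X} {Z : ∀ x : X, TangentSpace 𝓘(ℝ, EX) x}
    (hZ : MDiffAt (T% Z) x)
    (hor : ∀ᶠ x' in 𝓝 x, ∀ v ∈ Vertical EB EX ϖ x', G.riem.metric.inner x' (Z x') v = 0)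
    (a w : TangentSpace 𝓘(ℝ, EX) x) :
    G.riem.metric.inner x (G.riem.nabla Z x a) (G.vertProj x w) =
      -G.riem.metric.inner x (Z x) (G.riem.nabla (G.vertExtend w) x a) := by
  have h := G.riem.metric_compatible x Z (G.vertExtend w) hZ (G.mdifferentiableAt_vertExtend w) a
  have h0 : (fun x' => G.riem.metric.inner x' (Z x') (G.vertExtend w x')) =ᶠ[𝓝 x]
      fun _ => (0 : ℝ) := hor.mono fun x' hx' => hx' _ (G.vertProj_mem x' _)
  rw [h0.mfderiv_eq, mfderiv_const, G.vertExtend_self] at h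
  exact eq_neg_of_add_eq_zero_left h.symm

/-- Linearity in `a` and `w` is visible in the definition; linearity in `z` is not, as `z` enters
through a field extending it. Moving the derivative to the vertical field leaves only the value of
the horizontal field. -/
theorem secondForm_eq {x : X} (a z w : TangentSpace 𝓘(ℝ, EX) x) :
    G.secondForm x a z w =
      -G.riem.metric.inner x (G.horProj x z) (G.riem.nabla (G.vertExtend w) x a) := by
  rw [secondForm, G.inner_nabla_horizontal (G.mdifferentiableAt_horExtend z)
    (Filter.Eventually.of_forall fun x' v hv => G.inner_horProj x' _ hv), G.horExtend_self]

/-- Any horizontal field with the right value at `x` may replace `horExtend z`. This is needed for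
fields pulled back by an isometry, which are horizontal but need not be of the form `horExtend`. -/
theorem inner_nabla_eq_secondForm {x : X} {Z : ∀ x : X, TangentSpace 𝓘(ℝ, EX) x}
    (hZ : MDiffAt (T% Z) x)
    (hor : ∀ᶠ x' in 𝓝 x, ∀ v ∈ Vertical EB EX ϖ x', G.riem.metric.inner x' (Z x') v = 0)
    {z : TangentSpace 𝓘(ℝ, EX) x} (hz : Z x = G.horProj x z) (a w : TangentSpace 𝓘(ℝ, EX) x) :
    G.riem.metric.inner x (G.riem.nabla Z x a) (G.vertProj x w) = G.secondForm x a z w := by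
  rw [G.inner_nabla_horizontal hZ hor, hz, G.secondForm_eq]

/-- `secondForm` as a trilinear map. -/
def secondFormₗ (x : X) : TangentSpace 𝓘(ℝ, EX) x →ₗ[ℝ] TangentSpace 𝓘(ℝ, EX) x →ₗ[ℝ]
    TangentSpace 𝓘(ℝ, EX) x →ₗ[ℝ] ℝ :=
  LinearMap.mk₂ ℝ (fun a z =>
      (G.riem.metric.inner x (G.riem.nabla (G.horExtend z) x a)).toLinearMap ∘ₗ G.vertProj x)
    (fun a a' z => by
      ext w; simp)
    (fun c a z => by
      ext w; simp)
    (fun a z z' => by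
      ext w
      change G.secondForm x a (z + z') w = G.secondForm x a z w + G.secondForm x a z' w
      simp only [secondForm_eq, map_add, add_apply]
      ring)
    (fun c a z => by
      ext w
      change G.secondForm x a (c • z) w = c * G.secondForm x a z w
      simp only [secondForm_eq, map_smul, smul_apply, smul_eq_mul]
      ring)

theorem secondFormₗ_apply (x : X) (a z w : TangentSpace 𝓘(ℝ, EX) x) :
    G.secondFormₗ x a z w = G.secondForm x a z w := rfl

theorem secondForm_of_vertical {x : X} {z : TangentSpace 𝓘(ℝ, EX) x}
    (hz : z ∈ Vertical EB EX ϖ x) (a w : TangentSpace 𝓘(ℝ, EX) x) : G.secondForm x a z w = 0 := by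
  rw [secondForm_eq, G.horProj_of_mem hz]; simp

theorem secondForm_of_horizontal {x : X} {w : TangentSpace 𝓘(ℝ, EX) x}
    (hw : G.vertProj x w = 0) (a z : TangentSpace 𝓘(ℝ, EX) x) : G.secondForm x a z w = 0 := by
  rw [secondForm, hw, map_zero]

theorem metric₀_vertProj (x : X) (u w : TangentSpace 𝓘(ℝ, EX) x) :
    G.metric₀ x (G.vertProj x u) w = G.riem.metric.inner x u (G.vertProj x w) := by
  rw [metric₀, G.vertProj_of_mem (G.vertProj_mem x u), G.inner_vertProj_left x u
    (G.vertProj_mem x w)]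

/-- Torsion-freeness turns `∇_Z U - [Z, U]` into `∇_U Z`, which differentiates the horizontal field
along a vertical vector. -/
theorem metric₀_secondFundamentalForm (x : X) (u z w : TangentSpace 𝓘(ℝ, EX) x) :
    G.metric₀ x (G.secondFundamentalForm x u z) w = G.secondForm x (G.vertProj x u) z w := by
  have h := G.riem.torsion_free x (G.horExtend z) (G.vertExtend u)
    (G.mdifferentiableAt_horExtend z) (G.mdifferentiableAt_vertExtend u)
  have h1 : G.secondFundamentalForm x u z =
      G.vertProj x (G.riem.nabla (G.horExtend z) x (G.vertProj x u)) := by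
    change G.vertProj x (G.riem.nabla (G.vertExtend u) x (G.horExtend z x)) -
      G.vertProj x (VectorField.mlieBracket 𝓘(ℝ, EX) (G.horExtend z) (G.vertExtend u) x) = _
    rw [← h, ← map_sub, G.vertExtend_self, sub_sub_cancel]
  rw [h1, metric₀_vertProj, secondForm]

/-- Torsion-freeness again: `-[U, Z] = ∇_Z U - ∇_U Z`, with both fields horizontal. -/
theorem metric₀_horCurvature (x : X) (u z w : TangentSpace 𝓘(ℝ, EX) x) :
    G.metric₀ x (G.horCurvature x u z) w =
      G.secondForm x (G.horProj x z) u w - G.secondForm x (G.horProj x u) z w := by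
  have h := G.riem.torsion_free x (G.horExtend u) (G.horExtend z)
    (G.mdifferentiableAt_horExtend u) (G.mdifferentiableAt_horExtend z)
  have h1 : G.horCurvature x u z = G.vertProj x (G.riem.nabla (G.horExtend u) x (G.horProj x z) -
      G.riem.nabla (G.horExtend z) x (G.horProj x u)) := by
    change G.vertProj x (-VectorField.mlieBracket 𝓘(ℝ, EX) (G.horExtend u) (G.horExtend z) x) = _
    rw [← h, G.horExtend_self, G.horExtend_self, neg_sub]
  rw [h1, metric₀_vertProj, map_sub, sub_apply]
  rfl

/-- The definition of `omega` refers to extensions of vectors to fields. In this form its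
trilinearity, its vanishing properties and its invariance under isometries can be read off term by
term. -/
theorem omega_eq (x : X) (v y z : TangentSpace 𝓘(ℝ, EX) x) :
    G.omega x v y z = G.secondForm x (G.vertProj x v) y z - G.secondForm x (G.vertProj x v) z y
      + (1 / 2) * (G.secondForm x (G.horProj x z) v y - G.secondForm x (G.horProj x v) z y)
      - (1 / 2) * (G.secondForm x (G.horProj x y) v z - G.secondForm x (G.horProj x v) y z)
      + (1 / 2) * (G.secondForm x (G.horProj x z) y v - G.secondForm x (G.horProj x y) z v) := by
  simp only [omega, metric₀_secondFundamentalForm, metric₀_horCurvature]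

/-- `omega` as a trilinear map. -/
def omegaₗ (x : X) : TangentSpace 𝓘(ℝ, EX) x →ₗ[ℝ] TangentSpace 𝓘(ℝ, EX) x →ₗ[ℝ]
    TangentSpace 𝓘(ℝ, EX) x →ₗ[ℝ] ℝ :=
  LinearMap.mk₂ ℝ (fun v y =>
      { toFun := G.omega x v y
        map_add' := fun z z' => by
          simp only [omega_eq, ← secondFormₗ_apply, map_add, LinearMap.add_apply]; ring
        map_smul' := fun c z => by
          simp only [omega_eq, ← secondFormₗ_apply, map_smul, LinearMap.smul_apply, smul_eq_mul,
            RingHom.id_apply]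
          ring })
    (fun v v' y => by
      ext z
      change G.omega x (v + v') y z = G.omega x v y z + G.omega x v' y z
      simp only [omega_eq, ← secondFormₗ_apply, map_add, LinearMap.add_apply]; ring)
    (fun c v y => by
      ext z
      change G.omega x (c • v) y z = c * G.omega x v y z
      simp only [omega_eq, ← secondFormₗ_apply, map_smul, LinearMap.smul_apply, smul_eq_mul]; ring)
    (fun v y y' => by
      ext z
      change G.omega x v (y + y') z = G.omega x v y z + G.omega x v y' z
      simp only [omega_eq, ← secondFormₗ_apply, map_add, LinearMap.add_apply]; ring)
    (fun c v y => by
      ext z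
      change G.omega x v (c • y) z = c * G.omega x v y z
      simp only [omega_eq, ← secondFormₗ_apply, map_smul, LinearMap.smul_apply, smul_eq_mul]; ring)

theorem omegaₗ_apply (x : X) (v y z : TangentSpace 𝓘(ℝ, EX) x) :
    G.omegaₗ x v y z = G.omega x v y z := rfl

/-- Each term of `omega_eq` has one of `v`, `y`, `z` in the middle slot, where only its horizontal
part counts. -/
theorem omega_vertical {x : X} {v y z : TangentSpace 𝓘(ℝ, EX) x} (hv : v ∈ Vertical EB EX ϖ x)
    (hy : y ∈ Vertical EB EX ϖ x) (hz : z ∈ Vertical EB EX ϖ x) : G.omega x v y z = 0 := by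
  simp [omega_eq, G.secondForm_of_vertical hv, G.secondForm_of_vertical hy,
    G.secondForm_of_vertical hz]

theorem vertProj_horLift (x : X) (w : TangentSpace 𝓘(ℝ, EB) (ϖ x)) :
    G.vertProj x (G.horLift x w) = 0 := by
  rw [vertProj_apply, sub_eq_zero]
  change _ = G.horLift x (mfderiv 𝓘(ℝ, EX) 𝓘(ℝ, EB) ϖ x (G.horLift x w))
  rw [G.mfderiv_horLift]

/-- Dually, each term of `omega_eq` has one of the three arguments in the last slot, where only its
vertical part counts. -/
theorem omega_horLift (x : X) (v y z : TangentSpace 𝓘(ℝ, EB) (ϖ x)) :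
    G.omega x (G.horLift x v) (G.horLift x y) (G.horLift x z) = 0 := by
  simp [omega_eq, G.secondForm_of_horizontal (G.vertProj_horLift x _)]

end RiemannianFamily
end SecondForm
end EndPeriodic
end

noncomputable section

namespace EndPeriodic

/-! ### Cubic contractions that see only a subspace. -/

section LinearAlgebra

theorem map_real_smul_complex {T N : Type*} [AddCommGroup T] [Module ℝ T] [AddCommGroup N]
    [Module ℂ N] (f : T →ₗ[ℝ] N) (c : ℝ) (t : T) : f (c • t) = (c : ℂ) • f t :=
  (map_smul f c t).trans (algebraMap_smul ℂ c _).symm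

theorem _root_.AlternatingMap.sum_apply {T W ι κ : Type*} [AddCommGroup T] [Module ℝ T]
    [AddCommGroup W] [Module ℝ W] (s : Finset κ) (a : κ → T [⋀^ι]→ₗ[ℝ] W) (w : ι → T) :
    (∑ i ∈ s, a i) w = ∑ i ∈ s, a i w :=
  map_sum ({ toFun := fun a => a w, map_zero' := rfl, map_add' := fun _ _ => rfl } :
    (T [⋀^ι]→ₗ[ℝ] W) →+ W) a s

/-- A contraction with a trilinear form only sees the restriction of the form to `T'` when the
covectors only enter through their pullback along `f : T' → T`. -/
theorem sum_coord_comp_three_eq_zero {T T' W₀ W₁ W₂ κ : Type*} [AddCommGroup T] [Module ℝ T]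
    [AddCommGroup T'] [Module ℝ T'] [FiniteDimensional ℝ T'] [AddCommGroup W₀] [Module ℝ W₀]
    [AddCommGroup W₁] [Module ℝ W₁] [AddCommGroup W₂] [Module ℝ W₂] [Fintype κ]
    (b : Module.Basis κ ℝ T) (f : T' →ₗ[ℝ] T) (τ : T →ₗ[ℝ] T →ₗ[ℝ] T →ₗ[ℝ] ℝ)
    (hτ : ∀ u v w, τ (f u) (f v) (f w) = 0)
    (P : Module.Dual ℝ T' →ₗ[ℝ] W₁ →ₗ[ℝ] W₂) (Q : Module.Dual ℝ T' →ₗ[ℝ] W₀ →ₗ[ℝ] W₁)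
    (R : Module.Dual ℝ T' →ₗ[ℝ] W₀) :
    ∑ i, ∑ j, ∑ k, τ (b i) (b j) (b k) •
      P (b.coord i ∘ₗ f) (Q (b.coord j ∘ₗ f) (R (b.coord k ∘ₗ f))) = 0 := by
  let c := Module.finBasis ℝ T'
  have h1 : ∀ θ : Module.Dual ℝ T, ∑ k, θ (b k) • (b.coord k ∘ₗ f) = θ ∘ₗ f := fun θ => by
    ext u
    simp only [LinearMap.sum_apply, LinearMap.smul_apply, LinearMap.comp_apply, smul_eq_mul]
    conv_rhs => rw [← b.sum_repr (f u), map_sum]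
    refine Finset.sum_congr rfl fun k _ => ?_
    rw [map_smul, smul_eq_mul, mul_comm, b.coord_apply]
  -- The innermost index is absorbed into the covector `τ (b i) (b j) ∘ₗ f`. The other two are moved
  -- one at a time from the basis `b` of `T` to the basis `c` of `T'`, after which all arguments of
  -- `τ` come from `f`.
  have h2 : ∀ i j, ∑ k, τ (b i) (b j) (b k) •
      P (b.coord i ∘ₗ f) (Q (b.coord j ∘ₗ f) (R (b.coord k ∘ₗ f))) =
        P (b.coord i ∘ₗ f) (Q (b.coord j ∘ₗ f) (R (τ (b i) (b j) ∘ₗ f))) := fun i j => by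
    rw [← h1 (τ (b i) (b j))]
    simp only [map_sum, map_smul]
  have h3 : ∀ i, ∑ j, P (b.coord i ∘ₗ f) (Q (b.coord j ∘ₗ f) (R (τ (b i) (b j) ∘ₗ f))) =
      ∑ l, P (b.coord i ∘ₗ f) (Q (c.coord l) (R (τ (b i) (f (c l)) ∘ₗ f))) := fun i =>
    sum_coord_comp_eq b c f ((Q.compl₂ (R ∘ₗ f.dualMap ∘ₗ τ (b i))).compr₂ (P (b.coord i ∘ₗ f)))
  have h4 : ∀ l, ∑ i, P (b.coord i ∘ₗ f) (Q (c.coord l) (R (τ (b i) (f (c l)) ∘ₗ f))) =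
      ∑ m, P (c.coord m) (Q (c.coord l) (R (τ (f (c m)) (f (c l)) ∘ₗ f))) := fun l =>
    sum_coord_comp_eq b c f (P.compl₂ (Q (c.coord l) ∘ₗ R ∘ₗ f.dualMap ∘ₗ τ.flip (f (c l))))
  have h5 : ∀ u v, τ (f u) (f v) ∘ₗ f = 0 := fun u v => LinearMap.ext fun w => hτ u v w
  simp only [h2, h3]
  rw [Finset.sum_comm]
  simp only [h4, h5, map_zero, Finset.sum_const_zero]

end LinearAlgebra

/-! ### The degenerate Clifford action and the form degrees of the superconnection. -/

section Clifford

variable {EB : Type*} [NormedAddCommGroup EB] [NormedSpace ℝ EB]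
  {B : Type*} [TopologicalSpace B] [ChartedSpace EB B] [IsManifold 𝓘(ℝ, EB) ∞ B]
  {EX : Type*} [NormedAddCommGroup EX] [NormedSpace ℝ EX] [FiniteDimensional ℝ EX]
  {X : Type*} [TopologicalSpace X] [ChartedSpace EX X] [IsManifold 𝓘(ℝ, EX) ∞ X]
  {F : Type*} [NormedAddCommGroup F] [NormedSpace ℝ F] [FiniteDimensional ℝ F]
  {V : X → Type*} [TopologicalSpace (TotalSpace F V)] [∀ x, AddCommGroup (V x)]
  [∀ x, Module ℝ (V x)] [∀ x, Module ℂ (V x)] [∀ x, IsScalarTower ℝ ℂ (V x)]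
  [∀ x, TopologicalSpace (V x)] [∀ x, IsTopologicalAddGroup (V x)] [∀ x, ContinuousSMul ℝ (V x)]
  [FiberBundle F V] [VectorBundle ℝ F V] [ContMDiffVectorBundle ∞ F V 𝓘(ℝ, EX)]
  {ϖ : X → B} {G : RiemannianFamily (EB := EB) (EX := EX) ϖ}

namespace CliffordFamily

variable (C : CliffordFamily G F V)

theorem clForm_apply {k : ℕ} (x : X) (α : Module.Dual ℝ (TangentSpace 𝓘(ℝ, EX) x))
    (e : (TangentSpace 𝓘(ℝ, EB) (ϖ x)) [⋀^Fin k]→ₗ[ℝ] V x)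
    (w : Fin k → TangentSpace 𝓘(ℝ, EB) (ϖ x)) :
    C.clForm x α e w = C.cl x (α.domRestrict (Vertical EB EX ϖ x)) (e w) := rfl

theorem wedgeForm_apply {k : ℕ} (x : X) (α : Module.Dual ℝ (TangentSpace 𝓘(ℝ, EX) x))
    (e : (TangentSpace 𝓘(ℝ, EB) (ϖ x)) [⋀^Fin k]→ₗ[ℝ] V x)
    (w : Fin (k + 1) → TangentSpace 𝓘(ℝ, EB) (ϖ x)) :
    C.wedgeForm x α e w =
      ∑ i : Fin (k + 1), (-1 : ℤ) ^ (i : ℕ) • α (G.horLift x (w i)) • e (i.removeNth w) := by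
  rw [wedgeForm, AlternatingMap.alternatizeUncurryFin_apply]
  rfl

/-- Exterior multiplication by a covector of the base. -/
def wedgeₗ (V : X → Type*) [∀ x, AddCommGroup (V x)] [∀ x, Module ℝ (V x)] (ϖ : X → B)
    (k : ℕ) (x : X) : Module.Dual ℝ (TangentSpace 𝓘(ℝ, EB) (ϖ x)) →ₗ[ℝ]
      ((TangentSpace 𝓘(ℝ, EB) (ϖ x)) [⋀^Fin k]→ₗ[ℝ] V x) →ₗ[ℝ]
        ((TangentSpace 𝓘(ℝ, EB) (ϖ x)) [⋀^Fin (k + 1)]→ₗ[ℝ] V x) :=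
  LinearMap.mk₂ ℝ (fun β e => AlternatingMap.alternatizeUncurryFin (LinearMap.smulRight β e))
    (fun β β' e => by
      ext w
      simp [AlternatingMap.alternatizeUncurryFin_apply, add_smul, Finset.sum_add_distrib])
    (fun c β e => by
      ext w
      simp only [AlternatingMap.alternatizeUncurryFin_apply, LinearMap.smulRight_apply,
        LinearMap.smul_apply, AlternatingMap.smul_apply, Finset.smul_sum, smul_eq_mul, mul_smul,
        smul_comm c])
    (fun β e e' => by
      ext w
      simp [AlternatingMap.alternatizeUncurryFin_apply, Finset.sum_add_distrib])
    (fun c β e => by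
      ext w
      simp only [AlternatingMap.alternatizeUncurryFin_apply, LinearMap.smulRight_apply,
        AlternatingMap.smul_apply, Finset.smul_sum, smul_comm c])

theorem wedgeForm_eq {k : ℕ} (x : X) (α : Module.Dual ℝ (TangentSpace 𝓘(ℝ, EX) x))
    (e : (TangentSpace 𝓘(ℝ, EB) (ϖ x)) [⋀^Fin k]→ₗ[ℝ] V x) :
    C.wedgeForm x α e = wedgeₗ V ϖ k x (α ∘ₗ G.horLift x) e := rfl

theorem m₀_zero (x : X) (α : Module.Dual ℝ (TangentSpace 𝓘(ℝ, EX) x)) (e : FormFiber EB ϖ V x) :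
    C.m₀ x α e 0 = C.clForm x α (e 0) := rfl

theorem m₀_succ (x : X) (α : Module.Dual ℝ (TangentSpace 𝓘(ℝ, EX) x)) (e : FormFiber EB ϖ V x)
    (k : ℕ) : C.m₀ x α e (k + 1) =
      C.wedgeForm x α (e k) + (-1 : ℝ) ^ (k + 1) • C.clForm x α (e (k + 1)) := rfl

theorem clForm_add_left {k : ℕ} (x : X) (α β : Module.Dual ℝ (TangentSpace 𝓘(ℝ, EX) x))
    (e : (TangentSpace 𝓘(ℝ, EB) (ϖ x)) [⋀^Fin k]→ₗ[ℝ] V x) :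
    C.clForm x (α + β) e = C.clForm x α e + C.clForm x β e := by
  ext w
  rw [AlternatingMap.add_apply, clForm_apply, clForm_apply, clForm_apply, ← LinearMap.add_apply,
    ← map_add]
  rfl

theorem cl_real_smul (x : X) (c : ℝ) (α : Module.Dual ℝ (Vertical EB EX ϖ x)) (u : V x) :
    C.cl x (c • α) u = c • C.cl x α u :=
  (congrArg (fun A : V x →ₗ[ℂ] V x => A u) (map_real_smul_complex (C.cl x) c α)).trans (algebraMap_smul ℂ c _)

theorem clForm_smul_left {k : ℕ} (x : X) (c : ℝ) (α : Module.Dual ℝ (TangentSpace 𝓘(ℝ, EX) x))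
    (e : (TangentSpace 𝓘(ℝ, EB) (ϖ x)) [⋀^Fin k]→ₗ[ℝ] V x) :
    C.clForm x (c • α) e = c • C.clForm x α e := by
  ext w
  exact C.cl_real_smul x c (α.domRestrict (Vertical EB EX ϖ x)) (e w)

theorem clForm_add_right {k : ℕ} (x : X) (α : Module.Dual ℝ (TangentSpace 𝓘(ℝ, EX) x))
    (e e' : (TangentSpace 𝓘(ℝ, EB) (ϖ x)) [⋀^Fin k]→ₗ[ℝ] V x) :
    C.clForm x α (e + e') = C.clForm x α e + C.clForm x α e' := by
  ext w
  simp [clForm_apply]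

theorem clForm_smul_right {k : ℕ} (x : X) (c : ℂ) (α : Module.Dual ℝ (TangentSpace 𝓘(ℝ, EX) x))
    (e : (TangentSpace 𝓘(ℝ, EB) (ϖ x)) [⋀^Fin k]→ₗ[ℝ] V x) :
    C.clForm x α (c • e) = c • C.clForm x α e := by
  ext w
  simp [clForm_apply]

theorem wedgeForm_smul_right {k : ℕ} (x : X) (c : ℂ)
    (α : Module.Dual ℝ (TangentSpace 𝓘(ℝ, EX) x))
    (e : (TangentSpace 𝓘(ℝ, EB) (ϖ x)) [⋀^Fin k]→ₗ[ℝ] V x) :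
    C.wedgeForm x α (c • e) = c • C.wedgeForm x α e := by
  ext w
  simp only [wedgeForm_apply, AlternatingMap.smul_apply, Finset.smul_sum, smul_comm c]

theorem m₀_smul_right (x : X) (c : ℂ) (α : Module.Dual ℝ (TangentSpace 𝓘(ℝ, EX) x))
    (e : FormFiber EB ϖ V x) : C.m₀ x α (c • e) = c • C.m₀ x α e := by
  funext k
  cases k with
  | zero => exact C.clForm_smul_right x c α (e 0)
  | succ k =>
    rw [Pi.smul_apply, m₀_succ, m₀_succ, Pi.smul_apply, Pi.smul_apply, wedgeForm_smul_right,
      clForm_smul_right, smul_add, smul_comm c]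

theorem real_smul_form {x : X} (c : ℝ) (e : FormFiber EB ϖ V x) : c • e = (c : ℂ) • e := by
  funext k
  ext w
  exact (algebraMap_smul ℂ c _).symm

/-- The degenerate Clifford action as a bilinear map. -/
def m₀ₗ (x : X) : Module.Dual ℝ (TangentSpace 𝓘(ℝ, EX) x) →ₗ[ℝ]
    FormFiber EB ϖ V x →ₗ[ℝ] FormFiber EB ϖ V x :=
  LinearMap.mk₂ ℝ (C.m₀ x)
    (fun α β e => by
      funext k
      cases k with
      | zero => exact C.clForm_add_left x α β (e 0)
      | succ k =>
        rw [Pi.add_apply, m₀_succ, m₀_succ, m₀_succ, clForm_add_left, wedgeForm_eq,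
          LinearMap.add_comp, map_add, LinearMap.add_apply, smul_add, wedgeForm_eq, wedgeForm_eq]
        abel)
    (fun c α e => by
      funext k
      cases k with
      | zero => exact C.clForm_smul_left x c α (e 0)
      | succ k =>
        rw [Pi.smul_apply, m₀_succ, m₀_succ, clForm_smul_left, wedgeForm_eq,
          LinearMap.smul_comp, map_smul, LinearMap.smul_apply, smul_add, wedgeForm_eq,
          smul_comm c])
    (fun α e e' => by
      funext k
      cases k with
      | zero => exact C.clForm_add_right x α (e 0) (e' 0)
      | succ k =>
        rw [Pi.add_apply, m₀_succ, m₀_succ, m₀_succ, Pi.add_apply, Pi.add_apply, clForm_add_right,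
          wedgeForm_eq, map_add, smul_add, wedgeForm_eq, wedgeForm_eq]
        abel)
    (fun c α e => by rw [real_smul_form, m₀_smul_right, ← real_smul_form])

theorem m₀ₗ_apply (x : X) (α : Module.Dual ℝ (TangentSpace 𝓘(ℝ, EX) x))
    (e : FormFiber EB ϖ V x) : C.m₀ₗ x α e = C.m₀ x α e := rfl

/-- The Clifford multiplication as a real bilinear map. -/
def clₗ (x : X) : Module.Dual ℝ (Vertical EB EX ϖ x) →ₗ[ℝ] V x →ₗ[ℝ] V x :=
  LinearMap.mk₂ ℝ (fun α u => C.cl x α u) (fun _ _ _ => by simp) (fun c α u => C.cl_real_smul x c α u)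
    (fun _ _ _ => by simp) (fun c α u => by
      rw [← algebraMap_smul ℂ c u, map_smul, algebraMap_smul])

theorem clₗ_apply (x : X) (α : Module.Dual ℝ (Vertical EB EX ϖ x)) (u : V x) :
    C.clₗ x α u = C.cl x α u := rfl

theorem halfOmega_apply (x : X) (v : TangentSpace 𝓘(ℝ, EX) x) (e : FormFiber EB ϖ V x) :
    C.halfOmega x v e = (1 / 4 : ℝ) • ∑ i, ∑ j,
      G.omega x v (Module.finBasis ℝ (TangentSpace 𝓘(ℝ, EX) x) i)
        (Module.finBasis ℝ (TangentSpace 𝓘(ℝ, EX) x) j) •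
          C.m₀ x ((Module.finBasis ℝ (TangentSpace 𝓘(ℝ, EX) x)).coord i)
            (C.m₀ x ((Module.finBasis ℝ (TangentSpace 𝓘(ℝ, EX) x)).coord j) e) := rfl

theorem halfOmega_smul (x : X) (v : TangentSpace 𝓘(ℝ, EX) x) (c : ℂ) (e : FormFiber EB ϖ V x) :
    C.halfOmega x v (c • e) = c • C.halfOmega x v e := by
  simp only [halfOmega_apply, m₀_smul_right, Finset.smul_sum, real_smul_form, smul_comm c]

theorem halfOmega_add (x : X) (v : TangentSpace 𝓘(ℝ, EX) x) (e e' : FormFiber EB ϖ V x) :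
    C.halfOmega x v (e + e') = C.halfOmega x v e + C.halfOmega x v e' := by
  simp only [halfOmega_apply, ← m₀ₗ_apply, map_add, smul_add, Finset.sum_add_distrib]

theorem bismut_apply (SB : RiemannianStructure EB B) (s : ∀ x, FormFiber EB ϖ V x) (x : X) :
    C.bismut SB s x = ∑ j, C.m₀ x ((Module.finBasis ℝ (TangentSpace 𝓘(ℝ, EX) x)).coord j)
      (C.tensorConn SB s x (Module.finBasis ℝ (TangentSpace 𝓘(ℝ, EX) x) j)) +
        ∑ j, C.m₀ x ((Module.finBasis ℝ (TangentSpace 𝓘(ℝ, EX) x)).coord j)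
          (C.halfOmega x (Module.finBasis ℝ (TangentSpace 𝓘(ℝ, EX) x) j) (s x)) := by
  rw [← Finset.sum_add_distrib]
  refine Finset.sum_congr rfl fun j _ => ?_
  exact map_add (C.m₀ₗ x _) _ _

/-- Exterior multiplication raises the degree by one and Clifford multiplication keeps it, so each
`m₀` raises the top degree by at most one. -/
theorem m₀_eq_zero_of_lt {x : X} {n : ℕ} {e : FormFiber EB ϖ V x} (he : ∀ k, n < k → e k = 0)
    (α : Module.Dual ℝ (TangentSpace 𝓘(ℝ, EX) x)) (k : ℕ) (hk : n + 1 < k) :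
    C.m₀ x α e k = 0 := by
  obtain ⟨k, rfl⟩ : ∃ l, k = l + 1 := ⟨k - 1, by omega⟩
  rw [m₀_succ, he k (by omega), he (k + 1) (by omega), wedgeForm_eq, map_zero]
  ext w
  simp [clForm_apply]

/-- In the highest degree that can occur the Clifford part has nothing to act on. Iterated three
times, this isolates the purely exterior part of a triple product. -/
theorem m₀_top {x : X} {n : ℕ} {e : FormFiber EB ϖ V x} (he : ∀ k, n < k → e k = 0)
    (α : Module.Dual ℝ (TangentSpace 𝓘(ℝ, EX) x)) :
    C.m₀ x α e (n + 1) = wedgeₗ V ϖ n x (α ∘ₗ G.horLift x) (e n) := by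
  rw [m₀_succ, he (n + 1) (by omega), wedgeForm_eq, add_eq_left]
  ext w
  simp [clForm_apply]

theorem ofDegZero_zero (u : ∀ x, V x) (x : X) :
    ofDegZero (EB := EB) ϖ u x 0 = AlternatingMap.constOfIsEmpty ℝ _ (Fin 0) (u x) :=
  Pi.single_eq_same _ _

theorem ofDegZero_of_ne (u : ∀ x, V x) (x : X) {k : ℕ} (hk : k ≠ 0) :
    ofDegZero (EB := EB) ϖ u x k = 0 := Pi.single_eq_of_ne hk _

theorem ofDegZero_of_pos (u : ∀ x, V x) (x : X) (k : ℕ) (hk : 0 < k) :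
    ofDegZero (EB := EB) ϖ u x k = 0 := ofDegZero_of_ne u x hk.ne'

theorem horTensor_eq (x : X) (α : Module.Dual ℝ (TangentSpace 𝓘(ℝ, EX) x)) (u : V x) :
    C.horTensor x α u = Pi.single 1 (C.wedgeForm x α (AlternatingMap.constOfIsEmpty ℝ _ (Fin 0) u)) :=
  rfl

/-- The section `u'` only matters through its value at `x`; a whole section appears because
`ofDegZero` acts on sections. -/
theorem m₀_ofDegZero (x : X) (α : Module.Dual ℝ (TangentSpace 𝓘(ℝ, EX) x)) (u : ∀ x, V x)
    (u' : ∀ x, V x) (hu' : u' x = C.cl x (α.domRestrict (Vertical EB EX ϖ x)) (u x)) :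
    C.m₀ x α (ofDegZero ϖ u x) = ofDegZero ϖ u' x + C.horTensor x α (u x) := by
  have hz := ofDegZero_of_pos (EB := EB) (ϖ := ϖ) u x
  funext k
  rw [Pi.add_apply]
  match k with
  | 0 =>
    rw [m₀_zero, ofDegZero_zero, ofDegZero_zero, horTensor_eq, Pi.single_eq_of_ne (by simp),
      add_zero, hu']
    ext w
    rfl
  | 1 =>
    rw [show C.m₀ x α (ofDegZero ϖ u x) 1 = _ from C.m₀_top hz α, ofDegZero_zero,
      ofDegZero_of_ne u' x (by simp), zero_add (C.horTensor x α (u x) 1)]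
    exact (Pi.single_eq_same (M := fun k => (TangentSpace 𝓘(ℝ, EB) (ϖ x)) [⋀^Fin k]→ₗ[ℝ] V x) _ _).symm
  | k + 2 =>
    rw [C.m₀_eq_zero_of_lt hz α (k + 2) (by omega), ofDegZero_of_ne u' x (by simp), zero_add,
      horTensor_eq, Pi.single_eq_of_ne (by simp)]

variable [FiniteDimensional ℝ EB]

theorem tensorConn_ofDegZero (SB : RiemannianStructure EB B) {u : ∀ x, V x}
    (hu : CMDiff ∞ (T% u)) (x : X) (v : TangentSpace 𝓘(ℝ, EX) x) :
    C.tensorConn SB (ofDegZero ϖ u) x v 0 =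
      AlternatingMap.constOfIsEmpty ℝ _ (Fin 0) (C.conn u x v) := by
  ext w
  rw [C.tensorConn_apply SB (smoothForm_ofDegZero hu), tensorConnFun]
  simp only [ofDegZero_zero]
  simp

theorem tensorConn_ofDegZero_of_pos (SB : RiemannianStructure EB B) {u : ∀ x, V x}
    (hu : CMDiff ∞ (T% u)) (x : X) (v : TangentSpace 𝓘(ℝ, EX) x) (k : ℕ) (hk : 0 < k) :
    C.tensorConn SB (ofDegZero ϖ u) x v k = 0 := by
  ext w
  rw [C.tensorConn_apply SB (smoothForm_ofDegZero hu), tensorConnFun]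
  simp only [ofDegZero_of_pos u _ k hk, AlternatingMap.zero_apply, Finset.sum_const_zero, sub_zero]
  have h := C.conn.isCovariantDerivativeOnUniv.zero (x := x)
  exact congrArg (fun A : TangentSpace 𝓘(ℝ, EX) x →L[ℝ] V x => A v) h

/-- In degree 0 every covector acts through its restriction to the vertical space. The derivative
term can therefore be summed over a vertical basis, which gives the Dirac operator, and the cubic
term only involves `omega` on vertical triples, where it vanishes. -/
theorem bismut_ofDegZero_zero (SB : RiemannianStructure EB B) {u : ∀ x, V x}
    (hu : CMDiff ∞ (T% u)) (x : X) :
    C.bismut SB (ofDegZero ϖ u) x 0 =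
      AlternatingMap.constOfIsEmpty ℝ _ (Fin 0) (C.dirac u x) := by
  let b := Module.finBasis ℝ (TangentSpace 𝓘(ℝ, EX) x)
  let f := (Vertical EB EX ϖ x).subtype
  have h1 : ∑ j, C.cl x (b.coord j ∘ₗ f) (C.conn u x (b j)) = C.dirac u x :=
    sum_coord_comp_eq b (Module.finBasis ℝ (Vertical EB EX ϖ x)) f
      ((C.clₗ x).compl₂ (C.conn u x).toLinearMap)
  have h2 : ∑ i, ∑ j, ∑ k, G.omega x (b i) (b j) (b k) •
      C.cl x (b.coord i ∘ₗ f) (C.cl x (b.coord j ∘ₗ f) (C.cl x (b.coord k ∘ₗ f) (u x))) = 0 :=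
    sum_coord_comp_three_eq_zero b f (G.omegaₗ x)
      (fun v y z => G.omega_vertical v.2 y.2 z.2) (C.clₗ x) (C.clₗ x) ((C.clₗ x).flip (u x))
  ext w
  rw [bismut_apply, Pi.add_apply, AlternatingMap.add_apply, Finset.sum_apply, Finset.sum_apply,
    AlternatingMap.sum_apply, AlternatingMap.sum_apply]
  simp only [m₀_zero, tensorConn_ofDegZero C SB hu, clForm_apply, halfOmega_apply, Pi.smul_apply,
    Finset.sum_apply, AlternatingMap.smul_apply, AlternatingMap.sum_apply, ofDegZero_zero,
    AlternatingMap.constOfIsEmpty_apply]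
  refine (congrArg₂ (· + ·) h1 ?_).trans (add_zero _)
  have h3 : ∀ i, C.cl x (b.coord i ∘ₗ f) ((1 / 4 : ℝ) • ∑ j, ∑ k, G.omega x (b i) (b j) (b k) •
      C.cl x (b.coord j ∘ₗ f) (C.cl x (b.coord k ∘ₗ f) (u x))) =
      (1 / 4 : ℝ) • ∑ j, ∑ k, G.omega x (b i) (b j) (b k) • C.cl x (b.coord i ∘ₗ f)
        (C.cl x (b.coord j ∘ₗ f) (C.cl x (b.coord k ∘ₗ f) (u x))) := fun i => by
    simp only [← clₗ_apply, map_smul, map_sum]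
  refine (Finset.sum_congr rfl fun i _ => h3 i).trans ?_
  rw [← Finset.smul_sum, h2, smul_zero]

/-- The derivative term has degree at most 1 and the cubic term at most 3. In degree 3 the latter
consists of three exterior multiplications, whose covectors only see horizontal lifts, and `omega`
vanishes on these. -/
theorem bismut_ofDegZero_of_three_le (SB : RiemannianStructure EB B) {u : ∀ x, V x}
    (hu : CMDiff ∞ (T% u)) (x : X) (k : ℕ) (hk : 3 ≤ k) :
    C.bismut SB (ofDegZero ϖ u) x k = 0 := by
  let b := Module.finBasis ℝ (TangentSpace 𝓘(ℝ, EX) x)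
  have hz := ofDegZero_of_pos (EB := EB) (ϖ := ϖ) u x
  have h1 : ∀ α, ∀ k, 1 < k → C.m₀ x α (ofDegZero ϖ u x) k = 0 :=
    fun α k hk => C.m₀_eq_zero_of_lt hz α k hk
  have h2 : ∀ α β, ∀ k, 2 < k → C.m₀ x α (C.m₀ x β (ofDegZero ϖ u x)) k = 0 :=
    fun α β k hk => C.m₀_eq_zero_of_lt (h1 β) α k hk
  have h3 : ∀ i, C.m₀ x (b.coord i) (C.halfOmega x (b i) (ofDegZero ϖ u x)) =
      (1 / 4 : ℝ) • ∑ j, ∑ k, G.omega x (b i) (b j) (b k) •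
        C.m₀ x (b.coord i) (C.m₀ x (b.coord j) (C.m₀ x (b.coord k) (ofDegZero ϖ u x))) :=
    fun i => by
      rw [halfOmega_apply]
      simp only [← m₀ₗ_apply, map_smul, map_sum]
      rfl
  rw [bismut_apply, Pi.add_apply, Finset.sum_apply, Finset.sum_apply,
    Finset.sum_eq_zero (fun j _ => C.m₀_eq_zero_of_lt
      (C.tensorConn_ofDegZero_of_pos SB hu x _) _ k (by omega)), zero_add,
    Finset.sum_congr rfl (fun i _ => congrFun (h3 i) k)]
  simp only [Pi.smul_apply, Finset.sum_apply]
  rw [← Finset.smul_sum]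
  -- Degree 3 needs the vanishing of `omega` on horizontal triples; above it the degree bound is
  -- enough.
  obtain rfl | hk' := hk.eq_or_lt
  · have h4 : ∀ i j l, C.m₀ x (b.coord i) (C.m₀ x (b.coord j) (C.m₀ x (b.coord l)
        (ofDegZero ϖ u x))) 3 = wedgeₗ V ϖ 2 x (b.coord i ∘ₗ G.horLift x)
          (wedgeₗ V ϖ 1 x (b.coord j ∘ₗ G.horLift x) (wedgeₗ V ϖ 0 x (b.coord l ∘ₗ G.horLift x)
            (ofDegZero ϖ u x 0))) := fun i j l => by
      rw [C.m₀_top (h2 _ _), C.m₀_top (h1 _), C.m₀_top hz]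
    simp only [h4]
    have h5 := sum_coord_comp_three_eq_zero b (G.horLift x) (G.omegaₗ x) (G.omega_horLift x)
      (wedgeₗ V ϖ 2 x) (wedgeₗ V ϖ 1 x) ((wedgeₗ V ϖ 0 x).flip (ofDegZero ϖ u x 0))
    exact (congrArg ((1 / 4 : ℝ) • ·) h5).trans (smul_zero _)
  · rw [Finset.sum_eq_zero fun i _ => Finset.sum_eq_zero fun j _ => Finset.sum_eq_zero fun l _ => ?_,
      smul_zero]
    rw [C.m₀_eq_zero_of_lt (h2 _ _) _ k hk', smul_zero]

theorem component_ofDegZero (P : (∀ x, FormFiber EB ϖ V x) → ∀ x, FormFiber EB ϖ V x) (j : ℕ)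
    (u : ∀ x, V x) (x : X) :
    component j P (ofDegZero ϖ u) x = Pi.single j (P (ofDegZero ϖ u) x j) := rfl

theorem bismut_ofDegZero (SB : RiemannianStructure EB B) {u : ∀ x, V x}
    (hu : CMDiff ∞ (T% u)) (x : X) :
    C.bismut SB (ofDegZero ϖ u) x = ofDegZero ϖ (C.dirac u) x +
      component 1 (C.bismut SB) (ofDegZero ϖ u) x +
      component 2 (C.bismut SB) (ofDegZero ϖ u) x := by
  rw [component_ofDegZero, component_ofDegZero]
  funext k
  rw [Pi.add_apply, Pi.add_apply]
  match k with
  | 0 => rw [bismut_ofDegZero_zero C SB hu, ofDegZero_zero]; simp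
  | 1 => rw [ofDegZero_of_ne _ _ (by simp)]; simp
  | 2 => rw [ofDegZero_of_ne _ _ (by simp)]; simp
  | k + 3 =>
    rw [bismut_ofDegZero_of_three_le C SB hu x _ (by omega), ofDegZero_of_ne _ _ (by simp),
      Pi.single_eq_of_ne (by omega), Pi.single_eq_of_ne (by omega)]
    simp

/-- This lets `D` be treated as one more component of the superconnection, so that the results on
components cover it. -/
theorem component_zero_bismut (SB : RiemannianStructure EB B) {s : ∀ x, FormFiber EB ϖ V x}
    (hs : SmoothForm EX F ϖ s) : component 0 (C.bismut SB) s = C.diracForm s := by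
  funext x
  exact congrArg (Pi.single 0) (bismut_ofDegZero_zero C SB hs.degZero x)

end CliffordFamily
end Clifford
end EndPeriodic
end

noncomputable section

namespace EndPeriodic

/-! ### The superconnection and its components as first-order operators. -/

section Leibniz

variable {EB : Type*} [NormedAddCommGroup EB] [NormedSpace ℝ EB]
  {B : Type*} [TopologicalSpace B] [ChartedSpace EB B] [IsManifold 𝓘(ℝ, EB) ∞ B]
  {EX : Type*} [NormedAddCommGroup EX] [NormedSpace ℝ EX] [FiniteDimensional ℝ EX]
  {X : Type*} [TopologicalSpace X] [ChartedSpace EX X] [IsManifold 𝓘(ℝ, EX) ∞ X] [T2Space X]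
  {F : Type*} [NormedAddCommGroup F] [NormedSpace ℝ F] [FiniteDimensional ℝ F]
  {V : X → Type*} [TopologicalSpace (TotalSpace F V)] [∀ x, AddCommGroup (V x)]
  [∀ x, Module ℝ (V x)] [∀ x, Module ℂ (V x)] [∀ x, IsScalarTower ℝ ℂ (V x)]
  [∀ x, TopologicalSpace (V x)] [∀ x, IsTopologicalAddGroup (V x)] [∀ x, ContinuousSMul ℝ (V x)]
  [FiberBundle F V] [VectorBundle ℝ F V] [ContMDiffVectorBundle ∞ F V 𝓘(ℝ, EX)]
  {ϖ : X → B} {G : RiemannianFamily (EB := EB) (EX := EX) ϖ}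

variable (EX F ϖ) in
/-- `A` is an additive first order differential operator whose symbol at the covectors in the
complex span of `τ` is `c τ ↦ c σ`. -/
structure IsFirstOrder (τ : ∀ x : X, Module.Dual ℝ (TangentSpace 𝓘(ℝ, EX) x))
    (A : (∀ x, FormFiber EB ϖ V x) → ∀ x, FormFiber EB ϖ V x)
    (σ : ∀ x, FormFiber EB ϖ V x → FormFiber EB ϖ V x) : Prop where
  add : ∀ s t, SmoothForm EX F ϖ s → SmoothForm EX F ϖ t → ∀ x, A (s + t) x = A s x + A t x
  leibniz : ∀ s, SmoothForm EX F ϖ s → ∀ φ : X → ℂ, ContMDiff 𝓘(ℝ, EX) 𝓘(ℝ, ℂ) ∞ φ →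
    ∀ (x : X) (c : ℂ), (∀ v : TangentSpace 𝓘(ℝ, EX) x,
      mfderiv 𝓘(ℝ, EX) 𝓘(ℝ, ℂ) φ x v = (τ x v : ℂ) * c) →
    A (fun x => φ x • s x) x = φ x • A s x + c • σ x (s x)

namespace CliffordFamily

variable (C : CliffordFamily G F V)

theorem degZero_ofDegZero_smul (φ : X → ℂ) (s : ∀ x, FormFiber EB ϖ V x) :
    ofDegZero (EB := EB) ϖ (degZero fun x => φ x • s x) =
      fun x => φ x • ofDegZero (EB := EB) ϖ (degZero s) x := by
  funext x k
  rw [Pi.smul_apply]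
  cases k with
  | zero => rw [ofDegZero_zero, ofDegZero_zero]; rfl
  | succ k => rw [ofDegZero_of_ne _ _ (by simp), ofDegZero_of_ne _ _ (by simp), smul_zero]

theorem ofDegZero_add (u u' : ∀ x, V x) :
    ofDegZero (EB := EB) ϖ (u + u') = ofDegZero ϖ u + ofDegZero ϖ u' := by
  funext x k
  rw [Pi.add_apply, Pi.add_apply]
  cases k with
  | zero => rw [ofDegZero_zero, ofDegZero_zero, ofDegZero_zero]; rfl
  | succ k =>
    rw [ofDegZero_of_ne _ _ (by simp), ofDegZero_of_ne _ _ (by simp),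
      ofDegZero_of_ne _ _ (by simp), zero_add]

theorem smoothForm_complex_smul (C : CliffordFamily G F V) {s : ∀ x, FormFiber EB ϖ V x} (hs : SmoothForm EX F ϖ s)
    {φ : X → ℂ} (hφ : ContMDiff 𝓘(ℝ, EX) 𝓘(ℝ, ℂ) ∞ φ) :
    SmoothForm EX F ϖ (fun x => φ x • s x) :=
  fun x => C.smoothFormAt_complex_smul (hφ x) (hs x)

/-- A `CovariantDerivative` only has a Leibniz rule for real functions. The complex rule follows by
splitting `φ` into real and imaginary part and using that the connection commutes with `I`. -/
theorem conn_complex_smul {s : ∀ x, V x} {x : X} (hs : CMDiffAt ∞ (T% s) x) {φ : X → ℂ}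
    (hφ : ContMDiffAt 𝓘(ℝ, EX) 𝓘(ℝ, ℂ) ∞ φ x) (v : TangentSpace 𝓘(ℝ, EX) x) :
    C.conn (fun x => φ x • s x) x v =
      φ x • C.conn s x v + (show ℂ from mfderiv 𝓘(ℝ, EX) 𝓘(ℝ, ℂ) φ x v) • s x := by
  have hI : CMDiffAt ∞ (T% (fun x => Complex.I • s x)) x :=
    C.contMDiffAt_complex_smul contMDiffAt_const hs
  have hre : ContMDiffAt 𝓘(ℝ, EX) 𝓘(ℝ, ℝ) ∞ (fun x => (φ x).re) x :=
    Complex.reCLM.contDiff.contMDiff.contMDiffAt.comp x hφ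
  have him : ContMDiffAt 𝓘(ℝ, EX) 𝓘(ℝ, ℝ) ∞ (fun x => (φ x).im) x :=
    Complex.imCLM.contDiff.contMDiff.contMDiffAt.comp x hφ
  have hre' : mfderiv 𝓘(ℝ, EX) 𝓘(ℝ, ℝ) (fun x => (φ x).re) x v =
      (show ℂ from mfderiv 𝓘(ℝ, EX) 𝓘(ℝ, ℂ) φ x v).re := by
    have h := ((Complex.reCLM.hasFDerivAt (x := φ x)).hasMFDerivAt.comp x
      (hφ.mdifferentiableAt (by simp)).hasMFDerivAt).mfderiv
    exact congrArg (fun A : TangentSpace 𝓘(ℝ, EX) x →L[ℝ] ℝ => A v) h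
  have him' : mfderiv 𝓘(ℝ, EX) 𝓘(ℝ, ℝ) (fun x => (φ x).im) x v =
      (show ℂ from mfderiv 𝓘(ℝ, EX) 𝓘(ℝ, ℂ) φ x v).im := by
    have h := ((Complex.imCLM.hasFDerivAt (x := φ x)).hasMFDerivAt.comp x
      (hφ.mdifferentiableAt (by simp)).hasMFDerivAt).mfderiv
    exact congrArg (fun A : TangentSpace 𝓘(ℝ, EX) x →L[ℝ] ℝ => A v) h
  have hz : ∀ {x : X} (z : ℂ) (u : V x), z • u = z.re • u + z.im • Complex.I • u := fun z u => by
    conv_lhs => rw [← Complex.re_add_im z]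
    rw [add_smul, mul_smul, ← algebraMap_smul ℂ z.re, ← algebraMap_smul ℂ z.im]
    rfl
  have h0 : (fun x => φ x • s x) = (fun x => (φ x).re) • s + (fun x => (φ x).im) •
      fun x => Complex.I • s x := by
    funext x
    exact hz (φ x) (s x)
  have hs' := hs.mdifferentiableAt (by simp)
  have hI' := hI.mdifferentiableAt (by simp)
  have hre'' := hre.mdifferentiableAt (by simp)
  have him'' := him.mdifferentiableAt (by simp)
  rw [h0, C.conn.isCovariantDerivativeOnUniv.add
      ((hre.smul_section hs).mdifferentiableAt (by simp))
      ((him.smul_section hI).mdifferentiableAt (by simp)),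
    C.conn.isCovariantDerivativeOnUniv.leibniz hs' hre'',
    C.conn.isCovariantDerivativeOnUniv.leibniz hI' him'']
  change (φ x).re • C.conn s x v + (show ℝ from mfderiv 𝓘(ℝ, EX) 𝓘(ℝ, ℝ) (fun x => (φ x).re) x v)
    • s x + ((φ x).im • C.conn (fun x => Complex.I • s x) x v +
      (show ℝ from mfderiv 𝓘(ℝ, EX) 𝓘(ℝ, ℝ) (fun x => (φ x).im) x v) • Complex.I • s x) = _
  rw [C.conn_complex x s hs', hre', him', hz (φ x) (C.conn s x v),
    hz (show ℂ from mfderiv 𝓘(ℝ, EX) 𝓘(ℝ, ℂ) φ x v) (s x)]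
  abel

end CliffordFamily

/-- Passing to the degree zero part, and then to the part of degree `j` of the image, are fibrewise
linear operations over the complex numbers, so they commute with multiplication by functions and
simply truncate the symbol. -/
theorem IsFirstOrder.component {τ : ∀ x : X, Module.Dual ℝ (TangentSpace 𝓘(ℝ, EX) x)}
    {A : (∀ x, FormFiber EB ϖ V x) → ∀ x, FormFiber EB ϖ V x}
    {σ : ∀ x, FormFiber EB ϖ V x → FormFiber EB ϖ V x}
    (hA : IsFirstOrder EX F ϖ τ A σ) (j : ℕ) :
    IsFirstOrder EX F ϖ τ (EndPeriodic.component j A)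
      (fun x e => Pi.single j (σ x (Pi.single 0 (AlternatingMap.constOfIsEmpty ℝ _ (Fin 0)
        (e 0 Fin.elim0))) j)) where
  add s t hs ht x := by
    have h := hA.add _ _ (smoothForm_ofDegZero (ϖ := ϖ) hs.degZero)
      (smoothForm_ofDegZero (ϖ := ϖ) ht.degZero) x
    rw [← CliffordFamily.ofDegZero_add] at h
    rw [EndPeriodic.component, EndPeriodic.component, EndPeriodic.component, ← Pi.single_add]
    exact congrArg (Pi.single j) (congrFun h j)
  leibniz s hs φ hφ x c hc := by
    have h := hA.leibniz _ (smoothForm_ofDegZero (ϖ := ϖ) hs.degZero) φ hφ x c hc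
    rw [← CliffordFamily.degZero_ofDegZero_smul] at h
    rw [EndPeriodic.component, EndPeriodic.component, ← Pi.single_smul, ← Pi.single_smul,
      ← Pi.single_add]
    exact congrArg (Pi.single j) (congrFun h j)

variable [FiniteDimensional ℝ EB]

namespace CliffordFamily

variable (C : CliffordFamily G F V)

theorem tensorConn_complex_smul (SB : RiemannianStructure EB B) {s : ∀ x, FormFiber EB ϖ V x}
    (hs : SmoothForm EX F ϖ s) {φ : X → ℂ} (hφ : ContMDiff 𝓘(ℝ, EX) 𝓘(ℝ, ℂ) ∞ φ) (x : X)
    (v : TangentSpace 𝓘(ℝ, EX) x) :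
    C.tensorConn SB (fun x => φ x • s x) x v =
      φ x • C.tensorConn SB s x v + (show ℂ from mfderiv 𝓘(ℝ, EX) 𝓘(ℝ, ℂ) φ x v) • s x := by
  funext k
  ext w
  rw [C.tensorConn_apply SB (C.smoothForm_complex_smul hs hφ)]
  change _ = φ x • C.tensorConn SB s x v k w +
    (show ℂ from mfderiv 𝓘(ℝ, EX) 𝓘(ℝ, ℂ) φ x v) • s x k w
  have h := C.conn_complex_smul (hs x k (fun i => FiberBundle.extend
    (E := fun b : B => TangentSpace 𝓘(ℝ, EB) b) EB (w i))
      (fun i => FiberBundle.contMDiffAt_extend _ _ _)) (hφ x) v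
  rw [C.tensorConn_apply SB hs, tensorConnFun, tensorConnFun]
  refine (congrArg (fun z => z - _) h).trans ?_
  simp only [FiberBundle.extend_apply_self, smul_sub, Finset.smul_sum]
  exact add_sub_right_comm _ _ _

theorem tensorConn_add (SB : RiemannianStructure EB B) {s t : ∀ x, FormFiber EB ϖ V x}
    (hs : SmoothForm EX F ϖ s) (ht : SmoothForm EX F ϖ t) (x : X)
    (v : TangentSpace 𝓘(ℝ, EX) x) :
    C.tensorConn SB (s + t) x v = C.tensorConn SB s x v + C.tensorConn SB t x v := by
  funext k
  ext w
  have hst : SmoothForm EX F ϖ (s + t) := fun x => SmoothFormAt.add (hs x) (ht x)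
  rw [C.tensorConn_apply SB hst]
  change _ = C.tensorConn SB s x v k w + C.tensorConn SB t x v k w
  have hW : ∀ i, CMDiffAt ∞ (T% (FiberBundle.extend (E := fun b : B => TangentSpace 𝓘(ℝ, EB) b) EB
    (w i))) (ϖ x) := fun i => FiberBundle.contMDiffAt_extend _ _ _
  have h := C.conn.isCovariantDerivativeOnUniv.add
    ((hs x k (fun i => FiberBundle.extend (E := fun b : B => TangentSpace 𝓘(ℝ, EB) b) EB (w i))
      hW).mdifferentiableAt (by simp))
    ((ht x k (fun i => FiberBundle.extend (E := fun b : B => TangentSpace 𝓘(ℝ, EB) b) EB (w i))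
      hW).mdifferentiableAt (by simp))
  have h' := congrArg (fun A : TangentSpace 𝓘(ℝ, EX) x →L[ℝ] V x => A v) h
  rw [C.tensorConn_apply SB hs, C.tensorConn_apply SB ht, tensorConnFun, tensorConnFun,
    tensorConnFun]
  refine (congrArg (fun z => z - _) h').trans ?_
  simp only [Pi.add_apply, AlternatingMap.add_apply, Finset.sum_add_distrib]
  exact add_sub_add_comm _ _ _ _

/-- Only the derivative term produces `dφ`. If `dφ = c τ` at `x`, the extra contribution is `∑
m₀(e^j) (c τ(e_j) s) = c m₀(τ) s`; the term with `omega` is of order zero. -/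
theorem isFirstOrder_bismut (SB : RiemannianStructure EB B)
    (τ : ∀ x : X, Module.Dual ℝ (TangentSpace 𝓘(ℝ, EX) x)) :
    IsFirstOrder EX F ϖ τ (C.bismut SB) (fun x e => C.m₀ x (τ x) e) where
  add s t hs ht x := by
    simp only [bismut_apply, C.tensorConn_add SB hs ht, Pi.add_apply, halfOmega_add, ← m₀ₗ_apply,
      map_add, Finset.sum_add_distrib]
    abel
  leibniz s hs φ hφ x c hc := by
    let b := Module.finBasis ℝ (TangentSpace 𝓘(ℝ, EX) x)
    have h1 : ∀ j, C.tensorConn SB (fun x => φ x • s x) x (b j) =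
        φ x • C.tensorConn SB s x (b j) + τ x (b j) • c • s x := fun j => by
      rw [C.tensorConn_complex_smul SB hs hφ, real_smul_form, smul_smul, ← hc]
    have h2 : ∑ j, τ x (b j) • b.coord j = τ x := by
      refine b.ext fun i => ?_
      rw [LinearMap.sum_apply, Finset.sum_eq_single i]
      · simp
      · intro j _ hj
        simp [hj.symm]
      · simp
    have h3 : ∑ j, C.m₀ x (b.coord j) (C.tensorConn SB (fun x => φ x • s x) x (b j)) =
        φ x • ∑ j, C.m₀ x (b.coord j) (C.tensorConn SB s x (b j)) + c • C.m₀ x (τ x) (s x) := by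
      have h4 : ∑ j, τ x (b j) • C.m₀ₗ x (b.coord j) (c • s x) = C.m₀ₗ x (τ x) (c • s x) := by
        conv_rhs => rw [← h2, map_sum, LinearMap.sum_apply]
        exact Finset.sum_congr rfl fun j _ => (congrArg (fun A : FormFiber EB ϖ V x →ₗ[ℝ] _ =>
          A (c • s x)) ((C.m₀ₗ x).map_smul (τ x (b j)) (b.coord j))).symm
      rw [← C.m₀_smul_right, ← m₀ₗ_apply C x (τ x), ← h4, Finset.smul_sum,
        ← Finset.sum_add_distrib]
      refine Finset.sum_congr rfl fun j _ => ?_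
      rw [h1, ← m₀ₗ_apply, map_add, (C.m₀ₗ x (b.coord j)).map_smul, m₀ₗ_apply,
        m₀_smul_right]
    have h5 : ∑ j, C.m₀ x (b.coord j) (C.halfOmega x (b j) (φ x • s x)) =
        φ x • ∑ j, C.m₀ x (b.coord j) (C.halfOmega x (b j) (s x)) := by
      rw [Finset.smul_sum]
      exact Finset.sum_congr rfl fun j _ => by rw [halfOmega_smul, m₀_smul_right]
    rw [bismut_apply, bismut_apply, smul_add, add_right_comm]
    exact congrArg₂ (· + ·) h3 h5

end CliffordFamily

/-- Locality follows from the Leibniz rule. For a bump `φ` that is 1 near `x` and supported where `s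
= t`, the sections `φ s` and `φ t` coincide, and since `dφ = 0` at `x` the rule with `c = 0` gives
`A (φ s) x = A s x`, and likewise for `t`. -/
theorem IsFirstOrder.congr {τ : ∀ x : X, Module.Dual ℝ (TangentSpace 𝓘(ℝ, EX) x)}
    {A : (∀ x, FormFiber EB ϖ V x) → ∀ x, FormFiber EB ϖ V x}
    {σ : ∀ x, FormFiber EB ϖ V x → FormFiber EB ϖ V x}
    (hA : IsFirstOrder EX F ϖ τ A σ) {s t : ∀ x, FormFiber EB ϖ V x}
    (hs : SmoothForm EX F ϖ s) (ht : SmoothForm EX F ϖ t) {x : X}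
    (h : ∀ᶠ x' in 𝓝 x, s x' = t x') : A s x = A t x := by
  obtain ⟨φ, hφ, h1, h0⟩ := exists_bump (EX := EX) h
  have hφ' : ContMDiff 𝓘(ℝ, EX) 𝓘(ℝ, ℂ) ∞ (fun x => (φ x : ℂ)) :=
    Complex.ofRealCLM.contDiff.contMDiff.comp hφ
  have hd : ∀ v : TangentSpace 𝓘(ℝ, EX) x,
      mfderiv 𝓘(ℝ, EX) 𝓘(ℝ, ℂ) (fun x => (φ x : ℂ)) x v = (τ x v : ℂ) * 0 := fun v => by
    have h2 : (fun x => (φ x : ℂ)) =ᶠ[𝓝 x] fun _ => (1 : ℂ) := h1.mono fun x' hx' => by simp [hx']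
    exact (congrArg (fun A : TangentSpace 𝓘(ℝ, EX) x →L[ℝ] ℂ => A v)
      (h2.mfderiv_eq.trans mfderiv_const)).trans (mul_zero _).symm
  have hst : (fun x => (φ x : ℂ) • s x) = fun x => (φ x : ℂ) • t x := by
    funext x'
    by_cases hx' : s x' = t x'
    · rw [hx']
    · rw [(h0 x' hx').self_of_nhds]; simp
  have hs' := hA.leibniz s hs _ hφ' x 0 hd
  have ht' := hA.leibniz t ht _ hφ' x 0 hd
  rw [h1.self_of_nhds] at hs' ht'
  rw [hst] at hs'
  simpa using hs'.symm.trans ht'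

end Leibniz
end EndPeriodic
end

noncomputable section

namespace EndPeriodic

/-! ### Local sections of the cyclic cover and smoothness of its height. -/

namespace CyclicCover

variable {EY : Type*} [NormedAddCommGroup EY] [NormedSpace ℝ EY]
  {Y : Type*} [TopologicalSpace Y] [ChartedSpace EY Y]
  {f₀ : C^∞⟮𝓘(ℝ, EY), Y; 𝓡 1, Circle⟯}

theorem continuous_pair : Continuous (fun x : CyclicCover f₀ => (x.height, x.proj)) :=
  isInducing.continuous

theorem continuous_height : Continuous (height : CyclicCover f₀ → ℝ) := continuous_pair.fst

theorem continuous_proj : Continuous (proj : CyclicCover f₀ → Y) := continuous_pair.snd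

/-- The branch of the height function that takes the value `x.height` at `x.proj`. -/
def localHeight (x : CyclicCover f₀) (y : Y) : ℝ :=
  x.height + (2 * Real.pi)⁻¹ * Complex.arg (f₀ y / f₀ x.proj : Circle)

/-- The local section of the covering projection that takes the value `x` at `x.proj`. -/
def localSection (x : CyclicCover f₀) (y : Y) : CyclicCover f₀ where
  height := x.localHeight y
  proj := y
  exp_height := by
    have hpi : (2 * Real.pi) ≠ 0 := by positivity
    rw [localHeight, mul_add, mul_inv_cancel_left₀ hpi, Circle.exp_add, x.exp_height,
      Circle.exp_arg, mul_div_cancel]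

theorem localSection_self (x : CyclicCover f₀) : x.localSection x.proj = x := by
  refine CyclicCover.ext ?_ rfl
  change x.localHeight x.proj = _
  simp [localHeight]

theorem localSection_deck (x : CyclicCover f₀) (m : ℤ) (y : Y) :
    (x.deck m).localSection y = (x.localSection y).deck m := by
  refine CyclicCover.ext ?_ rfl
  change x.height + m + _ = x.height + _ + m
  exact add_right_comm _ _ _

theorem abs_localHeight_sub_le (x : CyclicCover f₀) (y : Y) :
    |x.localHeight y - x.height| ≤ 1 / 2 := by
  rw [localHeight, add_sub_cancel_left, abs_mul, abs_of_pos (by positivity)]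
  have h := Complex.abs_arg_le_pi (f₀ y / f₀ x.proj : Circle)
  calc (2 * Real.pi)⁻¹ * |Complex.arg (f₀ y / f₀ x.proj : Circle)|
      ≤ (2 * Real.pi)⁻¹ * Real.pi := by gcongr
    _ = 1 / 2 := by field_simp

/-- When the heights differ by less than 1/2, the angle `2π (x'.height - x.height)` lies in `(-π,
π)` and is recovered by the principal argument. -/
theorem localSection_proj {x x' : CyclicCover f₀} (h : |x'.height - x.height| < 1 / 2) :
    x.localSection x'.proj = x' := by
  refine CyclicCover.ext ?_ rfl
  change x.localHeight x'.proj = x'.height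
  have hq : f₀ x'.proj / f₀ x.proj = Circle.exp (2 * Real.pi * (x'.height - x.height)) := by
    rw [mul_sub, Circle.exp_sub, x.exp_height, x'.exp_height]
  have hpi := Real.pi_pos
  rw [abs_lt] at h
  rw [localHeight, hq, Circle.arg_exp (by nlinarith) (by nlinarith)]
  field_simp
  ring

theorem eventually_localSection_proj (x : CyclicCover f₀) :
    ∀ᶠ x' in 𝓝 x, x.localSection x'.proj = x' := by
  have h : ∀ᶠ x' in 𝓝 x, |x'.height - x.height| < 1 / 2 :=
    ((continuous_height.sub continuous_const).abs.tendsto' x 0 (by simp)).eventually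
      (gt_mem_nhds (by norm_num))
  exact h.mono fun x' hx' => localSection_proj hx'

/-- The points of `Y` where the local section through `x` is smooth. -/
def regular (x : CyclicCover f₀) : Set Y :=
  {y | ((f₀ y / f₀ x.proj : Circle) : ℂ) ∈ Complex.slitPlane}

theorem isOpen_regular (x : CyclicCover f₀) : IsOpen x.regular := by
  have hf : Continuous f₀ := f₀.contMDiff.continuous
  exact Complex.isOpen_slitPlane.preimage (continuous_subtype_val.comp (hf.div_const _))

theorem proj_mem_regular (x : CyclicCover f₀) : x.proj ∈ x.regular := by
  simp [regular]

theorem contMDiff_coe : ContMDiff 𝓘(ℝ, EY) 𝓘(ℝ, ℂ) ∞ (fun y => (f₀ y : ℂ)) :=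
  haveI : Fact (Module.finrank ℝ ℂ = 1 + 1) := finrank_real_complex_fact'
  (contMDiff_coe_sphere (E := ℂ) (n := 1)).comp f₀.contMDiff

theorem localHeight_eq (x : CyclicCover f₀) : x.localHeight =
    fun y => x.height + (2 * Real.pi)⁻¹ * (Complex.log ((f₀ x.proj : ℂ)⁻¹ * (f₀ y : ℂ))).im := by
  funext y
  rw [localHeight, Complex.log_im, Circle.coe_div, div_eq_inv_mul]

/-- Away from the slit, the branch is a constant plus `(2π)⁻¹ Im log` of a constant multiple of
`f₀`, so its derivative is `(2π)⁻¹ Im (f₀⁻¹ df₀)`, and on the circle the inverse is the conjugate.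
Every branch of the height thus has the same differential `dHeight`, although the height itself does
not descend to `Y`. -/
theorem contMDiffAt_localHeight (x : CyclicCover f₀) {y : Y} (hy : y ∈ x.regular) :
    ContMDiffAt 𝓘(ℝ, EY) 𝓘(ℝ, ℝ) ∞ x.localHeight y ∧
      ∀ v : TangentSpace 𝓘(ℝ, EY) y,
        mfderiv 𝓘(ℝ, EY) 𝓘(ℝ, ℝ) x.localHeight y v = dHeight f₀ y v := by
  have hy' : (f₀ x.proj : ℂ)⁻¹ * (f₀ y : ℂ) ∈ Complex.slitPlane := by
    rw [← div_eq_inv_mul, ← Circle.coe_div]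
    exact hy
  let g : ℂ → ℝ := fun z => x.height + (2 * Real.pi)⁻¹ *
    (Complex.log ((f₀ x.proj : ℂ)⁻¹ * z)).im
  have hg1 : ContDiffAt ℝ ∞ g (f₀ y : ℂ) := by
    have h1 : ContDiffAt ℝ ∞ (fun z : ℂ => (f₀ x.proj : ℂ)⁻¹ * z) (f₀ y : ℂ) :=
      contDiffAt_const.mul contDiffAt_id
    have h2 : ContDiffAt ℝ ∞ Complex.log ((f₀ x.proj : ℂ)⁻¹ * (f₀ y : ℂ)) :=
      (Complex.contDiffAt_log hy').restrict_scalars ℝ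
    exact contDiffAt_const.add (contDiffAt_const.mul
      (Complex.imCLM.contDiff.contDiffAt.comp _ (h2.comp _ h1)))
  have hg2 : ∀ z, fderiv ℝ g (f₀ y : ℂ) z =
      (2 * Real.pi)⁻¹ * ((starRingEnd ℂ) (f₀ y : ℂ) * z).im := fun z => by
    have h1 : HasDerivAt (fun z : ℂ => Complex.log ((f₀ x.proj : ℂ)⁻¹ * z))
        ((f₀ x.proj : ℂ)⁻¹ * 1 / ((f₀ x.proj : ℂ)⁻¹ * (f₀ y : ℂ))) (f₀ y : ℂ) :=
      ((hasDerivAt_id _).const_mul _).clog hy'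
    have h2 : ((f₀ x.proj : ℂ)⁻¹ * 1 / ((f₀ x.proj : ℂ)⁻¹ * (f₀ y : ℂ))) =
        (starRingEnd ℂ) (f₀ y : ℂ) := by
      rw [mul_one, ← Circle.coe_inv_eq_conj]
      have := Circle.coe_ne_zero (f₀ x.proj)
      have := Circle.coe_ne_zero (f₀ y)
      rw [Circle.coe_inv]
      field_simp
    rw [h2] at h1
    have h3 := (Complex.imCLM.hasFDerivAt.comp (f₀ y : ℂ) (h1.hasFDerivAt.restrictScalars ℝ))
    have h4 : HasFDerivAt g _ (f₀ y : ℂ) := (h3.const_mul (2 * Real.pi)⁻¹).const_add x.height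
    rw [h4.fderiv]
    simp [mul_comm]
  have hc : x.localHeight = g ∘ fun y => (f₀ y : ℂ) := x.localHeight_eq
  have hf := contMDiff_coe (f₀ := f₀) y
  refine ⟨hc ▸ hg1.contMDiffAt.comp y hf, fun v => ?_⟩
  have h5 := mfderiv_comp y (hg1.contMDiffAt.mdifferentiableAt (by simp))
    (hf.mdifferentiableAt (by simp))
  rw [← hc, mfderiv_eq_fderiv] at h5
  exact (congrArg (fun A : TangentSpace 𝓘(ℝ, EY) y →L[ℝ] ℝ => A v) h5).trans (hg2 _)

theorem continuousAt_localSection (x : CyclicCover f₀) {y : Y} (hy : y ∈ x.regular) :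
    ContinuousAt x.localSection y :=
  isInducing.continuousAt_iff.2
    ((x.contMDiffAt_localHeight hy).1.continuousAt.prodMk continuousAt_id)

/-- The local section through `x` as a partial homeomorphism. -/
def localHomeo (x : CyclicCover f₀) : OpenPartialHomeomorph Y (CyclicCover f₀) where
  toFun := x.localSection
  invFun := proj
  source := x.regular
  target := {x' | x'.proj ∈ x.regular ∧ |x'.height - x.height| < 1 / 2}
  map_source' y hy := by
    refine ⟨hy, ?_⟩
    change |x.localHeight y - x.height| < 1 / 2
    rw [localHeight, add_sub_cancel_left, abs_mul, abs_of_pos (by positivity)]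
    -- The value `π` is excluded by the slit plane and `-π` is never a principal argument;
    -- strictness is needed for the open target.
    have h : |Complex.arg (f₀ y / f₀ x.proj : Circle)| < Real.pi :=
      (Complex.abs_arg_le_pi _).lt_of_ne fun h => by
        obtain h | h := (abs_eq Real.pi_pos.le).1 h
        · exact (Complex.mem_slitPlane_iff_arg.1 hy).1 h
        · exact (Complex.neg_pi_lt_arg _).ne' h
    calc (2 * Real.pi)⁻¹ * |Complex.arg (f₀ y / f₀ x.proj : Circle)|
        < (2 * Real.pi)⁻¹ * Real.pi := by gcongr
      _ = 1 / 2 := by field_simp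
  map_target' x' hx' := hx'.1
  left_inv' y _ := rfl
  right_inv' x' hx' := localSection_proj hx'.2
  open_source := isOpen_regular x
  open_target := ((isOpen_regular x).preimage continuous_proj).inter
    (isOpen_lt (continuous_height.sub continuous_const).abs continuous_const)
  continuousOn_toFun y hy := (x.continuousAt_localSection hy).continuousWithinAt
  continuousOn_invFun := continuous_proj.continuousOn

/-- The cover is closed in `ℝ × Y`, so the set is a closed piece of a product of two compact sets.
-/
theorem isCompact_abs_height_le [CompactSpace Y] (R : ℝ) :
    IsCompact {x : CyclicCover f₀ | |x.height| ≤ R} := by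
  have hf : Continuous f₀ := f₀.contMDiff.continuous
  have hcl : Topology.IsClosedEmbedding (fun x : CyclicCover f₀ => (x.height, x.proj)) := by
    refine ⟨⟨isInducing, fun x x' h => CyclicCover.ext (congrArg Prod.fst h)
      (congrArg Prod.snd h)⟩, ?_⟩
    have : Set.range (fun x : CyclicCover f₀ => (x.height, x.proj)) =
        {q | Circle.exp (2 * Real.pi * q.1) = f₀ q.2} := by
      ext q
      exact ⟨fun ⟨x, hx⟩ => hx ▸ x.exp_height, fun hq => ⟨⟨q.1, q.2, hq⟩, rfl⟩⟩
    rw [this]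
    exact isClosed_eq (Circle.exp.continuous.comp (continuous_const.mul continuous_fst))
      (hf.comp continuous_snd)
  refine (hcl.isCompact_preimage ((isCompact_Icc (a := -R) (b := R)).prod
    (isCompact_univ (X := Y)))).of_isClosed_subset ?_ fun x hx => ?_
  · exact isClosed_le continuous_height.abs continuous_const
  · exact ⟨abs_le.1 hx, trivial⟩

/-- A chart of the cover is a chart of `Y` read through the projection. In such charts the
projection and the local sections are both the identity, hence smooth. -/
theorem chartAt_apply (x x' : CyclicCover f₀) :
    chartAt EY x x' = chartAt EY x.proj x'.proj := by
  change chartAt EY x.proj ((isLocalHomeomorph_proj.localInverseAt x).symm x') = _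
  rw [isLocalHomeomorph_proj.localInverseAt_symm]

variable [IsManifold 𝓘(ℝ, EY) ∞ Y]

theorem contMDiff_proj : ContMDiff 𝓘(ℝ, EY) 𝓘(ℝ, EY) ∞ (proj : CyclicCover f₀ → Y) := by
  intro x
  have h1 : ContMDiffAt 𝓘(ℝ, EY) 𝓘(ℝ, EY) ∞ (chartAt EY x) x :=
    contMDiffAt_of_mem_maximalAtlas (IsManifold.chart_mem_maximalAtlas x) (mem_chart_source EY x)
  have h2 : ContMDiffAt 𝓘(ℝ, EY) 𝓘(ℝ, EY) ∞ (chartAt EY x.proj).symm (chartAt EY x x) :=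
    contMDiffAt_symm_of_mem_maximalAtlas (IsManifold.chart_mem_maximalAtlas x.proj)
      (by rw [chartAt_apply]; exact mem_chart_target EY x.proj)
  refine (h2.comp x h1).congr_of_eventuallyEq ?_
  filter_upwards [continuous_proj.continuousAt.eventually
    ((chartAt EY x.proj).open_source.mem_nhds (mem_chart_source EY x.proj))] with x' hx'
  rw [Function.comp_apply, chartAt_apply]
  exact ((chartAt EY x.proj).left_inv hx').symm

theorem contMDiffAt_localSection (x : CyclicCover f₀) {y : Y} (hy : y ∈ x.regular) :
    ContMDiffAt 𝓘(ℝ, EY) 𝓘(ℝ, EY) ∞ x.localSection y := by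
  have h1 : ContMDiffAt 𝓘(ℝ, EY) 𝓘(ℝ, EY) ∞ (chartAt EY y) y :=
    contMDiffAt_of_mem_maximalAtlas (IsManifold.chart_mem_maximalAtlas y) (mem_chart_source EY y)
  have h2 : ContMDiffAt 𝓘(ℝ, EY) 𝓘(ℝ, EY) ∞ (chartAt EY (x.localSection y)).symm
      (chartAt EY y y) :=
    contMDiffAt_symm_of_mem_maximalAtlas (IsManifold.chart_mem_maximalAtlas (x.localSection y))
      (by have h := mem_chart_target EY (x.localSection y)
          rw [chartAt_apply] at h
          exact h)
  refine (h2.comp y h1).congr_of_eventuallyEq ?_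
  filter_upwards [(x.continuousAt_localSection hy).eventually
    ((chartAt EY (x.localSection y)).open_source.mem_nhds (mem_chart_source EY _))] with y' hy'
  rw [Function.comp_apply]
  refine ((chartAt EY (x.localSection y)).left_inv hy').symm.trans ?_
  rw [chartAt_apply]
  rfl

theorem mfderiv_proj_localSection (x : CyclicCover f₀) {y : Y} (hy : y ∈ x.regular)
    (v : TangentSpace 𝓘(ℝ, EY) y) :
    mfderiv 𝓘(ℝ, EY) 𝓘(ℝ, EY) proj (x.localSection y)
      (mfderiv 𝓘(ℝ, EY) 𝓘(ℝ, EY) x.localSection y v) = v := by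
  have h := mfderiv_comp y ((contMDiff_proj (f₀ := f₀) (x.localSection y)).mdifferentiableAt
    (by simp)) ((x.contMDiffAt_localSection hy).mdifferentiableAt (by simp))
  have h' : (proj : CyclicCover f₀ → Y) ∘ x.localSection = id := rfl
  rw [h', mfderiv_id] at h
  exact (congrArg (fun A : TangentSpace 𝓘(ℝ, EY) y →L[ℝ] TangentSpace 𝓘(ℝ, EY) y => A v) h).symm

end CyclicCover

section Sections

variable {EB : Type*} [NormedAddCommGroup EB] [NormedSpace ℝ EB]
  {B : Type*} [TopologicalSpace B] [ChartedSpace EB B] [IsManifold 𝓘(ℝ, EB) ∞ B]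
  {EY : Type*} [NormedAddCommGroup EY] [NormedSpace ℝ EY] [FiniteDimensional ℝ EY]
  {Y : Type*} [TopologicalSpace Y] [ChartedSpace EY Y] [IsManifold 𝓘(ℝ, EY) ∞ Y]
  {F : Type*} [NormedAddCommGroup F] [NormedSpace ℝ F]
  {V : Y → Type*} [TopologicalSpace (TotalSpace F V)] [∀ y, AddCommGroup (V y)]
  [∀ y, Module ℝ (V y)] [∀ y, Module ℂ (V y)] [∀ y, IsScalarTower ℝ ℂ (V y)]
  [∀ y, TopologicalSpace (V y)] [∀ y, IsTopologicalAddGroup (V y)] [∀ y, ContinuousSMul ℝ (V y)]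
  [FiberBundle F V] [VectorBundle ℝ F V]
  {f₀ : C^∞⟮𝓘(ℝ, EY), Y; 𝓡 1, Circle⟯} {ϖY : Y → B}

theorem SmoothForm.smoothAlong {v : ∀ y, FormFiber EB ϖY V y} (hv : SmoothForm EY F ϖY v) :
    SmoothAlong EY F (EX' := EY) ϖY (CyclicCover.proj (f₀ := f₀)) (fun x => v x.proj) :=
  fun x k W hW => (hv x.proj k W hW).comp x (CyclicCover.contMDiff_proj x)

theorem SmoothAlong.localSection {u : ∀ x : CyclicCover f₀, FormFiber EB ϖY V x.proj}
    (hu : SmoothAlong EY F (EX' := EY) ϖY CyclicCover.proj u) (x : CyclicCover f₀) {y : Y}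
    (hy : y ∈ x.regular) : SmoothFormAt EY F ϖY (fun y' => u (x.localSection y')) y :=
  fun k W hW => ContMDiffAt.comp (I' := 𝓘(ℝ, EY)) y (hu (x.localSection y) k W hW)
    (x.contMDiffAt_localSection hy)

end Sections
end EndPeriodic
end

noncomputable section

namespace EndPeriodic

/-! ### Invariance of the Levi-Civita connection under local isometries. -/

section Isometry

variable {E : Type*} [NormedAddCommGroup E] [NormedSpace ℝ E] [FiniteDimensional ℝ E]
  {M : Type*} [TopologicalSpace M] [ChartedSpace E M] [IsManifold 𝓘(ℝ, E) ∞ M]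
  {E' : Type*} [NormedAddCommGroup E'] [NormedSpace ℝ E'] [FiniteDimensional ℝ E']
  {M' : Type*} [TopologicalSpace M'] [ChartedSpace E' M'] [IsManifold 𝓘(ℝ, E') ∞ M']

/-- The derivative of a real valued function in the direction of a tangent vector. -/
def dirDeriv (g : M → ℝ) (x : M) (v : TangentSpace 𝓘(ℝ, E) x) : ℝ :=
  mfderiv 𝓘(ℝ, E) 𝓘(ℝ, ℝ) g x v

/-- The Koszul formula. -/
theorem RiemannianStructure.koszul (R : RiemannianStructure E M) {x : M}
    {U W Z : ∀ x : M, TangentSpace 𝓘(ℝ, E) x} (hU : MDiffAt (T% U) x) (hW : MDiffAt (T% W) x)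
    (hZ : MDiffAt (T% Z) x) :
    2 * R.metric.inner x (R.nabla W x (U x)) (Z x) =
      dirDeriv (fun x' => R.metric.inner x' (W x') (Z x')) x (U x) +
      dirDeriv (fun x' => R.metric.inner x' (Z x') (U x')) x (W x) -
      dirDeriv (fun x' => R.metric.inner x' (U x') (W x')) x (Z x) +
      R.metric.inner x (VectorField.mlieBracket 𝓘(ℝ, E) U W x) (Z x) -
      R.metric.inner x (VectorField.mlieBracket 𝓘(ℝ, E) U Z x) (W x) -
      R.metric.inner x (VectorField.mlieBracket 𝓘(ℝ, E) W Z x) (U x) := by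
  rw [dirDeriv, dirDeriv, dirDeriv, R.metric_compatible x W Z hW hZ, R.metric_compatible x Z U hZ hU,
    R.metric_compatible x U W hU hW, ← R.torsion_free x U W hU hW, ← R.torsion_free x U Z hU hZ,
    ← R.torsion_free x W Z hW hZ]
  simp only [map_sub, sub_apply]
  rw [R.metric.symm x (W x), R.metric.symm x (U x) (R.nabla W x (Z x)),
    R.metric.symm x (Z x) (R.nabla U x (W x))]
  ring

/-- A partial diffeomorphism that preserves the Riemannian metrics. -/
structure IsLocalIsometry (R : RiemannianStructure E M) (R' : RiemannianStructure E' M')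
    (ψ : OpenPartialHomeomorph M M') : Prop where
  smooth : ContMDiffOn 𝓘(ℝ, E) 𝓘(ℝ, E') ∞ ψ ψ.source
  smooth_symm : ContMDiffOn 𝓘(ℝ, E') 𝓘(ℝ, E) ∞ ψ.symm ψ.target
  metric_eq : ∀ x ∈ ψ.source, ∀ v w : TangentSpace 𝓘(ℝ, E) x,
    R'.metric.inner (ψ x) (mfderiv 𝓘(ℝ, E) 𝓘(ℝ, E') ψ x v) (mfderiv 𝓘(ℝ, E) 𝓘(ℝ, E') ψ x w) =
      R.metric.inner x v w

namespace IsLocalIsometry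

variable {R : RiemannianStructure E M} {R' : RiemannianStructure E' M'}
  {ψ : OpenPartialHomeomorph M M'}

theorem contMDiffAt (h : IsLocalIsometry R R' ψ) {x : M} (hx : x ∈ ψ.source) : ContMDiffAt 𝓘(ℝ, E) 𝓘(ℝ, E') ∞ ψ x :=
  h.smooth.contMDiffAt (ψ.open_source.mem_nhds hx)

theorem mdifferentiable (h : IsLocalIsometry R R' ψ) : ψ.MDifferentiable 𝓘(ℝ, E) 𝓘(ℝ, E') :=
  ⟨h.smooth.mdifferentiableOn (by simp), h.smooth_symm.mdifferentiableOn (by simp)⟩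

theorem isInvertible (h : IsLocalIsometry R R' ψ) {x : M} (hx : x ∈ ψ.source) :
    (mfderiv 𝓘(ℝ, E) 𝓘(ℝ, E') ψ x).IsInvertible :=
  ⟨h.mdifferentiable.mfderiv hx, rfl⟩

theorem surjective (h : IsLocalIsometry R R' ψ) {x : M} (hx : x ∈ ψ.source) :
    Function.Surjective (mfderiv 𝓘(ℝ, E) 𝓘(ℝ, E') ψ x) :=
  (h.mdifferentiable.mfderiv hx).surjective

theorem mfderiv_mpullback (h : IsLocalIsometry R R' ψ) (W : ∀ x : M', TangentSpace 𝓘(ℝ, E') x) {x : M} (hx : x ∈ ψ.source) :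
    mfderiv 𝓘(ℝ, E) 𝓘(ℝ, E') ψ x (VectorField.mpullback 𝓘(ℝ, E) 𝓘(ℝ, E') ψ W x) = W (ψ x) :=
  (h.isInvertible hx).self_apply_inverse _

/-- No differentiability of `g` is assumed: if it fails for `g`, it fails for the composite with the
diffeomorphism, and both derivatives take the default value zero. So no regularity of the inner
products in the Koszul formula has to be tracked. -/
theorem mfderiv_comp_real (h : IsLocalIsometry R R' ψ) (g : M' → ℝ) {x : M} (hx : x ∈ ψ.source) (v : TangentSpace 𝓘(ℝ, E) x) :
    dirDeriv (fun x => g (ψ x)) x v =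
      dirDeriv g (ψ x) (mfderiv 𝓘(ℝ, E) 𝓘(ℝ, E') ψ x v) := by
  have hψ := (h.contMDiffAt hx).mdifferentiableAt (by simp)
  by_cases hg : MDifferentiableAt 𝓘(ℝ, E') 𝓘(ℝ, ℝ) g (ψ x)
  · exact congrArg (fun A : TangentSpace 𝓘(ℝ, E) x →L[ℝ] ℝ => A v) (mfderiv_comp x hg hψ)
  · have hg' : ¬ MDifferentiableAt 𝓘(ℝ, E) 𝓘(ℝ, ℝ) (fun x => g (ψ x)) x := fun hc => hg <| by
      have h1 : MDifferentiableAt 𝓘(ℝ, E') 𝓘(ℝ, E) ψ.symm (ψ x) :=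
        h.mdifferentiable.mdifferentiableAt_symm (ψ.map_source hx)
      have hc' : MDifferentiableAt 𝓘(ℝ, E) 𝓘(ℝ, ℝ) (fun x => g (ψ x)) (ψ.symm (ψ x)) := by
        rwa [ψ.left_inv hx]
      refine (hc'.comp (ψ x) h1).congr_of_eventuallyEq ?_
      filter_upwards [ψ.open_target.mem_nhds (ψ.map_source hx)] with z hz
      exact congrArg g (ψ.right_inv hz).symm
    rw [dirDeriv, dirDeriv, mfderiv_zero_of_not_mdifferentiableAt hg, mfderiv_zero_of_not_mdifferentiableAt hg']
    rfl

theorem mdifferentiableAt_mpullback (h : IsLocalIsometry R R' ψ) {W : ∀ x : M', TangentSpace 𝓘(ℝ, E') x} {x : M}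
    (hx : x ∈ ψ.source) (hW : MDiffAt (T% W) (ψ x)) :
    MDiffAt (T% (VectorField.mpullback 𝓘(ℝ, E) 𝓘(ℝ, E') ψ W)) x :=
  hW.mpullback_vectorField (h.contMDiffAt hx) (h.isInvertible hx)
    (WithTop.coe_le_coe.2 (le_top : (2 : ℕ∞) ≤ ⊤))

/-- Isometries preserve the Levi-Civita connection. -/
theorem inner_nabla (h : IsLocalIsometry R R' ψ) {x : M} (hx : x ∈ ψ.source) {W : ∀ x : M', TangentSpace 𝓘(ℝ, E') x}
    (hW : MDiffAt (T% W) (ψ x)) (a z : TangentSpace 𝓘(ℝ, E) x) :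
    R'.metric.inner (ψ x) (R'.nabla W (ψ x) (mfderiv 𝓘(ℝ, E) 𝓘(ℝ, E') ψ x a))
        (mfderiv 𝓘(ℝ, E) 𝓘(ℝ, E') ψ x z) =
      R.metric.inner x (R.nabla (VectorField.mpullback 𝓘(ℝ, E) 𝓘(ℝ, E') ψ W) x a) z := by
  -- The Koszul formula needs fields. Extending the images of `a` and `z` on `M'` and pulling back
  -- gives fields on `M` whose values at `x` are again `a` and `z`.
  let U' : ∀ x : M', TangentSpace 𝓘(ℝ, E') x :=
    FiberBundle.extend (E := fun x : M' => TangentSpace 𝓘(ℝ, E') x) E'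
      (mfderiv 𝓘(ℝ, E) 𝓘(ℝ, E') ψ x a)
  let Z' : ∀ x : M', TangentSpace 𝓘(ℝ, E') x :=
    FiberBundle.extend (E := fun x : M' => TangentSpace 𝓘(ℝ, E') x) E'
      (mfderiv 𝓘(ℝ, E) 𝓘(ℝ, E') ψ x z)
  have hU : MDiffAt (T% U') (ψ x) := FiberBundle.mdifferentiableAt_extend 𝓘(ℝ, E') E' _
  have hZ : MDiffAt (T% Z') (ψ x) := FiberBundle.mdifferentiableAt_extend 𝓘(ℝ, E') E' _
  have hU0 : U' (ψ x) = mfderiv 𝓘(ℝ, E) 𝓘(ℝ, E') ψ x a := FiberBundle.extend_apply_self _ _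
  have hZ0 : Z' (ψ x) = mfderiv 𝓘(ℝ, E) 𝓘(ℝ, E') ψ x z := FiberBundle.extend_apply_self _ _
  have hinj := (h.mdifferentiable.mfderiv hx).injective
  have hU1 : VectorField.mpullback 𝓘(ℝ, E) 𝓘(ℝ, E') ψ U' x = a :=
    hinj ((h.mfderiv_mpullback U' hx).trans hU0)
  have hZ1 : VectorField.mpullback 𝓘(ℝ, E) 𝓘(ℝ, E') ψ Z' x = z :=
    hinj ((h.mfderiv_mpullback Z' hx).trans hZ0)
  have hd : ∀ (S T : ∀ x : M', TangentSpace 𝓘(ℝ, E') x) (v : TangentSpace 𝓘(ℝ, E) x),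
      dirDeriv (fun x' => R'.metric.inner x' (S x') (T x')) (ψ x)
        (mfderiv 𝓘(ℝ, E) 𝓘(ℝ, E') ψ x v) =
      dirDeriv (fun x' => R.metric.inner x'
        (VectorField.mpullback 𝓘(ℝ, E) 𝓘(ℝ, E') ψ S x')
        (VectorField.mpullback 𝓘(ℝ, E) 𝓘(ℝ, E') ψ T x')) x v := fun S T v => by
    rw [← h.mfderiv_comp_real _ hx]
    have he : (fun x' => R'.metric.inner (ψ x') (S (ψ x')) (T (ψ x'))) =ᶠ[𝓝 x]
        fun x' => R.metric.inner x' (VectorField.mpullback 𝓘(ℝ, E) 𝓘(ℝ, E') ψ S x')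
          (VectorField.mpullback 𝓘(ℝ, E) 𝓘(ℝ, E') ψ T x') := by
      filter_upwards [ψ.open_source.mem_nhds hx] with x' hx'
      rw [← h.metric_eq x' hx', h.mfderiv_mpullback S hx', h.mfderiv_mpullback T hx']
    exact congrArg (fun A : TangentSpace 𝓘(ℝ, E) x →L[ℝ] ℝ => A v) he.mfderiv_eq
  have h2 : minSmoothness ℝ 2 ≤ (∞ : WithTop ℕ∞) := by
    rw [minSmoothness_of_isRCLikeNormedField]
    exact WithTop.coe_le_coe.2 (le_top : (2 : ℕ∞) ≤ ⊤)
  have h3 : minSmoothness ℝ 3 ≤ (∞ : WithTop ℕ∞) := by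
    rw [minSmoothness_of_isRCLikeNormedField]
    exact WithTop.coe_le_coe.2 (le_top : (3 : ℕ∞) ≤ ⊤)
  have : IsManifold 𝓘(ℝ, E) (minSmoothness ℝ 2) M := IsManifold.of_le h2
  have : IsManifold 𝓘(ℝ, E') (minSmoothness ℝ 2) M' := IsManifold.of_le h2
  have : IsManifold 𝓘(ℝ, E) (minSmoothness ℝ 3) M := IsManifold.of_le h3
  have : IsManifold 𝓘(ℝ, E') (minSmoothness ℝ 3) M' := IsManifold.of_le h3
  have hb : ∀ S T : ∀ x : M', TangentSpace 𝓘(ℝ, E') x, MDiffAt (T% S) (ψ x) →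
      MDiffAt (T% T) (ψ x) → ∀ v : TangentSpace 𝓘(ℝ, E) x,
      R'.metric.inner (ψ x) (VectorField.mlieBracket 𝓘(ℝ, E') S T (ψ x))
        (mfderiv 𝓘(ℝ, E) 𝓘(ℝ, E') ψ x v) =
      R.metric.inner x (VectorField.mlieBracket 𝓘(ℝ, E)
        (VectorField.mpullback 𝓘(ℝ, E) 𝓘(ℝ, E') ψ S)
        (VectorField.mpullback 𝓘(ℝ, E) 𝓘(ℝ, E') ψ T) x) v := fun S T hS hT v => by
    rw [← VectorField.mpullback_mlieBracket hS hT (h.contMDiffAt hx) h2,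
      ← h.metric_eq x hx, h.mfderiv_mpullback _ hx]
  have hW1 := h.mfderiv_mpullback W hx
  -- The two Koszul formulas agree term by term, since the metric, derivatives of functions and Lie
  -- brackets all commute with the pullback.
  have k1 := R'.koszul hU hW hZ
  have k2 := R.koszul (h.mdifferentiableAt_mpullback hx hU) (h.mdifferentiableAt_mpullback hx hW)
    (h.mdifferentiableAt_mpullback hx hZ)
  rw [hU1, hZ1] at k2
  rw [hU0, hZ0, ← hW1, hd, hd, hd, hb U' W hU hW, hb U' Z' hU hZ, hb W Z' hW hZ] at k1
  linarith

end IsLocalIsometry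

end Isometry
end EndPeriodic
end

noncomputable section

namespace EndPeriodic

/-! ### Naturality of the superconnection under isomorphisms over the base. -/

section FamilyIso

variable {EB : Type*} [NormedAddCommGroup EB] [NormedSpace ℝ EB] [FiniteDimensional ℝ EB]
  {B : Type*} [TopologicalSpace B] [ChartedSpace EB B] [IsManifold 𝓘(ℝ, EB) ∞ B]
  {EX : Type*} [NormedAddCommGroup EX] [NormedSpace ℝ EX] [FiniteDimensional ℝ EX]
  {X : Type*} [TopologicalSpace X] [ChartedSpace EX X] [IsManifold 𝓘(ℝ, EX) ∞ X]
  {EX' : Type*} [NormedAddCommGroup EX'] [NormedSpace ℝ EX'] [FiniteDimensional ℝ EX']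
  {X' : Type*} [TopologicalSpace X'] [ChartedSpace EX' X'] [IsManifold 𝓘(ℝ, EX') ∞ X']
  {ϖ : X → B} {ϖ' : X' → B}

/-- A partial diffeomorphism over the base that preserves the Riemannian metrics. -/
structure IsFamilyIso (G : RiemannianFamily (EB := EB) (EX := EX) ϖ)
    (G' : RiemannianFamily (EB := EB) (EX := EX') ϖ') (ψ : OpenPartialHomeomorph X X') : Prop where
  isometry : IsLocalIsometry G.riem G'.riem ψ
  over_base : ∀ x ∈ ψ.source, ϖ' (ψ x) = ϖ x

namespace IsFamilyIso

variable {G : RiemannianFamily (EB := EB) (EX := EX) ϖ}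
  {G' : RiemannianFamily (EB := EB) (EX := EX') ϖ'} {ψ : OpenPartialHomeomorph X X'}

/-- The two sides are tangent vectors of `B` at the points `ϖ' (ψ x)` and `ϖ x`, which are equal but
not by definition. The equation is stated in the model space `EB`, to which every tangent space
unfolds. -/
theorem mfderiv_base (h : IsFamilyIso G G' ψ) {x : X} (hx : x ∈ ψ.source)
    (v : TangentSpace 𝓘(ℝ, EX) x) :
    (mfderiv 𝓘(ℝ, EX') 𝓘(ℝ, EB) ϖ' (ψ x) (mfderiv 𝓘(ℝ, EX) 𝓘(ℝ, EX') ψ x v) : EB) =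
      mfderiv 𝓘(ℝ, EX) 𝓘(ℝ, EB) ϖ x v := by
  have h1 := mfderiv_comp x ((G'.smooth_proj (ψ x)).mdifferentiableAt (by simp))
    ((h.isometry.contMDiffAt hx).mdifferentiableAt (by simp))
  have h2 : ϖ' ∘ ψ =ᶠ[𝓝 x] ϖ := by
    filter_upwards [ψ.open_source.mem_nhds hx] with x' hx'
    exact h.over_base x' hx'
  have h3 : (mfderiv 𝓘(ℝ, EX) 𝓘(ℝ, EB) (ϖ' ∘ ψ) x : EX →L[ℝ] EB) =
    mfderiv 𝓘(ℝ, EX) 𝓘(ℝ, EB) ϖ x := h2.mfderiv_eq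
  exact (congrArg (fun A : EX →L[ℝ] EB => A v) h1).symm.trans
    (congrArg (fun A : EX →L[ℝ] EB => A v) h3)

theorem mem_vertical_iff (h : IsFamilyIso G G' ψ) {x : X} (hx : x ∈ ψ.source)
    (v : TangentSpace 𝓘(ℝ, EX) x) :
    mfderiv 𝓘(ℝ, EX) 𝓘(ℝ, EX') ψ x v ∈ Vertical EB EX' ϖ' (ψ x) ↔ v ∈ Vertical EB EX ϖ x := by
  have h1 := h.mfderiv_base hx v
  exact ⟨fun hv => h1.symm.trans hv, fun hv => h1.trans hv⟩

theorem inner_eq_zero_of_horizontal (h : IsFamilyIso G G' ψ) {x : X} (hx : x ∈ ψ.source)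
    {z : TangentSpace 𝓘(ℝ, EX) x} :
    (∀ v ∈ Vertical EB EX' ϖ' (ψ x), G'.riem.metric.inner (ψ x)
      (mfderiv 𝓘(ℝ, EX) 𝓘(ℝ, EX') ψ x z) v = 0) ↔
    ∀ v ∈ Vertical EB EX ϖ x, G.riem.metric.inner x z v = 0 := by
  refine ⟨fun hz v hv => ?_, fun hz v hv => ?_⟩
  · rw [← h.isometry.metric_eq x hx]
    exact hz _ ((h.mem_vertical_iff hx v).2 hv)
  · obtain ⟨v, rfl⟩ := h.isometry.surjective hx v
    rw [h.isometry.metric_eq x hx]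
    exact hz v ((h.mem_vertical_iff hx v).1 hv)

theorem horProj_mfderiv (h : IsFamilyIso G G' ψ) {x : X} (hx : x ∈ ψ.source)
    (u : TangentSpace 𝓘(ℝ, EX) x) :
    G'.horProj (ψ x) (mfderiv 𝓘(ℝ, EX) 𝓘(ℝ, EX') ψ x u) =
      mfderiv 𝓘(ℝ, EX) 𝓘(ℝ, EX') ψ x (G.horProj x u) := by
  refine G'.horProj_eq ?_ ((h.inner_eq_zero_of_horizontal hx).2 fun v hv => G.inner_horProj x u hv)
  exact (h.mfderiv_base hx _).trans ((G.mfderiv_horProj x u).trans (h.mfderiv_base hx u).symm)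

theorem vertProj_mfderiv (h : IsFamilyIso G G' ψ) {x : X} (hx : x ∈ ψ.source)
    (u : TangentSpace 𝓘(ℝ, EX) x) :
    G'.vertProj (ψ x) (mfderiv 𝓘(ℝ, EX) 𝓘(ℝ, EX') ψ x u) =
      mfderiv 𝓘(ℝ, EX) 𝓘(ℝ, EX') ψ x (G.vertProj x u) := by
  rw [G.vertProj_apply, map_sub, ← h.horProj_mfderiv hx, G'.vertProj_apply]

theorem horLift_eq (h : IsFamilyIso G G' ψ) {x : X} (hx : x ∈ ψ.source) (w : EB) :
    G'.horLift (ψ x) w = mfderiv 𝓘(ℝ, EX) 𝓘(ℝ, EX') ψ x (G.horLift x w) := by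
  have h1 : (mfderiv 𝓘(ℝ, EX') 𝓘(ℝ, EB) ϖ' (ψ x)
      (mfderiv 𝓘(ℝ, EX) 𝓘(ℝ, EX') ψ x (G.horLift x w)) : EB) = w :=
    (h.mfderiv_base hx _).trans (G.mfderiv_horLift x w)
  have h2 : G'.horProj (ψ x) (mfderiv 𝓘(ℝ, EX) 𝓘(ℝ, EX') ψ x (G.horLift x w)) =
      G'.horLift (ψ x) w := congrArg (G'.horLift (ψ x)) h1
  rw [← h2]
  exact G'.horProj_eq rfl
    ((h.inner_eq_zero_of_horizontal hx).2 fun v hv => G.inner_horLift x w hv)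

/-- The pullback of the chosen horizontal extension on `X'` is horizontal on `X` with the right
value at `x`, and `secondForm` does not depend on the extension. -/
theorem secondForm_mfderiv (h : IsFamilyIso G G' ψ) {x : X} (hx : x ∈ ψ.source)
    (a z w : TangentSpace 𝓘(ℝ, EX) x) :
    G'.secondForm (ψ x) (mfderiv 𝓘(ℝ, EX) 𝓘(ℝ, EX') ψ x a) (mfderiv 𝓘(ℝ, EX) 𝓘(ℝ, EX') ψ x z)
      (mfderiv 𝓘(ℝ, EX) 𝓘(ℝ, EX') ψ x w) = G.secondForm x a z w := by
  have hZ := G'.mdifferentiableAt_horExtend (mfderiv 𝓘(ℝ, EX) 𝓘(ℝ, EX') ψ x z)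
  rw [RiemannianFamily.secondForm, h.vertProj_mfderiv hx, h.isometry.inner_nabla hx hZ]
  refine G.inner_nabla_eq_secondForm (h.isometry.mdifferentiableAt_mpullback hx hZ) ?_ ?_ a w
  · filter_upwards [ψ.open_source.mem_nhds hx] with x' hx'
    refine (h.inner_eq_zero_of_horizontal hx').1 ?_
    rw [h.isometry.mfderiv_mpullback _ hx']
    exact fun v hv => G'.inner_horProj _ _ hv
  · refine (h.isometry.mdifferentiable.mfderiv hx).injective
      ((h.isometry.mfderiv_mpullback _ hx).trans ?_)
    rw [G'.horExtend_self]
    exact h.horProj_mfderiv hx z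

theorem omega_mfderiv (h : IsFamilyIso G G' ψ) {x : X} (hx : x ∈ ψ.source)
    (a z w : TangentSpace 𝓘(ℝ, EX) x) :
    G'.omega (ψ x) (mfderiv 𝓘(ℝ, EX) 𝓘(ℝ, EX') ψ x a) (mfderiv 𝓘(ℝ, EX) 𝓘(ℝ, EX') ψ x z)
      (mfderiv 𝓘(ℝ, EX) 𝓘(ℝ, EX') ψ x w) = G.omega x a z w := by
  simp only [G'.omega_eq, G.omega_eq, h.vertProj_mfderiv hx, h.horProj_mfderiv hx,
    h.secondForm_mfderiv hx]

end IsFamilyIso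

variable {F : Type*} [NormedAddCommGroup F] [NormedSpace ℝ F] [FiniteDimensional ℝ F]
  {V : X → Type*} [TopologicalSpace (TotalSpace F V)] [∀ x, AddCommGroup (V x)]
  [∀ x, Module ℝ (V x)] [∀ x, Module ℂ (V x)] [∀ x, IsScalarTower ℝ ℂ (V x)]
  [∀ x, TopologicalSpace (V x)] [∀ x, IsTopologicalAddGroup (V x)] [∀ x, ContinuousSMul ℝ (V x)]
  [FiberBundle F V] [VectorBundle ℝ F V] [ContMDiffVectorBundle ∞ F V 𝓘(ℝ, EX)]
  {F' : Type*} [NormedAddCommGroup F'] [NormedSpace ℝ F'] [FiniteDimensional ℝ F']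
  {V' : X' → Type*} [TopologicalSpace (TotalSpace F' V')] [∀ x, AddCommGroup (V' x)]
  [∀ x, Module ℝ (V' x)] [∀ x, Module ℂ (V' x)] [∀ x, IsScalarTower ℝ ℂ (V' x)]
  [∀ x, TopologicalSpace (V' x)] [∀ x, IsTopologicalAddGroup (V' x)]
  [∀ x, ContinuousSMul ℝ (V' x)]
  [FiberBundle F' V'] [VectorBundle ℝ F' V'] [ContMDiffVectorBundle ∞ F' V' 𝓘(ℝ, EX')]

/-- Linearity in the direction is needed to compute the contraction defining `bismut` in another
basis. It is not immediate, as `tensorConn` is given by a choice and is only controlled on smooth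
sections. -/
theorem CliffordFamily.exists_conn₀_linear {G : RiemannianFamily (EB := EB) (EX := EX) ϖ}
    (C : CliffordFamily G F V) (SB : RiemannianStructure EB B) {s : ∀ x, FormFiber EB ϖ V x}
    (hs : SmoothForm EX F ϖ s) (x : X) :
    ∃ A : TangentSpace 𝓘(ℝ, EX) x →ₗ[ℝ] FormFiber EB ϖ V x, ∀ v, A v = C.conn₀ SB s x v := by
  have h1 : ∀ k (w : Fin k → TangentSpace 𝓘(ℝ, EB) (ϖ x)), ∃ l : TangentSpace 𝓘(ℝ, EX) x →ₗ[ℝ] V x,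
      ∀ v, l v = C.tensorConn SB s x v k w := fun k w => by
    refine ⟨(C.conn (fun x' => s x' k fun i => FiberBundle.extend
      (E := fun b : B => TangentSpace 𝓘(ℝ, EB) b) EB (w i) (ϖ x')) x).toLinearMap -
        ∑ i, (s x k).toMultilinearMap.toLinearMap w i ∘ₗ (SB.nabla (FiberBundle.extend
          (E := fun b : B => TangentSpace 𝓘(ℝ, EB) b) EB (w i)) (ϖ x)).toLinearMap ∘ₗ
            (mfderiv 𝓘(ℝ, EX) 𝓘(ℝ, EB) ϖ x).toLinearMap, fun v => ?_⟩
    rw [C.tensorConn_apply SB hs, LinearMap.sub_apply, LinearMap.sum_apply]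
    rfl
  have h2 : ∀ v v', C.tensorConn SB s x (v + v') =
      C.tensorConn SB s x v + C.tensorConn SB s x v' := fun v v' => by
    funext k
    ext w
    obtain ⟨l, hl⟩ := h1 k w
    change _ = C.tensorConn SB s x v k w + C.tensorConn SB s x v' k w
    rw [← hl, ← hl, ← hl, map_add]
  have h3 : ∀ (c : ℝ) v, C.tensorConn SB s x (c • v) = c • C.tensorConn SB s x v := fun c v => by
    funext k
    ext w
    obtain ⟨l, hl⟩ := h1 k w
    change _ = c • C.tensorConn SB s x v k w
    rw [← hl, ← hl, map_smul]
  refine ⟨{ toFun := C.conn₀ SB s x, map_add' := fun v v' => ?_, map_smul' := fun c v => ?_ },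
    fun _ => rfl⟩
  · have h4 : C.halfOmega x (v + v') (s x) = C.halfOmega x v (s x) + C.halfOmega x v' (s x) := by
      simp only [CliffordFamily.halfOmega_apply, ← RiemannianFamily.omegaₗ_apply, map_add,
        LinearMap.add_apply, add_smul, Finset.sum_add_distrib, smul_add]
    rw [CliffordFamily.conn₀, h2, h4, CliffordFamily.conn₀, CliffordFamily.conn₀]
    abel
  · have h4 : C.halfOmega x (c • v) (s x) = c • C.halfOmega x v (s x) := by
      simp only [CliffordFamily.halfOmega_apply, ← RiemannianFamily.omegaₗ_apply, map_smul,
        LinearMap.smul_apply, smul_assoc, Finset.smul_sum, smul_comm c]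
    rw [CliffordFamily.conn₀, h3, h4, ← smul_add]
    rfl

/-- The bundle maps `Φ` over `ψ` identify the families of Clifford modules over the source of
`ψ`. -/
structure IsCliffordIso {G : RiemannianFamily (EB := EB) (EX := EX) ϖ}
    {G' : RiemannianFamily (EB := EB) (EX := EX') ϖ'}
    (C : CliffordFamily G F V) (C' : CliffordFamily G' F' V')
    (ψ : OpenPartialHomeomorph X X') (Φ : ∀ x, V x →ₗ[ℂ] V' (ψ x)) : Prop where
  familyIso : IsFamilyIso G G' ψ
  cl_eq : ∀ x ∈ ψ.source, ∀ (α : Module.Dual ℝ (TangentSpace 𝓘(ℝ, EX) x))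
    (β : Module.Dual ℝ (TangentSpace 𝓘(ℝ, EX') (ψ x))),
    (∀ v : TangentSpace 𝓘(ℝ, EX) x, β (mfderiv 𝓘(ℝ, EX) 𝓘(ℝ, EX') ψ x v) = α v) → ∀ u,
    C'.cl (ψ x) (β.domRestrict (Vertical EB EX' ϖ' (ψ x))) (Φ x u) =
      Φ x (C.cl x (α.domRestrict (Vertical EB EX ϖ x)) u)
  conn_eq : ∀ x ∈ ψ.source, ∀ (u : ∀ x, V x) (s : ∀ x, V' x),
    MDiffAt (T% u) x → MDiffAt (T% s) (ψ x) → (∀ᶠ x' in 𝓝 x, s (ψ x') = Φ x' (u x')) →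
    ∀ v : TangentSpace 𝓘(ℝ, EX) x,
      C'.conn s (ψ x) (mfderiv 𝓘(ℝ, EX) 𝓘(ℝ, EX') ψ x v) = Φ x (C.conn u x v)

/-- Two forms correspond to each other under a linear map of the coefficients. -/
def FormCorr {x : X} {x' : X'} (Φ : V x →ₗ[ℂ] V' x') (e : FormFiber EB ϖ V x)
    (e' : FormFiber EB ϖ' V' x') : Prop :=
  ∀ (k : ℕ) (w : Fin k → EB), e' k w = Φ (e k w)

theorem map_real_smul_of_complex {N N' : Type*} [AddCommGroup N] [AddCommGroup N'] [Module ℝ N]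
    [Module ℂ N] [IsScalarTower ℝ ℂ N] [Module ℝ N'] [Module ℂ N'] [IsScalarTower ℝ ℂ N']
    (Φ : N →ₗ[ℂ] N') (c : ℝ) (u : N) : Φ (c • u) = c • Φ u := by
  rw [← algebraMap_smul ℂ c u, map_smul, algebraMap_smul]

namespace FormCorr

variable {x : X} {x' : X'} {Φ : V x →ₗ[ℂ] V' x'}

theorem add {e₁ e₂ : FormFiber EB ϖ V x} {e₁' e₂' : FormFiber EB ϖ' V' x'}
    (h₁ : FormCorr Φ e₁ e₁') (h₂ : FormCorr Φ e₂ e₂') : FormCorr Φ (e₁ + e₂) (e₁' + e₂') :=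
  fun k w => by
    change e₁' k w + e₂' k w = Φ (e₁ k w + e₂ k w)
    rw [h₁ k w, h₂ k w, map_add]

theorem zero : FormCorr Φ (0 : FormFiber EB ϖ V x) (0 : FormFiber EB ϖ' V' x') :=
  fun _ _ => (map_zero Φ).symm

theorem sum {ι : Type*} {s : Finset ι} {e : ι → FormFiber EB ϖ V x}
    {e' : ι → FormFiber EB ϖ' V' x'} (h : ∀ i ∈ s, FormCorr Φ (e i) (e' i)) :
    FormCorr Φ (∑ i ∈ s, e i) (∑ i ∈ s, e' i) := by
  classical
  induction s using Finset.induction_on with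
  | empty => exact zero
  | insert a s ha ih =>
    rw [Finset.sum_insert ha, Finset.sum_insert ha]
    exact (h a (by simp)).add (ih fun i hi => h i (by simp [hi]))

theorem real_smul {e : FormFiber EB ϖ V x} {e' : FormFiber EB ϖ' V' x'} (h : FormCorr Φ e e')
    (c : ℝ) : FormCorr Φ (c • e) (c • e') := fun k w => by
  change c • e' k w = Φ (c • e k w)
  rw [h k w, map_real_smul_of_complex]

end FormCorr

namespace IsCliffordIso

variable {G : RiemannianFamily (EB := EB) (EX := EX) ϖ}
  {G' : RiemannianFamily (EB := EB) (EX := EX') ϖ'}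
  {C : CliffordFamily G F V} {C' : CliffordFamily G' F' V'}
  {ψ : OpenPartialHomeomorph X X'} {Φ : ∀ x, V x →ₗ[ℂ] V' (ψ x)}

theorem clForm_corr (h : IsCliffordIso C C' ψ Φ) {x : X} (hx : x ∈ ψ.source)
    {α : Module.Dual ℝ (TangentSpace 𝓘(ℝ, EX) x)}
    {β : Module.Dual ℝ (TangentSpace 𝓘(ℝ, EX') (ψ x))}
    (hαβ : ∀ v : TangentSpace 𝓘(ℝ, EX) x, β (mfderiv 𝓘(ℝ, EX) 𝓘(ℝ, EX') ψ x v) = α v)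
    {e : FormFiber EB ϖ V x} {e' : FormFiber EB ϖ' V' (ψ x)} (he : FormCorr (Φ x) e e')
    (k : ℕ) (w : Fin k → EB) :
    C'.clForm (ψ x) β (e' k) w = Φ x (C.clForm x α (e k) w) := by
  refine Eq.trans ?_ (h.cl_eq x hx α β hαβ (e k w))
  exact congrArg (C'.cl (ψ x) (β.domRestrict (Vertical EB EX' ϖ' (ψ x)))) (he k w)

theorem wedgeForm_corr (h : IsCliffordIso C C' ψ Φ) {x : X} (hx : x ∈ ψ.source)
    {α : Module.Dual ℝ (TangentSpace 𝓘(ℝ, EX) x)}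
    {β : Module.Dual ℝ (TangentSpace 𝓘(ℝ, EX') (ψ x))}
    (hαβ : ∀ v : TangentSpace 𝓘(ℝ, EX) x, β (mfderiv 𝓘(ℝ, EX) 𝓘(ℝ, EX') ψ x v) = α v)
    {e : FormFiber EB ϖ V x} {e' : FormFiber EB ϖ' V' (ψ x)} (he : FormCorr (Φ x) e e')
    (k : ℕ) (w : Fin (k + 1) → EB) :
    C'.wedgeForm (ψ x) β (e' k) w = Φ x (C.wedgeForm x α (e k) w) := by
  refine (C'.wedgeForm_apply (ψ x) β (e' k) w).trans ?_
  refine Eq.trans ?_ (congrArg (Φ x) (C.wedgeForm_apply x α (e k) w)).symm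
  rw [map_sum]
  refine Finset.sum_congr rfl fun i _ => ?_
  have h1 : β (G'.horLift (ψ x) (w i)) = α (G.horLift x (w i)) := by
    rw [← hαβ]
    exact congrArg β (h.familyIso.horLift_eq hx (w i))
  rw [map_zsmul, map_real_smul_of_complex, h1]
  exact congrArg (fun u => (-1 : ℤ) ^ (i : ℕ) • α (G.horLift x (w i)) • u)
    (he k (i.removeNth w))

theorem m₀_corr (h : IsCliffordIso C C' ψ Φ) {x : X} (hx : x ∈ ψ.source)
    {α : Module.Dual ℝ (TangentSpace 𝓘(ℝ, EX) x)}
    {β : Module.Dual ℝ (TangentSpace 𝓘(ℝ, EX') (ψ x))}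
    (hαβ : ∀ v : TangentSpace 𝓘(ℝ, EX) x, β (mfderiv 𝓘(ℝ, EX) 𝓘(ℝ, EX') ψ x v) = α v)
    {e : FormFiber EB ϖ V x} {e' : FormFiber EB ϖ' V' (ψ x)} (he : FormCorr (Φ x) e e') :
    FormCorr (Φ x) (C.m₀ x α e) (C'.m₀ (ψ x) β e') := by
  intro k w
  cases k with
  | zero => exact h.clForm_corr hx hαβ he 0 w
  | succ k =>
    change C'.wedgeForm (ψ x) β (e' k) w + (-1 : ℝ) ^ (k + 1) • C'.clForm (ψ x) β (e' (k + 1)) w =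
      Φ x (C.wedgeForm x α (e k) w + (-1 : ℝ) ^ (k + 1) • C.clForm x α (e (k + 1)) w)
    rw [map_add, map_real_smul_of_complex, h.wedgeForm_corr hx hαβ he,
      h.clForm_corr hx hαβ he]

/-- The bases chosen at `x` and at `ψ x` are unrelated. Covectors on `X'` act on forms at `x`
through their pullback, so both sums can be moved to the other basis, one index at a time. -/
theorem halfOmega_corr (h : IsCliffordIso C C' ψ Φ) {x : X} (hx : x ∈ ψ.source)
    (v : TangentSpace 𝓘(ℝ, EX) x)
    {e : FormFiber EB ϖ V x} {e' : FormFiber EB ϖ' V' (ψ x)} (he : FormCorr (Φ x) e e') :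
    FormCorr (Φ x) (C.halfOmega x v e)
      (C'.halfOmega (ψ x) (mfderiv 𝓘(ℝ, EX) 𝓘(ℝ, EX') ψ x v) e') := by
  let b := Module.finBasis ℝ (TangentSpace 𝓘(ℝ, EX) x)
  let b' := Module.finBasis ℝ (TangentSpace 𝓘(ℝ, EX') (ψ x))
  let f : TangentSpace 𝓘(ℝ, EX) x →ₗ[ℝ] TangentSpace 𝓘(ℝ, EX') (ψ x) :=
    (mfderiv 𝓘(ℝ, EX) 𝓘(ℝ, EX') ψ x).toLinearMap
  let τ := G'.omegaₗ (ψ x) (f v)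
  have h1 : ∀ i, ∑ j, τ (b' i) (b' j) • C.m₀ x (b'.coord i ∘ₗ f) (C.m₀ x (b'.coord j ∘ₗ f) e) =
      ∑ j, τ (b' i) (f (b j)) • C.m₀ x (b'.coord i ∘ₗ f) (C.m₀ x (b.coord j) e) := fun i => by
    have := sum_coord_comp_eq b' b f ((LinearMap.lsmul ℝ (FormFiber EB ϖ V x)).flip.compl₁₂
      (C.m₀ₗ x (b'.coord i ∘ₗ f) ∘ₗ (C.m₀ₗ x).flip e) (τ (b' i)))
    exact this
  have h2 : ∀ j, ∑ i, τ (b' i) (f (b j)) • C.m₀ x (b'.coord i ∘ₗ f) (C.m₀ x (b.coord j) e) =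
      ∑ i, τ (f (b i)) (f (b j)) • C.m₀ x (b.coord i) (C.m₀ x (b.coord j) e) := fun j => by
    have := sum_coord_comp_eq b' b f ((LinearMap.lsmul ℝ (FormFiber EB ϖ V x)).flip.compl₁₂
      ((C.m₀ₗ x).flip (C.m₀ x (b.coord j) e)) (τ.flip (f (b j))))
    exact this
  have h3 : C.halfOmega x v e = (1 / 4 : ℝ) • ∑ i, ∑ j, τ (b' i) (b' j) •
      C.m₀ x (b'.coord i ∘ₗ f) (C.m₀ x (b'.coord j ∘ₗ f) e) := by
    rw [CliffordFamily.halfOmega_apply, Finset.sum_congr rfl fun i _ => h1 i]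
    congr 1
    refine Eq.trans ?_ (Finset.sum_comm.trans
      ((Finset.sum_congr rfl fun j _ => h2 j).trans Finset.sum_comm)).symm
    refine Finset.sum_congr rfl fun i _ => Finset.sum_congr rfl fun j _ => ?_
    exact congrArg (· • _) (h.familyIso.omega_mfderiv hx v (b i) (b j)).symm
  rw [h3, CliffordFamily.halfOmega_apply]
  refine (FormCorr.sum fun i _ => FormCorr.sum fun j _ => ?_).real_smul _
  exact (h.m₀_corr hx (fun _ => rfl) (h.m₀_corr hx (fun _ => rfl) he)).real_smul _

theorem extend_eq {b b' : B} (hb : b = b') (w : EB) :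
    FiberBundle.extend (E := fun b : B => TangentSpace 𝓘(ℝ, EB) b) EB
      (x := b) (show TangentSpace 𝓘(ℝ, EB) b from w) =
    FiberBundle.extend (E := fun b : B => TangentSpace 𝓘(ℝ, EB) b) EB
      (x := b') (show TangentSpace 𝓘(ℝ, EB) b' from w) := by
  subst hb; rfl

/-- Since `ψ` lies over the base, the same test fields on `B` serve on both sides. The compatibility
of the connections is applied to the sections obtained by inserting them, and the correction terms
involve `SB.nabla` of the same fields in the same directions. -/
theorem tensorConn_corr (h : IsCliffordIso C C' ψ Φ) (SB : RiemannianStructure EB B)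
    {x : X} (hx : x ∈ ψ.source) {u : ∀ x, FormFiber EB ϖ V x} {s : ∀ x, FormFiber EB ϖ' V' x}
    (hu : SmoothForm EX F ϖ u) (hs : SmoothForm EX' F' ϖ' s)
    (hus : ∀ᶠ x' in 𝓝 x, FormCorr (Φ x') (u x') (s (ψ x'))) (v : TangentSpace 𝓘(ℝ, EX) x) :
    FormCorr (Φ x) (C.tensorConn SB u x v)
      (C'.tensorConn SB s (ψ x) (mfderiv 𝓘(ℝ, EX) 𝓘(ℝ, EX') ψ x v)) := by
  intro k w
  have hb := h.familyIso.over_base x hx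
  refine (C'.tensorConn_apply SB hs (ψ x) (mfderiv 𝓘(ℝ, EX) 𝓘(ℝ, EX') ψ x v) k w).trans ?_
  refine Eq.trans ?_ (congrArg (Φ x) (C.tensorConn_apply SB hu x v k w)).symm
  let W : Fin k → ∀ b : B, TangentSpace 𝓘(ℝ, EB) b := fun i =>
    FiberBundle.extend (E := fun b : B => TangentSpace 𝓘(ℝ, EB) b) EB (x := ϖ x) (w i)
  let W' : Fin k → ∀ b : B, TangentSpace 𝓘(ℝ, EB) b := fun i =>
    FiberBundle.extend (E := fun b : B => TangentSpace 𝓘(ℝ, EB) b) EB (x := ϖ' (ψ x)) (w i)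
  have hW : ∀ i, CMDiffAt ∞ (T% (W i)) (ϖ x) := fun i => FiberBundle.contMDiffAt_extend _ _ _
  have hW' : ∀ i, CMDiffAt ∞ (T% (W' i)) (ϖ' (ψ x)) :=
    fun i => FiberBundle.contMDiffAt_extend _ _ _
  have hWW : W' = W := funext fun i => extend_eq hb (w i)
  have h1 : C'.conn (fun x' => s x' k fun i => W' i (ϖ' x')) (ψ x)
      (mfderiv 𝓘(ℝ, EX) 𝓘(ℝ, EX') ψ x v) =
        Φ x (C.conn (fun x' => u x' k fun i => W i (ϖ x')) x v) := by
    refine h.conn_eq x hx _ _ ((hu x k W hW).mdifferentiableAt (by simp))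
      ((hs (ψ x) k W' hW').mdifferentiableAt (by simp)) ?_ v
    filter_upwards [hus, ψ.open_source.mem_nhds hx] with x' hx' hx''
    rw [hWW]
    have h2 : (fun i => (W i (ϖ' (ψ x')) : EB)) = fun i => W i (ϖ x') := by
      rw [h.familyIso.over_base x' hx'']
    exact (hx' k (fun i => W i (ϖ' (ψ x')))).trans
      (congrArg (fun a : Fin k → EB => Φ x' (u x' k a)) h2)
  have h3 : ∀ i, (SB.nabla (W' i) (ϖ' (ψ x)) (mfderiv 𝓘(ℝ, EX') 𝓘(ℝ, EB) ϖ' (ψ x)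
      (mfderiv 𝓘(ℝ, EX) 𝓘(ℝ, EX') ψ x v)) : EB) =
      SB.nabla (W i) (ϖ x) (mfderiv 𝓘(ℝ, EX) 𝓘(ℝ, EB) ϖ x v) := fun i => by
    have h4 : ∀ (b b' : B) (_ : b = b') (a a' : EB) (_ : a = a'),
        (SB.nabla (W i) b a : EB) = SB.nabla (W i) b' a' := by
      rintro b _ rfl a _ rfl
      rfl
    rw [hWW]
    exact h4 _ _ hb _ _ (h.familyIso.mfderiv_base hx v)
  change C'.conn (fun x' => s x' k fun i => W' i (ϖ' x')) (ψ x)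
      (mfderiv 𝓘(ℝ, EX) 𝓘(ℝ, EX') ψ x v) - ∑ i, s (ψ x) k (Function.update w i
        (SB.nabla (W' i) (ϖ' (ψ x)) (mfderiv 𝓘(ℝ, EX') 𝓘(ℝ, EB) ϖ' (ψ x)
          (mfderiv 𝓘(ℝ, EX) 𝓘(ℝ, EX') ψ x v)))) =
    Φ x (C.conn (fun x' => u x' k fun i => W i (ϖ x')) x v - ∑ i, u x k (Function.update w i
      (SB.nabla (W i) (ϖ x) (mfderiv 𝓘(ℝ, EX) 𝓘(ℝ, EB) ϖ x v))))
  rw [map_sub, map_sum]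
  refine congrArg₂ (· - ·) h1 (Finset.sum_congr rfl fun i _ => ?_)
  refine Eq.trans ?_ (hus.self_of_nhds k _)
  exact congrArg (fun a : EB => s (ψ x) k (Function.update (β := fun _ => EB) w i a)) (h3 i)

theorem bismut_corr (h : IsCliffordIso C C' ψ Φ) (SB : RiemannianStructure EB B)
    {x : X} (hx : x ∈ ψ.source) {u : ∀ x, FormFiber EB ϖ V x} {s : ∀ x, FormFiber EB ϖ' V' x}
    (hu : SmoothForm EX F ϖ u) (hs : SmoothForm EX' F' ϖ' s)
    (hus : ∀ᶠ x' in 𝓝 x, FormCorr (Φ x') (u x') (s (ψ x'))) :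
    FormCorr (Φ x) (C.bismut SB u x) (C'.bismut SB s (ψ x)) := by
  let b := Module.finBasis ℝ (TangentSpace 𝓘(ℝ, EX) x)
  let b' := Module.finBasis ℝ (TangentSpace 𝓘(ℝ, EX') (ψ x))
  let f : TangentSpace 𝓘(ℝ, EX) x →ₗ[ℝ] TangentSpace 𝓘(ℝ, EX') (ψ x) :=
    (mfderiv 𝓘(ℝ, EX) 𝓘(ℝ, EX') ψ x).toLinearMap
  obtain ⟨A, hA⟩ := C.exists_conn₀_linear SB hu x
  let f' : TangentSpace 𝓘(ℝ, EX') (ψ x) →ₗ[ℝ] TangentSpace 𝓘(ℝ, EX) x :=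
    (h.familyIso.isometry.mdifferentiable.mfderiv hx).symm.toLinearMap
  have hf : ∀ v, f (f' v) = v :=
    (h.familyIso.isometry.mdifferentiable.mfderiv hx).apply_symm_apply
  have hf' : ∀ v, f' (f v) = v :=
    (h.familyIso.isometry.mdifferentiable.mfderiv hx).symm_apply_apply
  -- The superconnection at `x` is rewritten over the basis at `ψ x`, with directions pulled back by
  -- the inverse differential, so that the two sums match term by term.
  have h1 : C.bismut SB u x = ∑ j, C.m₀ x (b'.coord j ∘ₗ f) (C.conn₀ SB u x (f' (b' j))) := by
    have h2 : ∑ j, C.m₀ x (b'.coord j ∘ₗ f) (A (f' (b' j))) =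
        ∑ i, C.m₀ x (b.coord i) (A (f' (f (b i)))) :=
      sum_coord_comp_eq b' b f ((C.m₀ₗ x).compl₂ (A ∘ₗ f'))
    simp only [hA, hf'] at h2
    exact h2.symm
  rw [h1]
  refine FormCorr.sum fun j _ => h.m₀_corr hx (fun _ => rfl) ?_
  have h3 := (h.tensorConn_corr SB hx hu hs hus (f' (b' j))).add
    (h.halfOmega_corr hx (f' (b' j)) hus.self_of_nhds)
  have h4 : mfderiv 𝓘(ℝ, EX) 𝓘(ℝ, EX') ψ x (f' (b' j)) = b' j := hf (b' j)
  rw [h4] at h3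
  exact h3

end IsCliffordIso

end FamilyIso
end EndPeriodic
end

noncomputable section

namespace EndPeriodic

/-! ### Identification of the operators over the end. -/

section EndIso

variable {EB : Type*} [NormedAddCommGroup EB] [NormedSpace ℝ EB] [FiniteDimensional ℝ EB]
  {B : Type*} [TopologicalSpace B] [ChartedSpace EB B] [IsManifold 𝓘(ℝ, EB) ∞ B]
  {EY : Type*} [NormedAddCommGroup EY] [NormedSpace ℝ EY] [FiniteDimensional ℝ EY]
  {Y : Type*} [TopologicalSpace Y] [ChartedSpace EY Y] [IsManifold 𝓘(ℝ, EY) ∞ Y]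
  {F : Type*} [NormedAddCommGroup F] [NormedSpace ℝ F] [FiniteDimensional ℝ F]
  {V : Y → Type*} [TopologicalSpace (TotalSpace F V)] [∀ y, AddCommGroup (V y)]
  [∀ y, Module ℝ (V y)] [∀ y, Module ℂ (V y)] [∀ y, IsScalarTower ℝ ℂ (V y)]
  [∀ y, TopologicalSpace (V y)] [∀ y, IsTopologicalAddGroup (V y)] [∀ y, ContinuousSMul ℝ (V y)]
  [FiberBundle F V] [VectorBundle ℝ F V] [ContMDiffVectorBundle ∞ F V 𝓘(ℝ, EY)]
  {EM : Type*} [NormedAddCommGroup EM] [NormedSpace ℝ EM] [FiniteDimensional ℝ EM]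
  {M : Type*} [TopologicalSpace M] [ChartedSpace EM M] [IsManifold 𝓘(ℝ, EM) ∞ M]
  {F' : Type*} [NormedAddCommGroup F'] [NormedSpace ℝ F'] [FiniteDimensional ℝ F']
  {V' : M → Type*} [TopologicalSpace (TotalSpace F' V')] [∀ x, AddCommGroup (V' x)]
  [∀ x, Module ℝ (V' x)] [∀ x, Module ℂ (V' x)] [∀ x, IsScalarTower ℝ ℂ (V' x)]
  [∀ x, TopologicalSpace (V' x)] [∀ x, IsTopologicalAddGroup (V' x)]
  [∀ x, ContinuousSMul ℝ (V' x)]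
  [FiberBundle F' V'] [VectorBundle ℝ F' V'] [ContMDiffVectorBundle ∞ F' V' 𝓘(ℝ, EM)]
  {f₀ : C^∞⟮𝓘(ℝ, EY), Y; 𝓡 1, Circle⟯} {ϖY : Y → B} {ϖM : M → B}
  {GY : RiemannianFamily (EB := EB) (EX := EY) ϖY} {CY : CliffordFamily GY F V}
  {GM : RiemannianFamily (EB := EB) (EX := EM) ϖM} {CM : CliffordFamily GM F' V'}

theorem CyclicCover.surjective_mfderiv_localSection (x : CyclicCover f₀) {y : Y}
    (hy : y ∈ x.regular) :
    Function.Surjective (mfderiv 𝓘(ℝ, EY) 𝓘(ℝ, EY) x.localSection y) := by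
  have hinj : Function.Injective
      (show EY →L[ℝ] EY from mfderiv 𝓘(ℝ, EY) 𝓘(ℝ, EY) x.localSection y).toLinearMap :=
    Function.LeftInverse.injective (g := fun v : EY =>
      (mfderiv 𝓘(ℝ, EY) 𝓘(ℝ, EY) CyclicCover.proj (x.localSection y) v : EY))
      fun v => x.mfderiv_proj_localSection hy v
  exact LinearMap.injective_iff_surjective.1 hinj

theorem CyclicCover.eventually_of_localSection {x : CyclicCover f₀} {y : Y} (hy : y ∈ x.regular)
    {P : CyclicCover f₀ → Prop} (h : ∀ᶠ y' in 𝓝 y, P (x.localSection y')) :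
    ∀ᶠ x' in 𝓝 (x.localSection y), P x' := by
  have hc : Filter.Tendsto CyclicCover.proj (𝓝 (x.localSection y)) (𝓝 y) :=
    CyclicCover.continuous_proj.continuousAt
  filter_upwards [hc.eventually h,
    x.localHomeo.open_target.mem_nhds (x.localHomeo.map_source hy)] with x' h1 h2
  have h3 : x.localSection x'.proj = x' := x.localHomeo.right_inv h2
  exact h3 ▸ h1

namespace EndPeriodicFamily

variable (D : EndPeriodicFamily f₀ CY CM)

/-- The identification of an open subset of `Y` with an open subset of the end of `M`, given by
the local section of the cyclic cover through `x`. -/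
def endHomeo (x : CyclicCover f₀) : OpenPartialHomeomorph Y M := x.localHomeo.trans D.toEnd

theorem mem_endHomeo_source {x : CyclicCover f₀} {y : Y} :
    y ∈ (D.endHomeo x).source ↔ y ∈ x.regular ∧ x.localSection y ∈ D.toEnd.source := by
  rw [endHomeo, OpenPartialHomeomorph.trans_source]
  rfl

theorem contMDiffAt_toEnd {x : CyclicCover f₀} (hx : x ∈ D.toEnd.source) :
    ContMDiffAt 𝓘(ℝ, EY) 𝓘(ℝ, EM) ∞ D.toEnd x :=
  D.smooth.contMDiffAt (D.toEnd.open_source.mem_nhds hx)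

theorem mfderiv_endHomeo {x : CyclicCover f₀} {y : Y} (hy : y ∈ (D.endHomeo x).source)
    (v : TangentSpace 𝓘(ℝ, EY) y) :
    mfderiv 𝓘(ℝ, EY) 𝓘(ℝ, EM) (D.endHomeo x) y v =
      mfderiv 𝓘(ℝ, EY) 𝓘(ℝ, EM) D.toEnd (x.localSection y)
        (mfderiv 𝓘(ℝ, EY) 𝓘(ℝ, EY) x.localSection y v) := by
  rw [mem_endHomeo_source] at hy
  have h := mfderiv_comp y ((D.contMDiffAt_toEnd hy.2).mdifferentiableAt (by simp))
    ((x.contMDiffAt_localSection hy.1).mdifferentiableAt (by simp))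
  exact congrArg (fun A : EY →L[ℝ] EM => A v) h

/-- Composing with a local section turns the identification of the cover with the end into one
between open subsets of `Y` and `M`. The general naturality result then applies, and no geometric
structure has to be put on the cover. -/
theorem isCliffordIso (x : CyclicCover f₀) :
    IsCliffordIso CY CM (D.endHomeo x) (fun y => D.bundleMap (x.localSection y)) where
  familyIso :=
    { isometry :=
        { smooth := fun y hy => by
            rw [mem_endHomeo_source] at hy
            exact ((D.contMDiffAt_toEnd hy.2).comp y
              (x.contMDiffAt_localSection hy.1)).contMDiffWithinAt
          smooth_symm := fun z hz => by
            rw [endHomeo, OpenPartialHomeomorph.trans_target] at hz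
            have h1 : ContMDiffAt 𝓘(ℝ, EM) 𝓘(ℝ, EY) ∞ D.toEnd.symm z :=
              D.smooth_symm.contMDiffAt (D.toEnd.open_target.mem_nhds hz.1)
            exact ((CyclicCover.contMDiff_proj (D.toEnd.symm z)).comp z h1).contMDiffWithinAt
          metric_eq := fun y hy v w => by
            rw [D.mfderiv_endHomeo hy, D.mfderiv_endHomeo hy]
            rw [mem_endHomeo_source] at hy
            refine (D.metric_eq _ hy.2 _ _).trans ?_
            rw [x.mfderiv_proj_localSection hy.1, x.mfderiv_proj_localSection hy.1]
            rfl }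
      over_base := fun y hy => D.over_base _ (D.mem_endHomeo_source.1 hy).2 }
  cl_eq := fun y hy α β hαβ u => by
    refine D.cl_eq _ (D.mem_endHomeo_source.1 hy).2 α β (fun v => ?_) u
    obtain ⟨v, rfl⟩ := x.surjective_mfderiv_localSection (D.mem_endHomeo_source.1 hy).1 v
    have h := hαβ v
    rw [D.mfderiv_endHomeo hy] at h
    refine h.trans (congrArg α ?_)
    exact (x.mfderiv_proj_localSection (D.mem_endHomeo_source.1 hy).1 v).symm
  conn_eq := fun y hy u s hu hs hus v => by
    have hy' := D.mem_endHomeo_source.1 hy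
    rw [D.mfderiv_endHomeo hy]
    refine (D.conn_eq _ hy'.2 u s hu hs ?_ _).trans (congrArg (D.bundleMap (x.localSection y)) ?_)
    · exact CyclicCover.eventually_of_localSection hy'.1
        (P := fun z => s (D.toEnd z) = D.bundleMap z (u z.proj)) hus
    · exact congrArg (CY.conn u y) (x.mfderiv_proj_localSection hy'.1 v)

/-- Test fields in `Corresponds` need not be smooth, so fields constant in the model space `EB`
realize every tuple of vectors. Conversely, over the end the base points agree, so a field has the
same value on both sides. -/
theorem corresponds_iff {x : CyclicCover f₀} (hx : x ∈ D.toEnd.source)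
    {e : FormFiber EB ϖY V x.proj} {e' : FormFiber EB ϖM V' (D.toEnd x)} :
    D.Corresponds x e e' ↔ FormCorr (D.bundleMap x) e e' := by
  refine ⟨fun h k w => h k fun i _ => w i, fun h k W => ?_⟩
  refine (h k fun i => W i (ϖM (D.toEnd x))).trans ?_
  have h1 : (fun i => (W i (ϖM (D.toEnd x)) : EB)) = fun i => W i (ϖY x.proj) := by
    rw [D.over_base x hx]
  exact congrArg (fun w : Fin k → EB => D.bundleMap x (e k w)) h1

/-- The operators `A` on `M` and `A'` on `Y` are local and are identified with each other over the
end. -/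
def IsNatural (A : (∀ x, FormFiber EB ϖM V' x) → ∀ x, FormFiber EB ϖM V' x)
    (A' : (∀ y, FormFiber EB ϖY V y) → ∀ y, FormFiber EB ϖY V y) : Prop :=
  ∀ x ∈ D.toEnd.source, ∀ u s, SmoothForm EY F ϖY u → SmoothForm EM F' ϖM s →
    (∀ᶠ x' in 𝓝 x, D.Corresponds x' (u x'.proj) (s (D.toEnd x'))) →
      D.Corresponds x (A' u x.proj) (A s (D.toEnd x))

theorem isNatural_bismut (SB : RiemannianStructure EB B) :
    D.IsNatural (CM.bismut SB) (CY.bismut SB) := by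
  intro x hx u s hu hs hus
  rw [D.corresponds_iff hx]
  have hy : x.proj ∈ (D.endHomeo x).source := by
    rw [mem_endHomeo_source, x.localSection_self]
    exact ⟨x.proj_mem_regular, hx⟩
  have h1 : ∀ᶠ y in 𝓝 x.proj, FormCorr (D.bundleMap (x.localSection y)) (u y)
      (s (D.toEnd (x.localSection y))) := by
    have hc : Filter.Tendsto x.localSection (𝓝 x.proj) (𝓝 x) := by
      have := (x.continuousAt_localSection x.proj_mem_regular).tendsto
      rwa [x.localSection_self] at this
    filter_upwards [hc.eventually hus, hc.eventually (D.toEnd.open_source.mem_nhds hx)] with y h2 h3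
    exact (D.corresponds_iff h3).1 h2
  have h4 := (D.isCliffordIso x).bismut_corr SB hy hu hs h1
  -- The result is at the point `x.localSection x.proj`, which equals `x` but not definitionally;
  -- the point is generalized in order to transport the dependent statement.
  have h5 : ∀ z : CyclicCover f₀, z = x → FormCorr (D.bundleMap z) (CY.bismut SB u z.proj)
      (CM.bismut SB s (D.toEnd z)) → FormCorr (D.bundleMap x) (CY.bismut SB u x.proj)
      (CM.bismut SB s (D.toEnd x)) := by
    rintro _ rfl h
    exact h
  exact h5 _ x.localSection_self h4

theorem formCorr_single {x : CyclicCover f₀} {j : ℕ}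
    {a : (TangentSpace 𝓘(ℝ, EB) (ϖY x.proj)) [⋀^Fin j]→ₗ[ℝ] V x.proj}
    {a' : (TangentSpace 𝓘(ℝ, EB) (ϖM (D.toEnd x))) [⋀^Fin j]→ₗ[ℝ] V' (D.toEnd x)}
    (h : ∀ w : Fin j → EB, a' w = D.bundleMap x (a w)) :
    FormCorr (D.bundleMap x) (Pi.single j a : FormFiber EB ϖY V x.proj)
      (Pi.single j a' : FormFiber EB ϖM V' (D.toEnd x)) := by
  intro k w
  obtain rfl | hk := eq_or_ne k j
  · rw [Pi.single_eq_same, Pi.single_eq_same]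
    exact h w
  · rw [Pi.single_eq_of_ne hk, Pi.single_eq_of_ne hk]
    exact (map_zero _).symm

theorem IsNatural.component {D : EndPeriodicFamily f₀ CY CM}
    {A : (∀ x, FormFiber EB ϖM V' x) → ∀ x, FormFiber EB ϖM V' x}
    {A' : (∀ y, FormFiber EB ϖY V y) → ∀ y, FormFiber EB ϖY V y} (h : D.IsNatural A A') (j : ℕ) :
    D.IsNatural (EndPeriodic.component j A) (EndPeriodic.component j A') := by
  intro x hx u s hu hs hus
  rw [D.corresponds_iff hx]
  refine D.formCorr_single fun w => ?_
  refine (D.corresponds_iff hx).1 (h x hx _ _ (smoothForm_ofDegZero hu.degZero)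
    (smoothForm_ofDegZero hs.degZero) ?_) j w
  filter_upwards [hus, D.toEnd.open_source.mem_nhds hx] with x' h1 h2
  rw [D.corresponds_iff h2] at h1 ⊢
  exact D.formCorr_single fun w => h1 0 Fin.elim0

theorem IsNatural.congr {D : EndPeriodicFamily f₀ CY CM}
    {A₁ A₂ : (∀ x, FormFiber EB ϖM V' x) → ∀ x, FormFiber EB ϖM V' x}
    {A' : (∀ y, FormFiber EB ϖY V y) → ∀ y, FormFiber EB ϖY V y} (h : D.IsNatural A₁ A')
    (hA : ∀ s, SmoothForm EM F' ϖM s → A₁ s = A₂ s) : D.IsNatural A₂ A' := by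
  intro x hx u s hu hs hus
  rw [← hA s hs]
  exact h x hx u s hu hs hus

/-- The image of a form under the identification over the end. -/
def push (x : CyclicCover f₀) (e : FormFiber EB ϖY V x.proj) :
    FormFiber EB ϖM V' (D.toEnd x) := fun k =>
  ((D.bundleMap x).restrictScalars ℝ).compAlternatingMap
    (show (TangentSpace 𝓘(ℝ, EB) (ϖM (D.toEnd x))) [⋀^Fin k]→ₗ[ℝ] V x.proj from e k)

theorem push_apply (x : CyclicCover f₀) (e : FormFiber EB ϖY V x.proj) :
    FormCorr (D.bundleMap x) e (D.push x e) := fun _ _ => rfl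

/-- Over the end every smooth form on `Y` corresponds locally to a smooth form on `M`. -/
theorem exists_corresponds [T2Space M] {u : ∀ y, FormFiber EB ϖY V y} (hu : SmoothForm EY F ϖY u)
    {x : CyclicCover f₀} (hx : x ∈ D.toEnd.source) :
    ∃ s, SmoothForm EM F' ϖM s ∧
      ∀ᶠ x' in 𝓝 x, D.Corresponds x' (u x'.proj) (s (D.toEnd x')) := by
  classical
  -- The form is pushed to the whole image of the end and set to zero elsewhere. It is smooth on the
  -- open target only; cutting it off near `toEnd x` makes it globally smooth without changing its
  -- germ there.
  let s₀ : ∀ z, FormFiber EB ϖM V' z := fun z =>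
    if h : ∃ x' ∈ D.toEnd.source, D.toEnd x' = z then
      h.choose_spec.2 ▸ D.push h.choose (u h.choose.proj) else 0
  have hs₀ : ∀ x' ∈ D.toEnd.source, s₀ (D.toEnd x') = D.push x' (u x'.proj) := fun x' hx' => by
    have h : ∃ x'' ∈ D.toEnd.source, D.toEnd x'' = D.toEnd x' := ⟨x', hx', rfl⟩
    have h1 : ∀ x'' ∈ D.toEnd.source, ∀ he : D.toEnd x'' = D.toEnd x',
        (he ▸ D.push x'' (u x''.proj) : FormFiber EB ϖM V' (D.toEnd x')) =
          D.push x' (u x'.proj) := fun x'' hx'' he => by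
      obtain rfl := D.toEnd.injOn hx'' hx' he
      rfl
    exact (dif_pos h).trans (h1 _ h.choose_spec.1 _)
  have hsm : ∀ z ∈ D.toEnd.target, SmoothFormAt EM F' ϖM s₀ z := fun z hz k W hW => by
    have hx' := D.toEnd.map_target hz
    have hzx := D.toEnd.right_inv hz
    have hb : ϖM z = ϖY (D.toEnd.symm z).proj := by
      rw [← D.over_base _ hx', hzx]
    have h1 : ContMDiffAt 𝓘(ℝ, EY) (𝓘(ℝ, EY).prod 𝓘(ℝ, F)) ∞
        (fun x' : CyclicCover f₀ => TotalSpace.mk' F (E := V) x'.proj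
          (u x'.proj k fun i => W i (ϖY x'.proj))) (D.toEnd.symm z) :=
      hu.smoothAlong _ k W fun i => hb ▸ hW i
    have h2 := D.bundleMap_smooth _ hx' (fun x' => u x'.proj k fun i => W i (ϖY x'.proj)) h1
    have h3 : ContMDiffAt 𝓘(ℝ, EM) 𝓘(ℝ, EY) ∞ D.toEnd.symm z :=
      D.smooth_symm.contMDiffAt (D.toEnd.open_target.mem_nhds hz)
    refine (h2.comp z h3).congr_of_eventuallyEq ?_
    filter_upwards [D.toEnd.open_target.mem_nhds hz] with z' hz'
    let g : M → TotalSpace F' V' := fun z => TotalSpace.mk' F' (E := V') z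
      (s₀ z k fun i => W i (ϖM z))
    have h4 : g (D.toEnd (D.toEnd.symm z')) = TotalSpace.mk' F' (E := V')
        (D.toEnd (D.toEnd.symm z')) (D.bundleMap (D.toEnd.symm z')
          (u (D.toEnd.symm z').proj k fun i => W i (ϖY (D.toEnd.symm z').proj))) := by
      have hx'' := D.toEnd.map_target hz'
      have h5 := (D.corresponds_iff hx'').2 (D.push_apply _ (u (D.toEnd.symm z').proj)) k W
      rw [← hs₀ _ hx''] at h5
      exact congrArg _ h5
    exact (congrArg g (D.toEnd.right_inv hz')).symm.trans h4
  obtain ⟨s, hs, hse⟩ := exists_smoothForm (x := D.toEnd x) (s := s₀)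
    (Filter.eventually_of_mem (D.toEnd.open_target.mem_nhds (D.toEnd.map_source hx)) hsm)
  refine ⟨s, hs, ?_⟩
  filter_upwards [(D.toEnd.continuousAt hx).eventually hse, D.toEnd.open_source.mem_nhds hx]
    with x' h1 h2
  rw [h1, hs₀ x' h2, D.corresponds_iff h2]
  exact D.push_apply _ _

end EndPeriodicFamily

end EndIso
end EndPeriodic
end

noncomputable section

namespace EndPeriodic

/-! ### The Fourier-Laplace transform and first-order operators. -/

section Fourier

theorem finsum_eq_sum_of_eq {ι W : Type*} [AddCommMonoid W] {f g : ι → W} {S : Finset ι}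
    (h : ∀ m ∈ S, f m = g m) (h0 : ∀ m ∉ S, f m = 0) : ∑ᶠ m, f m = ∑ m ∈ S, g m := by
  rw [finsum_eq_sum_of_support_subset (s := S) f
    fun m hm => by_contra fun h => hm (h0 m (by simpa using h))]
  exact Finset.sum_congr rfl h

variable {EB : Type*} [NormedAddCommGroup EB] [NormedSpace ℝ EB] [FiniteDimensional ℝ EB]
  {B : Type*} [TopologicalSpace B] [ChartedSpace EB B] [IsManifold 𝓘(ℝ, EB) ∞ B]
  {EY : Type*} [NormedAddCommGroup EY] [NormedSpace ℝ EY] [FiniteDimensional ℝ EY]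
  {Y : Type*} [TopologicalSpace Y] [ChartedSpace EY Y] [IsManifold 𝓘(ℝ, EY) ∞ Y]
  {F : Type*} [NormedAddCommGroup F] [NormedSpace ℝ F] [FiniteDimensional ℝ F]
  {V : Y → Type*} [TopologicalSpace (TotalSpace F V)] [∀ y, AddCommGroup (V y)]
  [∀ y, Module ℝ (V y)] [∀ y, Module ℂ (V y)] [∀ y, IsScalarTower ℝ ℂ (V y)]
  [∀ y, TopologicalSpace (V y)] [∀ y, IsTopologicalAddGroup (V y)] [∀ y, ContinuousSMul ℝ (V y)]
  [FiberBundle F V] [VectorBundle ℝ F V] [ContMDiffVectorBundle ∞ F V 𝓘(ℝ, EY)]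
  {f₀ : C^∞⟮𝓘(ℝ, EY), Y; 𝓡 1, Circle⟯} {ϖY : Y → B}
  {GY : RiemannianFamily (EB := EB) (EX := EY) ϖY}

namespace CyclicCover

theorem section_congr {α : Y → Type*} (u : ∀ x : CyclicCover f₀, α x.proj) {t t' : ℝ} {y : Y}
    (h : Circle.exp (2 * Real.pi * t) = f₀ y) (h' : Circle.exp (2 * Real.pi * t') = f₀ y)
    (ht : t = t') : u ⟨t, y, h⟩ = u ⟨t', y, h'⟩ := by
  subst ht
  rfl

theorem eventually_eq_proj {α : Y → Type*} {u : ∀ x : CyclicCover f₀, α x.proj} {w : ∀ y, α y}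
    {x : CyclicCover f₀} (h : ∀ᶠ y in 𝓝 x.proj, u (x.localSection y) = w y) :
    ∀ᶠ x' in 𝓝 x, u x' = w x'.proj := by
  have h1 := eventually_of_localSection x.proj_mem_regular
    (P := fun z => u z = w z.proj) h
  rwa [x.localSection_self] at h1

theorem tendsto_localSection (x : CyclicCover f₀) :
    Filter.Tendsto x.localSection (𝓝 x.proj) (𝓝 x) := by
  have h := (x.continuousAt_localSection x.proj_mem_regular).tendsto
  rwa [x.localSection_self] at h

theorem eventually_mem_regular (x : CyclicCover f₀) : ∀ᶠ y in 𝓝 x.proj, y ∈ x.regular :=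
  x.isOpen_regular.mem_nhds x.proj_mem_regular

theorem abs_height_lift_le (y : Y) : |(lift f₀ y).height| ≤ 1 / 2 := by
  change |Complex.arg (f₀ y) / (2 * Real.pi)| ≤ 1 / 2
  rw [abs_div, abs_of_pos (a := 2 * Real.pi) (by positivity), div_le_iff₀ (by positivity)]
  linarith [Complex.abs_arg_le_pi (f₀ y)]

end CyclicCover

theorem smoothAlong_of_eventually {u : ∀ x : CyclicCover f₀, FormFiber EB ϖY V x.proj}
    (h : ∀ x, ∃ w, SmoothFormAt EY F ϖY w x.proj ∧ ∀ᶠ x' in 𝓝 x, u x' = w x'.proj) :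
    SmoothAlong EY F (EX' := EY) ϖY CyclicCover.proj u := fun x k W hW => by
  obtain ⟨w, hw, hwu⟩ := h x
  refine ((hw k W hW).comp x (CyclicCover.contMDiff_proj x)).congr_of_eventuallyEq ?_
  filter_upwards [hwu] with x' hx'
  rw [hx']
  rfl

theorem SmoothAlong.exists_smoothForm [T2Space Y]
    {u : ∀ x : CyclicCover f₀, FormFiber EB ϖY V x.proj}
    (hu : SmoothAlong EY F (EX' := EY) ϖY CyclicCover.proj u) (x : CyclicCover f₀) :
    ∃ w, SmoothForm EY F ϖY w ∧ ∀ᶠ y in 𝓝 x.proj, u (x.localSection y) = w y := by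
  obtain ⟨w, hw, h⟩ := EndPeriodic.exists_smoothForm (EX := EY) (x := x.proj)
    (s := fun y => u (x.localSection y)) (x.eventually_mem_regular.mono fun y => hu.localSection x)
  exact ⟨w, hw, h.mono fun y => Eq.symm⟩

theorem exists_contMDiff_complex [T2Space Y] {g : Y → ℂ} {y : Y}
    (hg : ∀ᶠ y' in 𝓝 y, ContMDiffAt 𝓘(ℝ, EY) 𝓘(ℝ, ℂ) ∞ g y') :
    ∃ φ : Y → ℂ, ContMDiff 𝓘(ℝ, EY) 𝓘(ℝ, ℂ) ∞ φ ∧ φ =ᶠ[𝓝 y] g := by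
  obtain ⟨φ, hφ, h1, h0⟩ := exists_bump (EX := EY) hg
  refine ⟨fun y => φ y • g y, fun y' => ?_, h1.mono fun y' hy' => by simp [hy']⟩
  by_cases hy' : ContMDiffAt 𝓘(ℝ, EY) 𝓘(ℝ, ℂ) ∞ g y'
  · exact (hφ y').smul hy'
  · exact (contMDiffAt_const (c := (0 : ℂ))).congr_of_eventuallyEq
      ((h0 y' hy').mono fun y'' h => by simp [h])

/-- The identity `dφ = L φ df` for `φ = exp (f L)`, the source of the term in `L` in the indicial
family. -/
theorem contMDiffAt_exp_localHeight (x : CyclicCover f₀) (L : ℂ) {y : Y} (hy : y ∈ x.regular) :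
    ContMDiffAt 𝓘(ℝ, EY) 𝓘(ℝ, ℂ) ∞ (fun y => Complex.exp (x.localHeight y * L)) y ∧
      ∀ v : TangentSpace 𝓘(ℝ, EY) y,
        mfderiv 𝓘(ℝ, EY) 𝓘(ℝ, ℂ) (fun y => Complex.exp (x.localHeight y * L)) y v =
          (dHeight f₀ y v : ℂ) * (Complex.exp (x.localHeight y * L) * L) := by
  let g : ℝ → ℂ := fun t => Complex.exp (t * L)
  have hg : ContDiff ℝ ∞ g :=
    Complex.contDiff_exp.comp (Complex.ofRealCLM.contDiff.mul contDiff_const)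
  obtain ⟨h1, h2⟩ := x.contMDiffAt_localHeight hy
  refine ⟨hg.contMDiff.contMDiffAt.comp y h1, fun v => ?_⟩
  have h3 : HasDerivAt g (Complex.exp (x.localHeight y * L) * L) (x.localHeight y) := by
    have h := ((Complex.ofRealCLM.hasDerivAt (x := x.localHeight y)).mul_const L).cexp
    simpa using h
  have h4 := mfderiv_comp y (hg.contMDiff.contMDiffAt.mdifferentiableAt (by simp))
    (h1.mdifferentiableAt (by simp))
  rw [mfderiv_eq_fderiv, h3.hasFDerivAt.fderiv] at h4
  refine (congrArg (fun A : TangentSpace 𝓘(ℝ, EY) y →L[ℝ] ℂ => A v) h4).trans ?_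
  rw [← h2]
  exact Complex.real_smul

/-- The Fourier-Laplace transform of a compactly supported smooth section is locally a finite sum
of translates. -/
theorem exists_local_fourierLaplace [T2Space Y] {ξ L : ℂ} (hL : Complex.exp L = ξ)
    {u : ∀ x : CyclicCover f₀, FormFiber EB ϖY V x.proj}
    (hu : SmoothAlong EY F (EX' := EY) ϖY CyclicCover.proj u)
    (hc : IsCompact (closure {x | u x ≠ 0})) (x : CyclicCover f₀) :
    ∃ (S : Finset ℤ) (w : ℤ → ∀ y, FormFiber EB ϖY V y) (φ : Y → ℂ),
      (∀ m, SmoothForm EY F ϖY (w m)) ∧ ContMDiff 𝓘(ℝ, EY) 𝓘(ℝ, ℂ) ∞ φ ∧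
      φ x.proj = Complex.exp (x.height * L) ∧
      (∀ v : TangentSpace 𝓘(ℝ, EY) x.proj, mfderiv 𝓘(ℝ, EY) 𝓘(ℝ, ℂ) φ x.proj v =
        (dHeight f₀ x.proj v : ℂ) * (Complex.exp (x.height * L) * L)) ∧
      (∀ m, ∀ᶠ x' in 𝓝 (x.deck m), u x' = w m x'.proj) ∧ (∀ m ∉ S, w m = 0) ∧
      ∀ᶠ y in 𝓝 x.proj, fourierLaplace ξ L u y = φ y • ∑ m ∈ S, ξ ^ m • w m y := by
  classical
  obtain ⟨R, hR⟩ := hc.exists_bound_of_continuousOn CyclicCover.continuous_height.continuousOn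
  -- Heights on the support are at most `R` in absolute value, and the local branch stays within 1/2
  -- of `x.height`. So a translate by `m` can only be nonzero if `|m| ≤ R + |x.height| + 1/2`, for
  -- all `y` at once.
  obtain ⟨n, hn⟩ := exists_nat_gt (|x.height| + 1 / 2 + R)
  have hlh : x.localHeight x.proj = x.height :=
    congrArg CyclicCover.height x.localSection_self
  have hdeck : ∀ m y, u ((x.deck m).localSection y) = u ((x.localSection y).deck m) := fun m y =>
    CyclicCover.section_congr u _ _ (congrArg CyclicCover.height (x.localSection_deck m y))
  have hS : ∀ m ∉ Finset.Icc (-n : ℤ) n, ∀ y, u ((x.localSection y).deck m) = 0 := by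
    intro m hm y
    by_contra h
    have h1 : |x.localHeight y + m| ≤ R := hR ((x.localSection y).deck m) (subset_closure h)
    have h2 := x.abs_localHeight_sub_le y
    refine hm (Finset.mem_Icc.2 (abs_le.1 ?_))
    have h3 : |(m : ℝ)| < n := by
      have h4 := abs_sub (x.localHeight y + m) (x.localHeight y)
      have h5 := abs_add_le (x.localHeight y - x.height) x.height
      rw [add_sub_cancel_left] at h4
      rw [sub_add_cancel] at h5
      linarith
    have h6 : ((|m| : ℤ) : ℝ) < ((n : ℤ) : ℝ) := by
      rw [Int.cast_abs]
      exact_mod_cast h3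
    exact (Int.cast_lt.1 h6).le
  -- Outside the finite range the representative is taken to be exactly zero, so that the lifted
  -- operator also vanishes at those translates.
  have hw : ∀ m : ℤ, ∃ w, SmoothForm EY F ϖY w ∧
      (∀ᶠ y in 𝓝 x.proj, u ((x.deck m).localSection y) = w y) ∧
        (m ∉ Finset.Icc (-n : ℤ) n → w = 0) := fun m => by
    by_cases hm : m ∈ Finset.Icc (-n : ℤ) n
    · obtain ⟨w, hw, h⟩ := hu.exists_smoothForm (x.deck m)
      exact ⟨w, hw, h, fun h => absurd hm h⟩
    · exact ⟨0, fun y => smoothFormAt_zero y, Filter.Eventually.of_forall fun y =>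
        (hdeck m y).trans (hS m hm y), fun _ => rfl⟩
  choose w hws hwu hw0 using hw
  obtain ⟨φ, hφ, hφe⟩ := exists_contMDiff_complex (x.eventually_mem_regular.mono fun y hy =>
    (contMDiffAt_exp_localHeight x L hy).1)
  refine ⟨Finset.Icc (-n : ℤ) n, w, φ, hws, hφ, ?_, fun v => ?_, fun m => ?_, hw0, ?_⟩
  · rw [hφe.self_of_nhds]
    change Complex.exp (x.localHeight x.proj * L) = _
    rw [hlh]
  · rw [hφe.mfderiv_eq]
    refine ((contMDiffAt_exp_localHeight x L x.proj_mem_regular).2 v).trans ?_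
    rw [hlh]
  · exact CyclicCover.eventually_eq_proj (hwu m)
  · filter_upwards [hφe, (Filter.eventually_all_finset (Finset.Icc (-n : ℤ) n)).2
      fun m _ => hwu m] with y h1 h2
    refine (fourierLaplace_proj ξ L hL u (x.localSection y)).trans ?_
    rw [h1]
    refine congrArg (Complex.exp (x.localHeight y * L) • ·) ?_
    exact finsum_eq_sum_of_eq (W := FormFiber EB ϖY V y)
      (fun m hm => congrArg (ξ ^ m • ·) ((hdeck m y).symm.trans (h2 m hm)))
      fun m hm =>
        (congrArg (fun e : FormFiber EB ϖY V y => ξ ^ m • e) (hS m hm y)).trans 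
          (smul_zero (A := FormFiber EB ϖY V y) (ξ ^ m))

variable [T2Space Y]

theorem CliffordFamily.smoothForm_sum_smul (C : CliffordFamily GY F V) {S : Finset ℤ} (c : ℤ → ℂ)
    {w : ℤ → ∀ y, FormFiber EB ϖY V y} (hw : ∀ m, SmoothForm EY F ϖY (w m)) :
    SmoothForm EY F ϖY (fun y => ∑ m ∈ S, c m • w m y) := by
  have h : (fun y => ∑ m ∈ S, c m • w m y) = ∑ m ∈ S, fun y => c m • w m y := by
    funext y
    rw [Finset.sum_apply]
  rw [h]
  exact fun y => SmoothFormAt.sum fun m _ => C.smoothForm_complex_smul (hw m) contMDiff_const y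

theorem CliffordFamily.smoothForm_fourierLaplace (C : CliffordFamily GY F V) {ξ L : ℂ}
    (hL : Complex.exp L = ξ) {u : ∀ x : CyclicCover f₀, FormFiber EB ϖY V x.proj}
    (hu : SmoothAlong EY F (EX' := EY) ϖY CyclicCover.proj u)
    (hc : IsCompact (closure {x | u x ≠ 0})) : SmoothForm EY F ϖY (fourierLaplace ξ L u) := by
  intro y
  obtain ⟨S, w, φ, hw, hφ, -, -, -, -, h⟩ :=
    exists_local_fourierLaplace hL hu hc (CyclicCover.lift f₀ y)
  exact SmoothFormAt.congr
    (C.smoothForm_complex_smul (C.smoothForm_sum_smul (fun m => ξ ^ m) hw) hφ y) h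

section Operators

variable {τ : ∀ y : Y, Module.Dual ℝ (TangentSpace 𝓘(ℝ, EY) y)}
  {A : (∀ y, FormFiber EB ϖY V y) → ∀ y, FormFiber EB ϖY V y}
  {σ : ∀ y, FormFiber EB ϖY V y → FormFiber EB ϖY V y}

theorem IsFirstOrder.map_zero (hA : IsFirstOrder EY F ϖY τ A σ) (y : Y) : A 0 y = 0 := by
  have h := hA.add 0 0 (fun y => smoothFormAt_zero y) (fun y => smoothFormAt_zero y) y
  rw [add_zero] at h
  exact left_eq_add.1 h

theorem IsFirstOrder.map_smul (hA : IsFirstOrder EY F ϖY τ A σ) (c : ℂ)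
    {s : ∀ y, FormFiber EB ϖY V y} (hs : SmoothForm EY F ϖY s) (y : Y) :
    A (fun y => c • s y) y = c • A s y := by
  have h := hA.leibniz s hs (fun _ => c) contMDiff_const y 0 fun v => by
    rw [mfderiv_const, mul_zero]
    rfl
  rwa [zero_smul, add_zero] at h

theorem IsFirstOrder.map_sum_smul (C : CliffordFamily GY F V) (hA : IsFirstOrder EY F ϖY τ A σ)
    (S : Finset ℤ) (c : ℤ → ℂ) {w : ℤ → ∀ y, FormFiber EB ϖY V y}
    (hw : ∀ m, SmoothForm EY F ϖY (w m)) (y : Y) :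
    A (fun y => ∑ m ∈ S, c m • w m y) y = ∑ m ∈ S, c m • A (w m) y := by
  classical
  induction S using Finset.induction_on with
  | empty =>
    simp only [Finset.sum_empty]
    exact hA.map_zero y
  | insert a S ha ih =>
    have h : (fun y => ∑ m ∈ insert a S, c m • w m y) =
        (fun y => c a • w a y) + fun y => ∑ m ∈ S, c m • w m y := by
      funext y
      rw [Finset.sum_insert ha]
      rfl
    rw [h, hA.add _ _ (C.smoothForm_complex_smul (hw a) contMDiff_const)
      (C.smoothForm_sum_smul c hw), ih, hA.map_smul _ (hw a), Finset.sum_insert ha]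

/-- The Fourier-Laplace transform intertwines the lift of a first order operator with its
indicial family. -/
theorem IsFirstOrder.fourierLaplace_lift (C : CliffordFamily GY F V)
    (hA : IsFirstOrder EY F ϖY (dHeight f₀) A σ) (hσ : ∀ y (c : ℂ) e, σ y (c • e) = c • σ y e)
    {N : (∀ x : CyclicCover f₀, FormFiber EB ϖY V x.proj) →
      ∀ x : CyclicCover f₀, FormFiber EB ϖY V x.proj} (hN : IsLift F A N) {ξ L : ℂ}
    (hL : Complex.exp L = ξ) {u : ∀ x : CyclicCover f₀, FormFiber EB ϖY V x.proj}
    (hu : SmoothAlong EY F (EX' := EY) ϖY CyclicCover.proj u)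
    (hc : IsCompact (closure {x | u x ≠ 0})) (y : Y) :
    fourierLaplace ξ L (N u) y =
      A (fourierLaplace ξ L u) y - L • σ y (fourierLaplace ξ L u y) := by
  obtain ⟨x, rfl⟩ : ∃ x : CyclicCover f₀, x.proj = y := ⟨CyclicCover.lift f₀ y, rfl⟩
  obtain ⟨S, w, φ, hw, hφ, hφx, hφd, hwu, hw0, h⟩ := exists_local_fourierLaplace hL hu hc x
  -- Only the defining property of a lift is used: near `x + m` the section `u` is the pullback of
  -- `w m`.
  have hNu : ∀ m, N u (x.deck m) = A (w m) x.proj := fun m => hN _ _ (hw m) hu _ (hwu m)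
  have h1 : fourierLaplace ξ L (N u) x.proj =
      Complex.exp (x.height * L) • ∑ m ∈ S, ξ ^ m • A (w m) x.proj := by
    rw [fourierLaplace_proj ξ L hL]
    refine congrArg (Complex.exp (x.height * L) • ·) ?_
    refine finsum_eq_sum_of_eq (W := FormFiber EB ϖY V x.proj)
      (fun m _ => congrArg (ξ ^ m • ·) (hNu m)) fun m hm => ?_
    refine (congrArg (ξ ^ m • ·) (hNu m)).trans ?_
    rw [hw0 m hm, hA.map_zero]
    exact smul_zero _
  have hW := C.smoothForm_sum_smul (S := S) (fun m => ξ ^ m) hw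
  -- By locality the transform may be replaced by `φ • W`. The Leibniz rule with `dφ = L φ df` gives
  -- `φ A W + L φ σ W`, and the second term is cancelled by `L • σ` of the transform.
  rw [h1, hA.congr (C.smoothForm_fourierLaplace hL hu hc) (C.smoothForm_complex_smul hW hφ) h,
    hA.leibniz _ hW φ hφ x.proj _ hφd, hA.map_sum_smul C S _ hw, h.self_of_nhds, hσ, hφx,
    smul_smul, mul_comm L, add_sub_cancel_right]

end Operators

/-- A smooth function on the line with support in `[-1, 1]` whose integral translates sum to `1`. -/
def bumpHeight (t : ℝ) : ℝ := Real.smoothTransition (t + 1) - Real.smoothTransition t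

theorem bumpHeight_of_one_le {t : ℝ} (ht : 1 ≤ |t|) : bumpHeight t = 0 := by
  obtain h | h := le_abs.1 ht
  · rw [bumpHeight, Real.smoothTransition.one_of_one_le h,
      Real.smoothTransition.one_of_one_le (by linarith), sub_self]
  · rw [bumpHeight, Real.smoothTransition.zero_of_nonpos (by linarith),
      Real.smoothTransition.zero_of_nonpos (by linarith), sub_self]

theorem contDiff_bumpHeight : ContDiff ℝ ∞ bumpHeight :=
  (Real.smoothTransition.contDiff.comp (contDiff_id.add contDiff_const)).sub
    Real.smoothTransition.contDiff

/-- With `s` the smooth transition function, the sum telescopes to `s (t + 2) - s (t - 1) = 1 - 0`.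
-/
theorem sum_bumpHeight {t : ℝ} (ht : |t| ≤ 1 / 2) :
    ∑ m ∈ Finset.Icc (-1 : ℤ) 1, bumpHeight (t + m) = 1 := by
  rw [abs_le] at ht
  have h : Finset.Icc (-1 : ℤ) 1 = {-1, 0, 1} := rfl
  rw [h, Finset.sum_insert (by decide), Finset.sum_insert (by decide), Finset.sum_singleton]
  simp only [bumpHeight]
  push_cast
  rw [neg_add_cancel_right, add_zero, Real.smoothTransition.one_of_one_le (x := t + 1 + 1)
      (by linarith), Real.smoothTransition.zero_of_nonpos (x := t + -1) (by linarith)]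
  ring

/-- Every smooth form on `Y` is the Fourier-Laplace transform of a compactly supported smooth
section. -/
theorem CliffordFamily.exists_fourierLaplace_eq [CompactSpace Y] (C : CliffordFamily GY F V)
    {ξ L : ℂ} (hL : Complex.exp L = ξ) {v : ∀ y, FormFiber EB ϖY V y}
    (hv : SmoothForm EY F ϖY v) :
    ∃ u : ∀ x : CyclicCover f₀, FormFiber EB ϖY V x.proj,
      SmoothAlong EY F (EX' := EY) ϖY CyclicCover.proj u ∧ IsCompact (closure {x | u x ≠ 0}) ∧
        fourierLaplace ξ L u = v := by
  -- The factor `exp (-(t L))` undoes the weights of the transform: `exp (t L) ∑ ξ ^ m g (t + m) = ∑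
  -- bumpHeight (t + m) = 1`.
  let g : ℝ → ℂ := fun t => Complex.exp (-(t * L)) * bumpHeight t
  have hg : ContDiff ℝ ∞ g :=
    (Complex.contDiff_exp.comp (Complex.ofRealCLM.contDiff.mul contDiff_const).neg).mul
      (Complex.ofRealCLM.contDiff.comp contDiff_bumpHeight)
  refine ⟨fun x => g x.height • v x.proj, smoothAlong_of_eventually fun x =>
    ⟨fun y => g (x.localHeight y) • v y, ?_, ?_⟩, ?_, ?_⟩
  · exact C.smoothFormAt_complex_smul (hg.contMDiff.contMDiffAt.comp _
      (x.contMDiffAt_localHeight x.proj_mem_regular).1) (hv x.proj)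
  · filter_upwards [x.eventually_localSection_proj] with x' hx'
    have h : x.localHeight x'.proj = x'.height := congrArg CyclicCover.height hx'
    rw [h]
  · refine (CyclicCover.isCompact_abs_height_le 1).of_isClosed_subset isClosed_closure
      (closure_minimal (fun x hx => ?_) (isClosed_le CyclicCover.continuous_height.abs
        continuous_const))
    by_contra h
    refine hx ?_
    change g x.height • v x.proj = 0
    simp only [g]
    rw [bumpHeight_of_one_le (not_le.1 h).le, Complex.ofReal_zero, mul_zero, zero_smul]
  · funext y
    have ht := CyclicCover.abs_height_lift_le (f₀ := f₀) y
    set t := (CyclicCover.lift f₀ y).height with hdef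
    have h1 : ∀ m : ℤ, ξ ^ m • g (t + m) • v y =
        (Complex.exp (-(t * L)) * bumpHeight (t + m)) • v y := fun m => by
      rw [smul_smul, ← hL, ← Complex.exp_int_mul, ← mul_assoc, ← Complex.exp_add]
      congr 3
      push_cast
      ring
    have h2 : fourierLaplace ξ L (fun x : CyclicCover f₀ => g x.height • v x.proj) y =
        Complex.exp (t * L) • ∑ᶠ m : ℤ, (Complex.exp (-(t * L)) * bumpHeight (t + m)) • v y :=
      congrArg (Complex.exp (t * L) • ·) (finsum_congr h1)
    -- The chosen lift has `|t| ≤ 1/2`, so for `|m| ≥ 2` the argument `t + m` lies outside the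
    -- support of the bump.
    rw [h2, finsum_eq_sum_of_support_subset (s := Finset.Icc (-1 : ℤ) 1)]
    · rw [← Finset.sum_smul, ← Finset.mul_sum, ← Complex.ofReal_sum, sum_bumpHeight ht, smul_smul,
        Complex.ofReal_one, mul_one, ← Complex.exp_add, add_neg_cancel, Complex.exp_zero, one_smul]
    · intro m hm
      by_contra h
      refine hm ?_
      have h3 : 1 ≤ |t + m| := by
        rw [abs_le] at ht
        rw [Finset.coe_Icc, Set.mem_Icc, not_and_or, not_le, not_le] at h
        rw [le_abs]
        obtain h | h := h
        · right
          have : (m : ℝ) ≤ -2 := by exact_mod_cast (by omega : m ≤ -2)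
          linarith
        · left
          have : (2 : ℝ) ≤ m := by exact_mod_cast (by omega : 2 ≤ m)
          linarith
      change (Complex.exp (-(t * L)) * bumpHeight (t + m)) • v y = 0
      rw [bumpHeight_of_one_le h3, Complex.ofReal_zero, mul_zero, zero_smul]

end Fourier
end EndPeriodic
end

noncomputable section

namespace EndPeriodic

/-! ### Normal operators and indicial families. -/

section Indicial

variable {EB : Type*} [NormedAddCommGroup EB] [NormedSpace ℝ EB] [FiniteDimensional ℝ EB]
  {B : Type*} [TopologicalSpace B] [ChartedSpace EB B] [IsManifold 𝓘(ℝ, EB) ∞ B]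
  {EY : Type*} [NormedAddCommGroup EY] [NormedSpace ℝ EY] [FiniteDimensional ℝ EY]
  {Y : Type*} [TopologicalSpace Y] [ChartedSpace EY Y] [IsManifold 𝓘(ℝ, EY) ∞ Y]
  {F : Type*} [NormedAddCommGroup F] [NormedSpace ℝ F] [FiniteDimensional ℝ F]
  {V : Y → Type*} [TopologicalSpace (TotalSpace F V)] [∀ y, AddCommGroup (V y)]
  [∀ y, Module ℝ (V y)] [∀ y, Module ℂ (V y)] [∀ y, IsScalarTower ℝ ℂ (V y)]
  [∀ y, TopologicalSpace (V y)] [∀ y, IsTopologicalAddGroup (V y)] [∀ y, ContinuousSMul ℝ (V y)]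
  [FiberBundle F V] [VectorBundle ℝ F V] [ContMDiffVectorBundle ∞ F V 𝓘(ℝ, EY)]
  {EM : Type*} [NormedAddCommGroup EM] [NormedSpace ℝ EM] [FiniteDimensional ℝ EM]
  {M : Type*} [TopologicalSpace M] [ChartedSpace EM M] [IsManifold 𝓘(ℝ, EM) ∞ M]
  {F' : Type*} [NormedAddCommGroup F'] [NormedSpace ℝ F'] [FiniteDimensional ℝ F']
  {V' : M → Type*} [TopologicalSpace (TotalSpace F' V')] [∀ x, AddCommGroup (V' x)]
  [∀ x, Module ℝ (V' x)] [∀ x, Module ℂ (V' x)] [∀ x, IsScalarTower ℝ ℂ (V' x)]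
  [∀ x, TopologicalSpace (V' x)] [∀ x, IsTopologicalAddGroup (V' x)]
  [∀ x, ContinuousSMul ℝ (V' x)]
  [FiberBundle F' V'] [VectorBundle ℝ F' V'] [ContMDiffVectorBundle ∞ F' V' 𝓘(ℝ, EM)]
  {f₀ : C^∞⟮𝓘(ℝ, EY), Y; 𝓡 1, Circle⟯} {ϖY : Y → B} {ϖM : M → B}
  {GY : RiemannianFamily (EB := EB) (EX := EY) ϖY} {CY : CliffordFamily GY F V}
  {GM : RiemannianFamily (EB := EB) (EX := EM) ϖM} {CM : CliffordFamily GM F' V'}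

/-- At each point the operator is applied to any smooth form on `Y` that represents the section near
that point; locality makes the choice irrelevant. Where there is no such form the value is set to
zero. -/
theorem IsFirstOrder.exists_isLift [T2Space Y]
    {τ : ∀ y : Y, Module.Dual ℝ (TangentSpace 𝓘(ℝ, EY) y)}
    {A : (∀ y, FormFiber EB ϖY V y) → ∀ y, FormFiber EB ϖY V y}
    {σ : ∀ y, FormFiber EB ϖY V y → FormFiber EB ϖY V y} (hA : IsFirstOrder EY F ϖY τ A σ) :
    ∃ N : (∀ x : CyclicCover f₀, FormFiber EB ϖY V x.proj) →
      ∀ x : CyclicCover f₀, FormFiber EB ϖY V x.proj, IsLift F A N := by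
  classical
  refine ⟨fun u x => if h : ∃ w, SmoothForm EY F ϖY w ∧ ∀ᶠ x' in 𝓝 x, u x' = w x'.proj then
    A h.choose x.proj else 0, fun w u hw _ x hwu => ?_⟩
  have h : ∃ w, SmoothForm EY F ϖY w ∧ ∀ᶠ x' in 𝓝 x, u x' = w x'.proj := ⟨w, hw, hwu⟩
  refine (dif_pos h).trans (hA.congr h.choose_spec.1 hw ?_)
  filter_upwards [x.tendsto_localSection.eventually hwu,
    x.tendsto_localSection.eventually h.choose_spec.2] with y h1 h2
  exact h2.symm.trans h1

namespace EndPeriodicFamily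

variable {D : EndPeriodicFamily f₀ CY CM}
  {A : (∀ x, FormFiber EB ϖM V' x) → ∀ x, FormFiber EB ϖM V' x}
  {A' : (∀ y, FormFiber EB ϖY V y) → ∀ y, FormFiber EB ϖY V y}
  {σ : ∀ y, FormFiber EB ϖY V y → FormFiber EB ϖY V y}

theorem corresponds_unique {x : CyclicCover f₀} (hx : x ∈ D.toEnd.source)
    {e e₁ : FormFiber EB ϖY V x.proj} {e' : FormFiber EB ϖM V' (D.toEnd x)}
    (h : D.Corresponds x e e') (h₁ : D.Corresponds x e₁ e') : e = e₁ := by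
  rw [D.corresponds_iff hx] at h h₁
  funext k
  ext w
  exact (D.bundleMap_bijective x hx).1 ((h k w).symm.trans (h₁ k w))

/-- A normal operator may come with a different `P` on `Y`, so it must be shown that `P` and `A'`
agree on smooth forms. Every point of `Y` has a lift in the end; there both `P w` and `A' w`
correspond to the value of `A` on the same section, and the bundle map is injective. -/
theorem IsNatural.isLift [T2Space M] [T2Space Y] (h : D.IsNatural A A')
    {P : (∀ y, FormFiber EB ϖY V y) → ∀ y, FormFiber EB ϖY V y}
    {N : (∀ x : CyclicCover f₀, FormFiber EB ϖY V x.proj) →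
      ∀ x : CyclicCover f₀, FormFiber EB ϖY V x.proj} (hN : D.IsNormalOperator A P N) :
    IsLift F A' N := by
  intro w u hw hu x hwu
  rw [hN.1 w u hw hu x hwu]
  -- The chosen lift has height at least `-1/2`, so one deck translation brings it into the region
  -- of positive height.
  have hx : (CyclicCover.lift f₀ x.proj).deck 1 ∈ D.toEnd.source := by
    rw [D.source_eq]
    change 0 < (CyclicCover.lift f₀ x.proj).height + ((1 : ℤ) : ℝ)
    have := abs_le.1 (CyclicCover.abs_height_lift_le (f₀ := f₀) x.proj)
    push_cast
    linarith
  obtain ⟨s, hs, hws⟩ := D.exists_corresponds hw hx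
  have h1 := hN.2 s (fun x => w x.proj) hs hw.smoothAlong _ hx hws
  rw [hN.1 w _ hw hw.smoothAlong _ (Filter.Eventually.of_forall fun _ => rfl)] at h1
  exact corresponds_unique hx h1 (h _ hx w s hw hs hws)

theorem IsNatural.isNormalOperator [T2Space Y] (h : D.IsNatural A A')
    {N : (∀ x : CyclicCover f₀, FormFiber EB ϖY V x.proj) →
      ∀ x : CyclicCover f₀, FormFiber EB ϖY V x.proj} (hN : IsLift F A' N) :
    D.IsNormalOperator A A' N := by
  refine ⟨hN, fun s u hs hu x hx hus => ?_⟩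
  obtain ⟨w, hw, hwu⟩ := hu.exists_smoothForm x
  have hwu' := CyclicCover.eventually_eq_proj hwu
  rw [hN w u hw hu x hwu']
  refine h x hx w s hw hs ?_
  filter_upwards [hus, hwu'] with x' h1 h2
  exact h2 ▸ h1

/-- The indicial family of an end-periodic first order operator is obtained from the operator on
the furled-up family by subtracting `log ξ` times the symbol at `df`. -/
theorem IsNatural.isIndicialFamily_iff [T2Space M] [T2Space Y] [CompactSpace Y]
    (h : D.IsNatural A A') (hA : IsFirstOrder EY F ϖY (dHeight f₀) A' σ)
    (hσ : ∀ y (c : ℂ) e, σ y (c • e) = c • σ y e) {ξ L : ℂ} (hL : Complex.exp L = ξ)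
    (Q : (∀ y, FormFiber EB ϖY V y) → ∀ y, FormFiber EB ϖY V y) :
    D.IsIndicialFamily ξ L A Q ↔
      ∀ v, SmoothForm EY F ϖY v → ∀ y, Q v y = A' v y - L • σ y (v y) := by
  refine ⟨fun ⟨P, N, hN, hF⟩ v hv y => ?_, fun hQ => ?_⟩
  · obtain ⟨u, hu, hc, rfl⟩ := CY.exists_fourierLaplace_eq (f₀ := f₀) hL hv
    rw [← hF u hu hc]
    exact hA.fourierLaplace_lift CY hσ (h.isLift hN) hL hu hc y
  · obtain ⟨N, hN⟩ := hA.exists_isLift (f₀ := f₀)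
    refine ⟨A', N, h.isNormalOperator hN, fun u hu hc => funext fun y => ?_⟩
    rw [hQ _ (CY.smoothForm_fourierLaplace hL hu hc)]
    exact hA.fourierLaplace_lift CY hσ hN hL hu hc y

end EndPeriodicFamily

end Indicial
end EndPeriodic
end

noncomputable section

namespace EndPeriodic

/-! ### Components of the symbol `m₀(df)`. -/

section Symbols

variable {EB : Type*} [NormedAddCommGroup EB] [NormedSpace ℝ EB]
  {B : Type*} [TopologicalSpace B] [ChartedSpace EB B] [IsManifold 𝓘(ℝ, EB) ∞ B]
  {EX : Type*} [NormedAddCommGroup EX] [NormedSpace ℝ EX] [FiniteDimensional ℝ EX]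
  {X : Type*} [TopologicalSpace X] [ChartedSpace EX X] [IsManifold 𝓘(ℝ, EX) ∞ X]
  {F : Type*} [NormedAddCommGroup F] [NormedSpace ℝ F] [FiniteDimensional ℝ F]
  {V : X → Type*} [TopologicalSpace (TotalSpace F V)] [∀ x, AddCommGroup (V x)]
  [∀ x, Module ℝ (V x)] [∀ x, Module ℂ (V x)] [∀ x, IsScalarTower ℝ ℂ (V x)]
  [∀ x, TopologicalSpace (V x)] [∀ x, IsTopologicalAddGroup (V x)] [∀ x, ContinuousSMul ℝ (V x)]
  [FiberBundle F V] [VectorBundle ℝ F V] [ContMDiffVectorBundle ∞ F V 𝓘(ℝ, EX)]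
  {ϖ : X → B} {G : RiemannianFamily (EB := EB) (EX := EX) ϖ}

theorem component_symbol_smul {σ : ∀ x, FormFiber EB ϖ V x → FormFiber EB ϖ V x}
    (hσ : ∀ x (c : ℂ) e, σ x (c • e) = c • σ x e) (j : ℕ) (x : X) (c : ℂ)
    (e : FormFiber EB ϖ V x) :
    (Pi.single j (σ x (Pi.single 0 (AlternatingMap.constOfIsEmpty ℝ _ (Fin 0)
        ((c • e) 0 Fin.elim0))) j) : FormFiber EB ϖ V x) =
      c • Pi.single j (σ x (Pi.single 0 (AlternatingMap.constOfIsEmpty ℝ _ (Fin 0)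
        (e 0 Fin.elim0))) j) := by
  have h : (Pi.single 0 (AlternatingMap.constOfIsEmpty ℝ _ (Fin 0) ((c • e) 0 Fin.elim0)) :
      FormFiber EB ϖ V x) =
      c • Pi.single 0 (AlternatingMap.constOfIsEmpty ℝ _ (Fin 0) (e 0 Fin.elim0)) := by
    rw [← Pi.single_smul]
    rfl
  rw [h, hσ, ← Pi.single_smul]
  rfl

namespace CliffordFamily

theorem ofDegZero_sub_smul (c : ℂ) (u u' : ∀ x, V x) (x : X) :
    ofDegZero (EB := EB) ϖ (fun x => u x - c • u' x) x =
      ofDegZero ϖ u x - c • ofDegZero ϖ u' x := by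
  rw [ofDegZero, ofDegZero, ofDegZero, ← Pi.single_smul, ← Pi.single_sub]
  rfl

variable (C : CliffordFamily G F V) (x : X) (α : Module.Dual ℝ (TangentSpace 𝓘(ℝ, EX) x))
  (u : ∀ x, V x)

/-- The truncated symbols of `IsFirstOrder.component` are evaluated here and below: Clifford
multiplication in degree 0, exterior multiplication in degree 1, and zero in degree 2, which is why
`A_[2]` has no term in `log ξ`. -/
theorem single_zero_m₀ {u' : ∀ x, V x}
    (hu' : u' x = C.cl x (α.domRestrict (Vertical EB EX ϖ x)) (u x)) :
    (Pi.single 0 (C.m₀ x α (ofDegZero ϖ u x) 0) : FormFiber EB ϖ V x) = ofDegZero ϖ u' x := by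
  rw [C.m₀_ofDegZero x α u u' hu', Pi.add_apply, ofDegZero_zero, horTensor_eq,
    Pi.single_eq_of_ne (by simp), add_zero]
  rfl

theorem single_one_m₀ :
    (Pi.single 1 (C.m₀ x α (ofDegZero ϖ u x) 1) : FormFiber EB ϖ V x) =
      C.horTensor x α (u x) := by
  classical
  -- Any section with the prescribed value at `x` will do, as its contribution has degree 0 and
  -- drops out in degree 1.
  rw [C.m₀_ofDegZero x α u (Function.update u x (C.cl x (α.domRestrict (Vertical EB EX ϖ x)) (u x)))
    (Function.update_self _ _ _), Pi.add_apply, ofDegZero_of_ne _ _ (by simp), zero_add,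
    horTensor_eq, Pi.single_eq_same]

theorem single_two_m₀ :
    (Pi.single 2 (C.m₀ x α (ofDegZero ϖ u x) 2) : FormFiber EB ϖ V x) = 0 := by
  rw [C.m₀_eq_zero_of_lt (ofDegZero_of_pos u x) α 2 (by omega), Pi.single_zero]

end CliffordFamily

end Symbols
end EndPeriodic
end

theorem mainTheorem12
    {EB : Type*} [NormedAddCommGroup EB] [NormedSpace ℝ EB] [FiniteDimensional ℝ EB]
    {B : Type*} [TopologicalSpace B] [ChartedSpace EB B] [IsManifold 𝓘(ℝ, EB) ∞ B]
    [T2Space B] [CompactSpace B]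
    {EY : Type*} [NormedAddCommGroup EY] [NormedSpace ℝ EY] [FiniteDimensional ℝ EY]
    {Y : Type*} [TopologicalSpace Y] [ChartedSpace EY Y] [IsManifold 𝓘(ℝ, EY) ∞ Y]
    [T2Space Y] [CompactSpace Y]
    {F : Type*} [NormedAddCommGroup F] [NormedSpace ℝ F] [FiniteDimensional ℝ F]
    {V : Y → Type*} [TopologicalSpace (TotalSpace F V)] [∀ y, AddCommGroup (V y)]
    [∀ y, Module ℝ (V y)] [∀ y, Module ℂ (V y)] [∀ y, IsScalarTower ℝ ℂ (V y)]
    [∀ y, TopologicalSpace (V y)] [∀ y, IsTopologicalAddGroup (V y)] [∀ y, ContinuousSMul ℝ (V y)]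
    [FiberBundle F V] [VectorBundle ℝ F V] [ContMDiffVectorBundle ∞ F V 𝓘(ℝ, EY)]
    {EM : Type*} [NormedAddCommGroup EM] [NormedSpace ℝ EM] [FiniteDimensional ℝ EM]
    {M : Type*} [TopologicalSpace M] [ChartedSpace EM M] [IsManifold 𝓘(ℝ, EM) ∞ M]
    [T2Space M] [SecondCountableTopology M]
    {F' : Type*} [NormedAddCommGroup F'] [NormedSpace ℝ F'] [FiniteDimensional ℝ F']
    {V' : M → Type*} [TopologicalSpace (TotalSpace F' V')] [∀ x, AddCommGroup (V' x)]
    [∀ x, Module ℝ (V' x)] [∀ x, Module ℂ (V' x)] [∀ x, IsScalarTower ℝ ℂ (V' x)]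
    [∀ x, TopologicalSpace (V' x)] [∀ x, IsTopologicalAddGroup (V' x)]
    [∀ x, ContinuousSMul ℝ (V' x)]
    [FiberBundle F' V'] [VectorBundle ℝ F' V'] [ContMDiffVectorBundle ∞ F' V' 𝓘(ℝ, EM)]
    (SB : RiemannianStructure EB B) {ϖY : Y → B} {ϖM : M → B}
    {GY : RiemannianFamily (EB := EB) (EX := EY) ϖY} (CY : CliffordFamily GY F V)
    {GM : RiemannianFamily (EB := EB) (EX := EM) ϖM} (CM : CliffordFamily GM F' V')
    (f₀ : C^∞⟮𝓘(ℝ, EY), Y; 𝓡 1, Circle⟯) (D : EndPeriodicFamily f₀ CY CM)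
    (ξ L : ℂ) (hL : Complex.exp L = ξ) :
    -- `A = D + A_[1] + A_[2]` on sections of `E → M`
    (∀ u : ∀ x, V' x, CMDiff ∞ (T% u) → ∀ x,
      CM.bismut SB (ofDegZero ϖM u) x = ofDegZero ϖM (CM.dirac u) x +
        component 1 (CM.bismut SB) (ofDegZero ϖM u) x +
        component 2 (CM.bismut SB) (ofDegZero ϖM u) x) ∧
    -- `A(Y) = D(Y) + A_[1](Y) + A_[2](Y)` on sections of `E_Y → Y`
    (∀ u : ∀ y, V y, CMDiff ∞ (T% u) → ∀ y,
      CY.bismut SB (ofDegZero ϖY u) y = ofDegZero ϖY (CY.dirac u) y +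
        component 1 (CY.bismut SB) (ofDegZero ϖY u) y +
        component 2 (CY.bismut SB) (ofDegZero ϖY u) y) ∧
    -- the indicial family of `A` is `A(Y)(ξ) = A(Y) - log ξ m₀(df)`
    (∀ Q : (∀ y, FormFiber EB ϖY V y) → ∀ y, FormFiber EB ϖY V y,
      D.IsIndicialFamily ξ L (CM.bismut SB) Q ↔
        ∀ v, SmoothForm EY F ϖY v → ∀ y,
          Q v y = CY.bismut SB v y - L • CY.m₀ y (dHeight f₀ y) (v y)) ∧
    -- the indicial family of `D` is `D(Y)(ξ) = D(Y) - log ξ cl(d_{Y/B} f)`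
    (∀ Q : (∀ y, FormFiber EB ϖY V y) → ∀ y, FormFiber EB ϖY V y,
      D.IsIndicialFamily ξ L CM.diracForm Q ↔
        ∀ v, SmoothForm EY F ϖY v → ∀ y,
          Q v y = ofDegZero ϖY (fun y => CY.dirac (degZero v) y -
            L • CY.cl y ((dHeight f₀ y).domRestrict (Vertical EB EY ϖY y)) (degZero v y)) y) ∧
    -- the indicial family of `A_[1]` is `A_[1](Y)(ξ) = A_[1](Y) - log ξ π^* d_B f`
    (∀ Q : (∀ y, FormFiber EB ϖY V y) → ∀ y, FormFiber EB ϖY V y,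
      D.IsIndicialFamily ξ L (component 1 (CM.bismut SB)) Q ↔
        ∀ v, SmoothForm EY F ϖY v → ∀ y,
          Q v y = component 1 (CY.bismut SB) v y -
            L • CY.horTensor y (dHeight f₀ y) (degZero v y)) ∧
    -- the indicial family of `A_[2]` is `A_[2](Y)`
    (∀ Q : (∀ y, FormFiber EB ϖY V y) → ∀ y, FormFiber EB ϖY V y,
      D.IsIndicialFamily ξ L (component 2 (CM.bismut SB)) Q ↔
        ∀ v, SmoothForm EY F ϖY v → ∀ y, Q v y = component 2 (CY.bismut SB) v y) ∧
    -- the decomposition of `A(Y) - log ξ m₀(df)` on sections of `E_Y → Y`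
    (∀ u : ∀ y, V y, CMDiff ∞ (T% u) → ∀ y,
      CY.bismut SB (ofDegZero ϖY u) y - L • CY.m₀ y (dHeight f₀ y) (ofDegZero ϖY u y) =
        ofDegZero ϖY (fun y => CY.dirac u y -
            L • CY.cl y ((dHeight f₀ y).domRestrict (Vertical EB EY ϖY y)) (u y)) y +
          (component 1 (CY.bismut SB) (ofDegZero ϖY u) y -
            L • CY.horTensor y (dHeight f₀ y) (u y)) +
          component 2 (CY.bismut SB) (ofDegZero ϖY u) y) := by
  have hM := D.isNatural_bismut SB
  have hY := CY.isFirstOrder_bismut SB (dHeight f₀)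
  have hσ : ∀ y (c : ℂ) e, CY.m₀ y (dHeight f₀ y) (c • e) = c • CY.m₀ y (dHeight f₀ y) e :=
    fun y c e => CY.m₀_smul_right y c _ e
  refine ⟨fun u hu x => CM.bismut_ofDegZero SB hu x, fun u hu y => CY.bismut_ofDegZero SB hu y,
    fun Q => hM.isIndicialFamily_iff hY hσ hL Q, fun Q => ?_, fun Q => ?_, fun Q => ?_,
    fun u hu y => ?_⟩
  -- `D` is the component of degree 0 of the superconnection on smooth forms, both on `M` and on
  -- `Y`.
  · refine (((hM.component 0).congr fun s hs => CM.component_zero_bismut SB hs).isIndicialFamily_iff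
      (hY.component 0) (component_symbol_smul hσ 0) hL Q).trans ?_
    refine forall₃_congr fun v hv y => ?_
    rw [CY.component_zero_bismut SB hv, CliffordFamily.ofDegZero_sub_smul,
      ← CY.single_zero_m₀ y (dHeight f₀ y) (degZero v)
        (u' := fun y => CY.cl y ((dHeight f₀ y).domRestrict (Vertical EB EY ϖY y)) (degZero v y))
        rfl]
    rfl
  · refine ((hM.component 1).isIndicialFamily_iff (hY.component 1) (component_symbol_smul hσ 1)
      hL Q).trans (forall₃_congr fun v hv y => ?_)
    rw [← CY.single_one_m₀ y (dHeight f₀ y) (degZero v)]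
    rfl
  · refine ((hM.component 2).isIndicialFamily_iff (hY.component 2) (component_symbol_smul hσ 2)
      hL Q).trans (forall₃_congr fun v hv y => ?_)
    refine Iff.of_eq (congrArg (Q v y = ·) ?_)
    refine (congrArg (fun e : FormFiber EB ϖY V y => component 2 (CY.bismut SB) v y - L • e)
      (CY.single_two_m₀ y (dHeight f₀ y) (degZero v))).trans ?_
    rw [smul_zero, sub_zero]
  · rw [CY.bismut_ofDegZero SB hu, CliffordFamily.ofDegZero_sub_smul,
      CY.m₀_ofDegZero y (dHeight f₀ y) u
        (fun y => CY.cl y ((dHeight f₀ y).domRestrict (Vertical EB EY ϖY y)) (u y)) rfl, smul_add]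
    abel
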